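/- Let $d\ge 1$ and $\mathbb{T}^d=\mathbb{R}^d/(2\pi\mathbb{Z})^d$. For $h>0$ and a Lipschitz function $\eta:\mathbb{T}^d\to\mathbb{R}$ with $\inf_{\mathbb{T}^d}\eta>-h/2$, let $\Omega=\{(x,y): x\in\mathbb{T}^d,\ -h<y<\eta(x)\}$. For real-valued $\psi\in\dot H^{1/2}(\mathbb{T}^d)$, that is, $\psi\in L^2(\mathbb{T}^d)$ with $\|\psi\|_{\dot H^{1/2}}^2:=\sum_{\xi\in\mathbb{Z}^d}|\xi|\,|\widehat\psi(\xi)|^2<\infty$, where $\widehat\psi(\xi)=(2\pi)^{-d}\int_{\mathbb{T}^d}e^{-ix\cdot\xi}\psi(x)\,dx$, let $\phi\in H^1(\Omega)$ be the variational solution of $\Delta_{x,y}\phi=0$ in $\Omega$, $\phi|_{y=\eta}=\psi$, $\partial_y\phi|_{y=-h}=0$, and let $G(\eta)\psi=\sqrt{1+|\nabla\eta|^2}\,\partial_n\phi|_{y=\eta}\in H^{-1/2}(\mathbb{T}^d)$ (Dirichlet-to-Neumann operator), with $n$ the outward unit normal; the normal derivative is understood weakly, i.e. $\int_{\mathbb{T}^d}\chi\,G(\eta)\psi\,dx=\iint_\Omega\nabla_{x,y}\phi\cdot\nabla_{x,y}\Phi\,dy\,dx$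 for every $\chi\in H^{1/2}(\mathbb{T}^d)$ and every $\Phi\in H^1(\Omega)$ with $\Phi|_{y=\eta}=\chi$. (i) There exists $C>0$ depending only on $d$ such that for all $h>0$, all Lipschitz $\eta:\mathbb{T}^d\to\mathbb{R}$ with $\inf_{\mathbb{T}^d}\eta>-h/2$, and all $\psi\in\dot H^{1/2}(\mathbb{T}^d)$, $$\int_{\mathbb{T}^d}\psi\,G(\eta)\psi\,dx\ \ge\ \frac{C\tanh(h)}{1+\|\nabla\eta\|_{L^\infty(\mathbb{T}^d)}}\,\|\psi\|^2_{\dot H^{1/2}(\mathbb{T}^d)}.$$ (ii) The dependence on $\|\nabla\eta\|_{L^\infty}$ is optimal: for every $\alpha<1$ and every $h>0$ there is no constant $C>0$ such that $$\int_{\mathbb{T}^d}\psi\,G(\eta)\psi\,dx\ \ge\ \frac{C\tanh(h)}{(1+\|\nabla\eta\|_{L^\infty(\mathbb{T}^d)})^{\alpha}}\,\|\psi\|^2_{\dot H^{1/2}(\mathbb{T}^d)}$$ holds for all Lipschitz $\eta$ with $\inf_{\mathbb{T}^d}\eta>-h/2$ and all $\psi\in\dot H^{1/2}(\mathbb{T}^d)$.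 -/

import Mathlib

open MeasureTheory Filter Topology
open scoped ContDiff ENNReal

namespace WaterWaves

/-- Horizontal space `ℝ^d` with its Euclidean structure. Functions on the torus
`𝕋^d = ℝ^d / (2πℤ)^d` are represented by `2πℤ^d`-periodic functions on it. -/
abbrev Horiz (d : ℕ) : Type := EuclideanSpace ℝ (Fin d)

/-- The integer vector `n ∈ ℤ^d`, seen in `ℝ^d`. -/
noncomputable def latticeVec {d : ℕ} (n : Fin d → ℤ) : Horiz d :=
  WithLp.toLp 2 (fun i => (n i : ℝ))

/-- `f` is a function on the torus `𝕋^d`. -/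
def IsPeriodic {d : ℕ} {α : Type*} (f : Horiz d → α) : Prop :=
  ∀ (n : Fin d → ℤ) (x : Horiz d), f (x + (2 * Real.pi) • latticeVec n) = f x

/-- `f` is a function on `𝕋^d × ℝ`. -/
def IsPeriodicX {d : ℕ} {α : Type*} (f : Horiz d × ℝ → α) : Prop :=
  ∀ y : ℝ, IsPeriodic (fun x => f (x, y))

/-- The fundamental cell `[0, 2π)^d` of the torus. -/
def cell (d : ℕ) : Set (Horiz d) :=
  {x | ∀ i, x i ∈ Set.Ico (0 : ℝ) (2 * Real.pi)}

/-- Lebesgue measure on the torus `𝕋^d` (total mass `(2π)^d`). -/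
noncomputable def torusMeasure (d : ℕ) : Measure (Horiz d) :=
  volume.restrict (cell d)

/-! ### The space `Ḣ^{1/2}(𝕋^d)` -/

/-- Fourier coefficient `(2π)^{-d} ∫_{𝕋^d} e^{-i x·ξ} f(x) dx`. -/
noncomputable def fourierCoeff {d : ℕ} (f : Horiz d → ℝ) (ξ : Fin d → ℤ) : ℂ :=
  (((2 * Real.pi) ^ d)⁻¹ : ℝ) *
    ∫ x, Complex.exp (-Complex.I * ((inner ℝ x (latticeVec ξ) : ℝ) : ℂ)) * (f x : ℂ)
      ∂(torusMeasure d)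

/-- The general term `|ξ| |f̂(ξ)|²` of the series for the square of the `Ḣ^{1/2}` norm. -/
noncomputable def hHalfTerm {d : ℕ} (f : Horiz d → ℝ) (ξ : Fin d → ℤ) : ℝ :=
  ‖(latticeVec ξ : Horiz d)‖ * ‖fourierCoeff f ξ‖ ^ 2

/-- `f ∈ Ḣ^{1/2}(𝕋^d)`. On the torus the finiteness of the seminorm forces `f` to be
square integrable, so this is a space of real `L²` functions. -/
structure MemHHalf {d : ℕ} (f : Horiz d → ℝ) : Prop where
  periodic : IsPeriodic f
  memLp : MemLp f 2 (torusMeasure d)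
  summable : Summable (hHalfTerm f)

/-- `‖f‖²_{Ḣ^{1/2}} = ∑_ξ |ξ| |f̂(ξ)|²`. -/
noncomputable def hHalfNormSq {d : ℕ} (f : Horiz d → ℝ) : ℝ :=
  ∑' ξ : Fin d → ℤ, hHalfTerm f ξ

/-! ### Surfaces and the fluid domain -/

/-- `η` is a Lipschitz function on the torus. -/
def IsLipschitzSurface {d : ℕ} (η : Horiz d → ℝ) : Prop :=
  IsPeriodic η ∧ ∃ K, LipschitzWith K η

/-- `‖∇η‖_{L^∞(𝕋^d)}`, the essential supremum of the length of the (almost everywhere defined)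
gradient. -/
noncomputable def gradSupNorm {d : ℕ} (η : Horiz d → ℝ) : ℝ :=
  (eLpNorm (fun x => gradient η x) ∞ (torusMeasure d)).toReal

/-- The periodic lift to `ℝ^d × ℝ` of `Ω = {(x, y) : -h < y < η(x)}`. -/
def fluidDomain {d : ℕ} (h : ℝ) (η : Horiz d → ℝ) : Set (Horiz d × ℝ) :=
  {p | -h < p.2 ∧ p.2 < η p.1}

/-- Lebesgue measure on `Ω ⊆ 𝕋^d × ℝ`, i.e. on one period of its lift. -/
noncomputable def fluidMeasure {d : ℕ} (h : ℝ) (η : Horiz d → ℝ) : Measure (Horiz d × ℝ) :=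
  volume.restrict (fluidDomain h η ∩ {p | p.1 ∈ cell d})

/-! ### The Sobolev space `H¹(Ω)` and traces on the free surface -/

/-- `∇_x u`. -/
noncomputable def gradX {d : ℕ} (u : Horiz d × ℝ → ℝ) (p : Horiz d × ℝ) : Horiz d :=
  gradient (fun x => u (x, p.2)) p.1

/-- `∂_y u`. -/
noncomputable def derivY {d : ℕ} (u : Horiz d × ℝ → ℝ) (p : Horiz d × ℝ) : ℝ :=
  deriv (fun y => u (p.1, y)) p.2

/-- A function on `𝕋^d × ℝ` together with a candidate for its gradient `(∇_x, ∂_y)`. -/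
structure FunWithGrad (d : ℕ) where
  /-- the function -/
  val : Horiz d × ℝ → ℝ
  /-- its horizontal gradient -/
  dx : Horiz d × ℝ → Horiz d
  /-- its vertical derivative -/
  dy : Horiz d × ℝ → ℝ

/-- `u.val ∈ H¹(Ω)`, with weak gradient `(u.dx, u.dy)`. -/
structure MemH1 {d : ℕ} (h : ℝ) (η : Horiz d → ℝ) (u : FunWithGrad d) : Prop where
  periodic_val : IsPeriodicX u.val
  periodic_dx : IsPeriodicX u.dx
  periodic_dy : IsPeriodicX u.dy
  memLp_val : MemLp u.val 2 (fluidMeasure h η)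
  memLp_dx : MemLp u.dx 2 (fluidMeasure h η)
  memLp_dy : MemLp u.dy 2 (fluidMeasure h η)
  weak_dx : ∀ θ : Horiz d × ℝ → ℝ, ContDiff ℝ ∞ θ → HasCompactSupport θ →
    tsupport θ ⊆ fluidDomain h η → ∫ p, u.val p • gradX θ p = -∫ p, θ p • u.dx p
  weak_dy : ∀ θ : Horiz d × ℝ → ℝ, ContDiff ℝ ∞ θ → HasCompactSupport θ →
    tsupport θ ⊆ fluidDomain h η → ∫ p, u.val p * derivY θ p = -∫ p, θ p * u.dy p

/-- `u ∈ H¹(Ω)` has trace `u|_{y=η} = ψ`. The trace operator is the continuous extension to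
`H¹(Ω)` of the restriction to the free surface, defined on functions that are smooth up to the
boundary. -/
def HasTrace {d : ℕ} (h : ℝ) (η : Horiz d → ℝ) (u : FunWithGrad d) (ψ : Horiz d → ℝ) : Prop :=
  ∃ U : ℕ → Horiz d × ℝ → ℝ,
    (∀ n, ContDiff ℝ ∞ (U n) ∧ IsPeriodicX (U n)) ∧
    Tendsto (fun n => eLpNorm (fun p => U n p - u.val p) 2 (fluidMeasure h η)) atTop (𝓝 0) ∧
    Tendsto (fun n => eLpNorm (fun p => gradX (U n) p - u.dx p) 2 (fluidMeasure h η))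
      atTop (𝓝 0) ∧
    Tendsto (fun n => eLpNorm (fun p => derivY (U n) p - u.dy p) 2 (fluidMeasure h η))
      atTop (𝓝 0) ∧
    Tendsto (fun n => eLpNorm (fun x => U n (x, η x) - ψ x) 2 (torusMeasure d)) atTop (𝓝 0)

/-- The Dirichlet form `∬_Ω ∇_{x,y} u · ∇_{x,y} v dy dx`. -/
noncomputable def dirichletForm {d : ℕ} (h : ℝ) (η : Horiz d → ℝ) (u v : FunWithGrad d) : ℝ :=
  ∫ p, (inner ℝ (u.dx p) (v.dx p) + u.dy p * v.dy p) ∂(fluidMeasure h η)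

/-! ### The Dirichlet-to-Neumann operator -/

/-- `φ` is the variational solution of `Δ_{x,y} φ = 0` in `Ω`, `φ|_{y=η} = ψ`,
`∂_y φ|_{y=-h} = 0`. The test functions vanish on the free surface only, which encodes the
Neumann condition at the bottom. -/
structure IsVariationalSolution {d : ℕ} (h : ℝ) (η ψ : Horiz d → ℝ) (φ : FunWithGrad d) :
    Prop where
  memH1 : MemH1 h η φ
  trace : HasTrace h η φ ψ
  weak : ∀ θ : FunWithGrad d, MemH1 h η θ → HasTrace h η θ (fun _ => 0) →
    dirichletForm h η φ θ = 0

/-- `r` is the value of the distribution `G(η)ψ = √(1+|∇η|²) ∂_n φ|_{y=η} ∈ H^{-1/2}(𝕋^d)` at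
`χ`, by Green's formula: `⟨G(η)ψ, χ⟩ = ∬_Ω ∇φ · ∇Φ`, where `φ` is the variational solution with
data `ψ` and `Φ ∈ H¹(Ω)` is any function with trace `χ` on the free surface. -/
def IsDNValue {d : ℕ} (h : ℝ) (η ψ χ : Horiz d → ℝ) (r : ℝ) : Prop :=
  ∃ φ : FunWithGrad d, IsVariationalSolution h η ψ φ ∧
    ∃ Φ : FunWithGrad d, MemH1 h η Φ ∧ HasTrace h η Φ χ ∧ dirichletForm h η φ Φ = r

open Classical in
/-- The Dirichlet-to-Neumann operator: `dirichletToNeumann h η ψ χ` is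
`⟨G(η)ψ, χ⟩ = ∫_{𝕋^d} χ G(η)ψ dx` (duality of `H^{-1/2}` and `H^{1/2}`). The value does not depend
on the choice made; it would be `0` if there were no variational solution. -/
noncomputable def dirichletToNeumann {d : ℕ} (h : ℝ) (η ψ : Horiz d → ℝ) :
    (Horiz d → ℝ) → ℝ :=
  fun χ => if H : ∃ r, IsDNValue h η ψ χ r then H.choose else 0

end WaterWaves

/-! The value of `G(η)ψ` at `ψ` is the Dirichlet energy of the variational solution, so the lower
bound is a trace inequality: the energy of an extension of `ψ` controls its `Ḣ^{1/2}` seminorm.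

For a smooth extension `U`, consider its traces on the translates of the surface at depth `s`. At
each frequency `ξ`, the coefficient on the surface and the one at depth `s` differ by an integral of
coefficients of `∂_y U`. Averaging over `0 < s < l/|ξ|` bounds `|ξ|` times the squared surface
coefficient by `1/l` times a tangential gradient term plus `l` times a term in `∂_y U`
(`mul_norm_sq_le_of_eq_add_integral`). The tangential gradient is `∇_x U + ∂_y U ∇η`, whose square
is at most of order `(1+L)²` times the energy density, where `L = ‖∇η‖_∞`. The choice `l = 1+L`
balances the two terms at order `1+L`: linear growth, not quadratic. Since the translates may leave
the fluid, they are stopped at a flat level between `-h` and `-h/2`. The stopped part costs the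
gradient on that slice, and a level can be chosen where this is at most `2/h` times the energy
(`exists_level`). The total `6 + 4/h` is at most `10 / tanh h`. `sum_hHalfTerm_le_of_smooth`
assembles this, and `hHalfNormSq_le_dirichletForm` passes to `H¹(Ω)`.

The bound for `dirichletToNeumann` also needs existence of the variational solution. Trigonometric
sums damped by `e^{|ξ|(y-ζ(x))}`, with `ζ` a smooth approximation of `η` from above, extend
truncations of `ψ` with bounded energy (`MemHHalf.exists_extension`). A weak limit of their
gradients, minus its projection on the gradients with zero trace, solves the problem
(`exists_isVariationalSolution`). The Poincaré inequality recovers a function from its gradient and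
trace.

For optimality, take the datum equal to the surface, `ψ = η = (h/4) cos(n x_j)`. By Dirichlet's
principle the extension `y` shows that the energy is at most the volume of one period of the fluid,
bounded in `n`. The squared seminorm grows at least like `n` while the slope is at most of order
`n`, so every exponent below `1` fails as `n → ∞`. -/

namespace WaterWaves

/-! ### Fourier analysis on the torus -/

/-- The character `x ↦ e^{i x·ξ}`. -/
noncomputable def wave {d : ℕ} (ξ : Fin d → ℤ) (x : Horiz d) : ℂ :=
  Complex.exp (Complex.I * ((inner ℝ x (latticeVec ξ) : ℝ) : ℂ))

/-- The Haar probability measure of `(ℝ/ℤ)^d`. -/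
noncomputable abbrev torusHaar (d : ℕ) : Measure (UnitAddTorus (Fin d)) :=
  Measure.pi (fun _ => AddCircle.haarAddCircle)

/-- The covering map `ℝ^d → (ℝ/ℤ)^d` with periods `2π`. -/
noncomputable def toTorus {d : ℕ} (x : Horiz d) : UnitAddTorus (Fin d) :=
  fun i => ((x i * (2 * Real.pi)⁻¹ : ℝ) : UnitAddCircle)

/-- The section of the covering map with values in the fundamental cell. -/
noncomputable def ofTorus {d : ℕ} (q : UnitAddTorus (Fin d)) : Horiz d :=
  WithLp.toLp 2 (fun i => ((AddCircle.equivIco (1 : ℝ) 0 (q i) : ℝ)) * (2 * Real.pi))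

lemma measurableSet_cell (d : ℕ) : MeasurableSet (cell d) := by
  have : cell d = ⋂ i, (fun x : Horiz d => x i) ⁻¹' Set.Ico (0 : ℝ) (2 * Real.pi) := by
    ext x; simp [cell]
  rw [this]
  exact MeasurableSet.iInter fun i => (by fun_prop : Measurable fun x : Horiz d => x i)
    measurableSet_Ico

lemma toTorus_ofTorus {d : ℕ} (q : UnitAddTorus (Fin d)) : toTorus (ofTorus q) = q := by
  funext i
  have : (2 * Real.pi) ≠ 0 := by positivity
  simp only [toTorus, ofTorus]
  rw [mul_inv_cancel_right₀ this]
  exact AddCircle.coe_equivIco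

lemma ofTorus_mem_cell {d : ℕ} (q : UnitAddTorus (Fin d)) : ofTorus q ∈ cell d := by
  intro i
  have h := (AddCircle.equivIco (1 : ℝ) 0 (q i)).2
  have hp : 0 < 2 * Real.pi := by positivity
  simp only [ofTorus, Set.mem_Ico] at h ⊢
  constructor
  · exact mul_nonneg h.1 hp.le
  · nlinarith [h.2]

lemma exists_ofTorus_toTorus {d : ℕ} (x : Horiz d) :
    ∃ n : Fin d → ℤ, ofTorus (toTorus x) = x + (2 * Real.pi) • latticeVec n := by
  refine ⟨fun i => -⌊x i * (2 * Real.pi)⁻¹⌋, ?_⟩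
  have : (2 * Real.pi) ≠ 0 := by positivity
  ext i
  simp only [ofTorus, toTorus, AddCircle.coe_equivIco_mk_apply, latticeVec, PiLp.add_apply,
    PiLp.smul_apply, smul_eq_mul, div_one, mul_one, Int.fract]
  push_cast
  field_simp
  ring

lemma ofTorus_toTorus_of_mem {d : ℕ} {x : Horiz d} (hx : x ∈ cell d) :
    ofTorus (toTorus x) = x := by
  ext i
  have h := hx i
  have hp : 0 < 2 * Real.pi := by positivity
  simp only [ofTorus, toTorus, AddCircle.coe_equivIco_mk_apply, div_one, mul_one]
  rw [Int.fract_eq_self.2, inv_mul_cancel_right₀ hp.ne']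
  constructor
  · exact mul_nonneg h.1 (by positivity)
  · rw [← div_eq_mul_inv, div_lt_one hp]; exact h.2

lemma IsPeriodic.ofTorus_toTorus {d : ℕ} {α : Type*} {f : Horiz d → α} (hf : IsPeriodic f)
    (x : Horiz d) : f (ofTorus (toTorus x)) = f x := by
  obtain ⟨n, hn⟩ := exists_ofTorus_toTorus x
  rw [hn, hf]

lemma measurable_toTorus {d : ℕ} : Measurable (toTorus : Horiz d → _) := by
  refine measurable_pi_lambda _ fun i => ?_
  exact AddCircle.measurable_mk'.comp (by fun_prop)

lemma measurable_ofTorus {d : ℕ} : Measurable (ofTorus : _ → Horiz d) := by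
  have h : Measurable fun q : UnitAddTorus (Fin d) =>
      fun i => ((AddCircle.equivIco (1 : ℝ) 0 (q i) : ℝ)) * (2 * Real.pi) := by
    refine measurable_pi_lambda _ fun i => Measurable.mul_const ?_ _
    exact measurable_subtype_coe.comp
      ((AddCircle.measurableEquivIco (1 : ℝ) 0).measurable.comp (measurable_pi_apply i))
  exact (PiLp.volume_preserving_toLp (Fin d)).measurable.comp h

lemma toTorus_add {d : ℕ} (x y : Horiz d) : toTorus (x + y) = toTorus x + toTorus y := by
  funext i
  simp [toTorus, add_mul]

lemma measurePreserving_toTorus_coord :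
    MeasurePreserving (fun t : ℝ => ((t * (2 * Real.pi)⁻¹ : ℝ) : UnitAddCircle))
      (volume.restrict (Set.Ico 0 (2 * Real.pi)))
      (ENNReal.ofReal (2 * Real.pi) • AddCircle.haarAddCircle) := by
  have hp : 0 < 2 * Real.pi := by positivity
  have h1 : MeasurePreserving (fun t : ℝ => t * (2 * Real.pi)⁻¹)
      (volume.restrict (Set.Ico 0 (2 * Real.pi)))
      (ENNReal.ofReal (2 * Real.pi) • volume.restrict (Set.Ioc (0 : ℝ) (0 + 1))) := by
    refine ⟨by fun_prop, ?_⟩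
    have h2 : Set.Ico 0 (2 * Real.pi) = (fun t : ℝ => t * (2 * Real.pi)⁻¹) ⁻¹' Set.Ico 0 1 := by
      ext t
      simp only [Set.mem_Ico, Set.mem_preimage, ← div_eq_mul_inv]
      rw [div_lt_one hp, le_div_iff₀ hp, zero_mul]
    rw [h2, ← Measure.restrict_map (by fun_prop) measurableSet_Ico,
      Real.map_volume_mul_right (by positivity), inv_inv, abs_of_pos hp, zero_add,
      ← restrict_Ico_eq_restrict_Ioc, Measure.restrict_smul]
  have h3 := AddCircle.measurePreserving_mk (1 : ℝ) 0
  refine ⟨AddCircle.measurable_mk'.comp h1.measurable, ?_⟩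
  rw [show (fun t : ℝ => ((t * (2 * Real.pi)⁻¹ : ℝ) : UnitAddCircle)) =
    (fun t : ℝ => (t : UnitAddCircle)) ∘ fun t : ℝ => t * (2 * Real.pi)⁻¹ from rfl,
    ← Measure.map_map h3.measurable h1.measurable, h1.map_eq, Measure.map_smul, h3.map_eq,
    AddCircle.volume_eq_smul_haarAddCircle]
  simp

/-- The measure on the cell is a product, so the one-dimensional rescaling applies in each
coordinate. The factor appears because the Haar measure is normalised while the cell has volume
`(2π)^d`. -/
lemma measurePreserving_toTorus (d : ℕ) :
    MeasurePreserving (toTorus : Horiz d → _) (torusMeasure d)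
      (ENNReal.ofReal ((2 * Real.pi) ^ d) • torusHaar d) := by
  have : IsFiniteMeasure (ENNReal.ofReal (2 * Real.pi) •
      (AddCircle.haarAddCircle : Measure UnitAddCircle)) :=
    Measure.smul_finite _ ENNReal.ofReal_ne_top
  have h1 := measurePreserving_pi (ι := Fin d) (fun _ => volume.restrict (Set.Ico 0 (2 * Real.pi)))
    (fun _ => ENNReal.ofReal (2 * Real.pi) • AddCircle.haarAddCircle)
    (hν := fun _ => inferInstance) (fun _ => measurePreserving_toTorus_coord)
  have h2 : Measure.pi (fun _ : Fin d => ENNReal.ofReal (2 * Real.pi) •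
      (AddCircle.haarAddCircle : Measure UnitAddCircle)) =
      ENNReal.ofReal ((2 * Real.pi) ^ d) • torusHaar d := by
    refine Measure.pi_eq fun s hs => ?_
    simp only [Measure.smul_apply, smul_eq_mul, Finset.prod_mul_distrib, Finset.prod_const,
      Finset.card_univ, Fintype.card_fin]
    rw [Measure.pi_pi, ENNReal.ofReal_pow (by positivity)]
  have h3 : MeasurePreserving (@WithLp.ofLp 2 (Fin d → ℝ)) (torusMeasure d)
      (Measure.pi fun _ => volume.restrict (Set.Ico 0 (2 * Real.pi))) := by
    rw [← Measure.restrict_pi_pi]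
    have h4 := (PiLp.volume_preserving_ofLp (Fin d)).restrict_preimage
      (s := Set.pi Set.univ fun _ => Set.Ico 0 (2 * Real.pi))
      (MeasurableSet.univ_pi fun _ => measurableSet_Ico)
    convert h4 using 2
    · rw [torusMeasure]; congr 1; ext x; simp [cell]
    · rfl
  rw [h2] at h1
  exact h1.comp h3

instance (d : ℕ) : IsFiniteMeasure (torusMeasure d) := by
  refine ⟨?_⟩
  have h := (measurePreserving_toTorus d).measure_preimage MeasurableSet.univ.nullMeasurableSet
  rw [Set.preimage_univ] at h
  rw [h]
  have := Measure.smul_finite (torusHaar d) (c := ENNReal.ofReal ((2 * Real.pi) ^ d))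
    ENNReal.ofReal_ne_top
  exact measure_lt_top _ _

lemma measurePreserving_ofTorus (d : ℕ) :
    MeasurePreserving (ofTorus : _ → Horiz d)
      (ENNReal.ofReal ((2 * Real.pi) ^ d) • torusHaar d) (torusMeasure d) := by
  refine ⟨measurable_ofTorus, ?_⟩
  rw [← (measurePreserving_toTorus d).map_eq, Measure.map_map measurable_ofTorus measurable_toTorus]
  have : (ofTorus ∘ toTorus : Horiz d → Horiz d) =ᵐ[torusMeasure d] id := by
    filter_upwards [ae_restrict_mem (measurableSet_cell d)] with x hx
    exact ofTorus_toTorus_of_mem hx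
  rw [Measure.map_congr this, Measure.map_id]

lemma wave_ofTorus {d : ℕ} (ξ : Fin d → ℤ) (q : UnitAddTorus (Fin d)) :
    wave ξ (ofTorus q) = UnitAddTorus.mFourier ξ q := by
  conv_rhs => rw [← toTorus_ofTorus q]
  have : (Real.pi : ℂ) ≠ 0 := by exact_mod_cast Real.pi_ne_zero
  simp only [wave, UnitAddTorus.mFourier, ContinuousMap.coe_mk, toTorus, fourier_coe_apply,
    ← Complex.exp_sum, latticeVec, PiLp.inner_apply, RCLike.inner_apply, conj_trivial]
  push_cast
  rw [Finset.mul_sum]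
  congr 1
  refine Finset.sum_congr rfl fun i _ => ?_
  field_simp

lemma norm_wave {d : ℕ} (ξ : Fin d → ℤ) (x : Horiz d) : ‖wave ξ x‖ = 1 := by
  rw [wave, mul_comm, Complex.norm_exp_ofReal_mul_I]

lemma contDiff_wave {d : ℕ} (ξ : Fin d → ℤ) : ContDiff ℝ ∞ (wave ξ : Horiz d → ℂ) := by
  unfold wave
  refine Complex.contDiff_exp.comp ?_
  refine contDiff_const.mul (Complex.ofRealCLM.contDiff.comp ?_)
  exact contDiff_id.inner ℝ contDiff_const

lemma continuous_wave {d : ℕ} (ξ : Fin d → ℤ) : Continuous (wave ξ : Horiz d → ℂ) :=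
  (contDiff_wave ξ).continuous

lemma wave_add {d : ℕ} (ξ : Fin d → ℤ) (x y : Horiz d) :
    wave ξ (x + y) = wave ξ x * wave ξ y := by
  simp only [wave, ← Complex.exp_add, inner_add_left]
  push_cast; ring_nf

lemma wave_latticeVec {d : ℕ} (ξ n : Fin d → ℤ) :
    wave ξ ((2 * Real.pi) • latticeVec n : Horiz d) = 1 := by
  have : (inner ℝ ((2 * Real.pi) • latticeVec n : Horiz d) (latticeVec ξ) : ℝ) =
      ((∑ i, ξ i * n i : ℤ) : ℝ) * (2 * Real.pi) := by
    simp only [inner_smul_left, latticeVec, PiLp.inner_apply, RCLike.inner_apply, conj_trivial]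
    push_cast
    ring
  rw [wave, this]
  push_cast
  have h := Complex.exp_int_mul_two_pi_mul_I (∑ i, ξ i * n i)
  push_cast at h
  rw [← h]; congr 1; ring

lemma isPeriodic_wave {d : ℕ} (ξ : Fin d → ℤ) : IsPeriodic (wave ξ : Horiz d → ℂ) := by
  intro n x
  rw [wave_add, wave_latticeVec, mul_one]

lemma conj_wave {d : ℕ} (ξ : Fin d → ℤ) (x : Horiz d) :
    (starRingEnd ℂ) (wave ξ x) = wave (-ξ) x := by
  have : latticeVec (-ξ) = -(latticeVec ξ : Horiz d) := by ext i; simp [latticeVec]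
  simp [wave, ← Complex.exp_conj, this, inner_neg_right]

lemma fourierCoeff_eq {d : ℕ} (f : Horiz d → ℝ) (ξ : Fin d → ℤ) :
    fourierCoeff f ξ = (((2 * Real.pi) ^ d)⁻¹ : ℝ) *
      ∫ x, (starRingEnd ℂ) (wave ξ x) * (f x : ℂ) ∂(torusMeasure d) := by
  simp only [fourierCoeff, wave, ← Complex.exp_conj]
  simp

lemma integral_torusMeasure {d : ℕ} {F : Type*} [NormedAddCommGroup F] [NormedSpace ℝ F]
    {g : Horiz d → F} (hg : AEStronglyMeasurable g (torusMeasure d)) :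
    ∫ x, g x ∂(torusMeasure d) = ((2 * Real.pi) ^ d : ℝ) • ∫ q, g (ofTorus q) ∂(torusHaar d) := by
  have h := measurePreserving_ofTorus d
  rw [← h.map_eq, integral_map measurable_ofTorus.aemeasurable (by rwa [h.map_eq]),
    integral_smul_measure, ENNReal.toReal_ofReal (by positivity)]

/-- The cell is not invariant under translation. For periodic integrands the integral moves to the
quotient group, where Haar measure is invariant. -/
lemma integral_torusMeasure_add {d : ℕ} {F : Type*} [NormedAddCommGroup F] [NormedSpace ℝ F]
    {g : Horiz d → F} (hg : IsPeriodic g) (hc : Continuous g) (a : Horiz d) :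
    ∫ x, g (x + a) ∂(torusMeasure d) = ∫ x, g x ∂(torusMeasure d) := by
  rw [integral_torusMeasure (by fun_prop), integral_torusMeasure (by fun_prop)]
  congr 1
  have : ∀ q, g (ofTorus q + a) = (fun q => g (ofTorus q)) (q + toTorus a) := by
    intro q
    simp only
    rw [← hg.ofTorus_toTorus, toTorus_add, toTorus_ofTorus]
  simp_rw [this]
  exact integral_add_right_eq_self (μ := torusHaar d) (fun q => g (ofTorus q)) (toTorus a)

lemma MemLp.comp_ofTorus {d : ℕ} {F : Type*} [NormedAddCommGroup F] {g : Horiz d → F}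
    (hg : MemLp g 2 (torusMeasure d)) : MemLp (fun q => g (ofTorus q)) 2 (torusHaar d) := by
  have h := hg.comp_measurePreserving (measurePreserving_ofTorus d)
  have h2 : torusHaar d = (ENNReal.ofReal ((2 * Real.pi) ^ d))⁻¹ •
      (ENNReal.ofReal ((2 * Real.pi) ^ d) • torusHaar d) := by
    rw [smul_smul, ENNReal.inv_mul_cancel (by simp; positivity) ENNReal.ofReal_ne_top, one_smul]
  rw [h2]
  exact h.smul_measure (by simp; positivity)

lemma toLp_mFourier_orthonormal (d : ℕ) : Orthonormal ℂ
    (fun n : Fin d → ℤ => ContinuousMap.toLp (E := ℂ) 2 (torusHaar d) ℂ (UnitAddTorus.mFourier n)) :=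
  UnitAddTorus.orthonormal_mFourier

lemma hasSum_mFourier {d : ℕ} (f : Lp ℂ 2 (torusHaar d)) :
    HasSum (fun n : Fin d → ℤ =>
      (∫ q, UnitAddTorus.mFourier (-n) q * f q ∂(torusHaar d)) •
        ContinuousMap.toLp (E := ℂ) 2 (torusHaar d) ℂ (UnitAddTorus.mFourier n)) f :=
  UnitAddTorus.hasSum_mFourier_series_L2 f

lemma hasSum_sq_mFourier {d : ℕ} (f : Lp ℂ 2 (torusHaar d)) :
    HasSum (fun n : Fin d → ℤ => ‖∫ q, UnitAddTorus.mFourier (-n) q * f q ∂(torusHaar d)‖ ^ 2)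
      (∫ q, ‖f q‖ ^ 2 ∂(torusHaar d)) :=
  UnitAddTorus.hasSum_sq_mFourierCoeff f

lemma eLpNorm_two_sq {α F : Type*} [MeasurableSpace α] {μ : Measure α} [NormedAddCommGroup F]
    (f : α → F) : eLpNorm f 2 μ ^ 2 = ∫⁻ x, ‖f x‖ₑ ^ 2 ∂μ := by
  rw [eLpNorm_eq_lintegral_rpow_enorm_toReal (by norm_num) (by norm_num)]
  rw [← ENNReal.rpow_natCast, ← ENNReal.rpow_mul]
  norm_num

lemma integral_norm_sq {α F : Type*} [MeasurableSpace α] {μ : Measure α} [NormedAddCommGroup F]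
    {f : α → F} (hf : AEStronglyMeasurable f μ) :
    ∫ x, ‖f x‖ ^ 2 ∂μ = (eLpNorm f 2 μ).toReal ^ 2 := by
  rw [← ENNReal.toReal_pow, eLpNorm_two_sq, integral_eq_lintegral_of_nonneg_ae]
  · congr 1
    refine lintegral_congr fun x => ?_
    rw [ENNReal.ofReal_pow (norm_nonneg _), ofReal_norm]
  · exact Eventually.of_forall fun x => by positivity
  · exact hf.norm.pow 2

/-- The prefactor `(2π)^{-d}` cancels the volume of the cell, which gives access to the Hilbert
basis of characters on `(ℝ/ℤ)^d`. -/
lemma fourierCoeff_eq_integral_haar {d : ℕ} {f : Horiz d → ℝ}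
    (hf : AEStronglyMeasurable f (torusMeasure d)) (ξ : Fin d → ℤ) :
    fourierCoeff f ξ =
      ∫ q, UnitAddTorus.mFourier (-ξ) q * (f (ofTorus q) : ℂ) ∂(torusHaar d) := by
  have hm : AEStronglyMeasurable
      (fun x => (starRingEnd ℂ) (wave ξ x) * (f x : ℂ)) (torusMeasure d) :=
    (RCLike.continuous_conj.comp (continuous_wave ξ)).aestronglyMeasurable.mul
      (Complex.continuous_ofReal.comp_aestronglyMeasurable hf)
  rw [fourierCoeff_eq, integral_torusMeasure hm, Complex.real_smul, ← mul_assoc,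
    ← Complex.ofReal_mul, inv_mul_cancel₀ (by positivity), Complex.ofReal_one, one_mul]
  simp only [conj_wave, ← wave_ofTorus]

lemma memLp_ofReal_ofTorus {d : ℕ} {f : Horiz d → ℝ} (hf : MemLp f 2 (torusMeasure d)) :
    MemLp (fun q => (f (ofTorus q) : ℂ)) 2 (torusHaar d) :=
  (MemLp.comp_ofTorus hf).ofReal

lemma hasSum_sq_fourierCoeff {d : ℕ} {f : Horiz d → ℝ} (hf : MemLp f 2 (torusMeasure d)) :
    HasSum (fun ξ => ‖fourierCoeff f ξ‖ ^ 2)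
      (((2 * Real.pi) ^ d)⁻¹ * ∫ x, f x ^ 2 ∂(torusMeasure d)) := by
  have hL := memLp_ofReal_ofTorus hf
  have h := hasSum_sq_mFourier hL.toLp
  convert h using 1
  · funext ξ
    rw [fourierCoeff_eq_integral_haar hf.1]
    congr 2
    refine integral_congr_ae ?_
    filter_upwards [hL.coeFn_toLp] with q hq
    rw [hq]
  · rw [integral_torusMeasure (hf.integrable_sq.1), smul_eq_mul, inv_mul_cancel_left₀ (by positivity)]
    refine integral_congr_ae ?_
    filter_upwards [hL.coeFn_toLp] with q hq
    rw [hq]; simp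

lemma sum_sq_fourierCoeff_le {d : ℕ} {f : Horiz d → ℝ} (hf : MemLp f 2 (torusMeasure d))
    (F : Finset (Fin d → ℤ)) :
    ∑ ξ ∈ F, ‖fourierCoeff f ξ‖ ^ 2 ≤
      ((2 * Real.pi) ^ d)⁻¹ * ∫ x, f x ^ 2 ∂(torusMeasure d) :=
  sum_le_hasSum F (fun _ _ => by positivity) (hasSum_sq_fourierCoeff hf)

lemma fourierCoeff_sub {d : ℕ} {f g : Horiz d → ℝ} (hf : MemLp f 2 (torusMeasure d))
    (hg : MemLp g 2 (torusMeasure d)) (ξ : Fin d → ℤ) :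
    fourierCoeff (fun x => f x - g x) ξ = fourierCoeff f ξ - fourierCoeff g ξ := by
  have key : ∀ {u : Horiz d → ℝ}, MemLp u 2 (torusMeasure d) →
      Integrable (fun x => (starRingEnd ℂ) (wave ξ x) * (u x : ℂ)) (torusMeasure d) := by
    intro u hu
    have hu1 : Integrable (fun x => (u x : ℂ)) (torusMeasure d) :=
      (hu.integrable (by norm_num)).ofReal
    refine hu1.bdd_mul (c := 1)
      (RCLike.continuous_conj.comp (continuous_wave ξ)).aestronglyMeasurable ?_
    exact Eventually.of_forall fun x => by simp [norm_wave]
  simp only [fourierCoeff_eq]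
  rw [← mul_sub, ← integral_sub (key hf) (key hg)]
  congr 2
  funext x
  push_cast; ring

/-- Continuity of the Fourier coefficients for convergence in the mean. -/
lemma tendsto_fourierCoeff {d : ℕ} {f : ℕ → Horiz d → ℝ} {g : Horiz d → ℝ}
    (hf : ∀ n, MemLp (f n) 2 (torusMeasure d)) (hg : MemLp g 2 (torusMeasure d))
    (h : Tendsto (fun n => eLpNorm (fun x => f n x - g x) 2 (torusMeasure d)) atTop (𝓝 0))
    (ξ : Fin d → ℤ) :
    Tendsto (fun n => fourierCoeff (f n) ξ) atTop (𝓝 (fourierCoeff g ξ)) := by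
  rw [tendsto_iff_norm_sub_tendsto_zero]
  have h1 : Tendsto (fun n => ((2 * Real.pi) ^ d)⁻¹ *
      ((eLpNorm (fun x => f n x - g x) 2 (torusMeasure d)).toReal) ^ 2) atTop (𝓝 0) := by
    have := (((ENNReal.tendsto_toReal ENNReal.zero_ne_top).comp h).pow 2).const_mul
      (((2 * Real.pi) ^ d)⁻¹)
    simpa using this
  have h2 : Tendsto (fun n => ‖fourierCoeff (f n) ξ - fourierCoeff g ξ‖ ^ 2) atTop (𝓝 0) := by
    refine squeeze_zero (fun _ => by positivity) (fun n => ?_) h1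
    rw [← fourierCoeff_sub (hf n) hg]
    have h3 := sum_sq_fourierCoeff_le ((hf n).sub hg) {ξ}
    rw [Finset.sum_singleton] at h3
    refine h3.trans_eq ?_
    congr 1
    refine Eq.trans ?_ (integral_norm_sq ((hf n).sub hg).1)
    simp
  have h4 := h2.sqrt
  simpa using h4

lemma integral_norm_sq_trigPoly {d : ℕ} (F : Finset (Fin d → ℤ)) (a : (Fin d → ℤ) → ℂ) :
    ∫ x, ‖∑ ξ ∈ F, a ξ * wave ξ x‖ ^ 2 ∂(torusMeasure d) =
      (2 * Real.pi) ^ d * ∑ ξ ∈ F, ‖a ξ‖ ^ 2 := by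
  have hc : Continuous fun x : Horiz d => ∑ ξ ∈ F, a ξ * wave ξ x :=
    continuous_finsetSum _ fun ξ _ => continuous_const.mul (continuous_wave ξ)
  rw [integral_torusMeasure (g := fun x => ‖∑ ξ ∈ F, a ξ * wave ξ x‖ ^ 2)
    (hc.norm.pow 2).aestronglyMeasurable, smul_eq_mul]
  congr 1
  set v := fun n : Fin d → ℤ =>
    ContinuousMap.toLp (E := ℂ) 2 (torusHaar d) ℂ (UnitAddTorus.mFourier n) with hv
  have h1 : ‖∑ ξ ∈ F, a ξ • v ξ‖ ^ 2 = ∑ ξ ∈ F, ‖a ξ‖ ^ 2 := by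
    have := (toLp_mFourier_orthonormal d).inner_sum a a F
    have h2 := inner_self_eq_norm_sq_to_K (𝕜 := ℂ) (∑ ξ ∈ F, a ξ • v ξ)
    rw [this] at h2
    have h3 : ((∑ ξ ∈ F, ‖a ξ‖ ^ 2 : ℝ) : ℂ) = ((‖∑ ξ ∈ F, a ξ • v ξ‖ ^ 2 : ℝ) : ℂ) := by
      push_cast
      rw [← RCLike.ofReal_eq_complex_ofReal] 
      rw [← h2]
      refine Finset.sum_congr rfl fun ξ _ => ?_
      rw [mul_comm, Complex.mul_conj, Complex.normSq_eq_norm_sq]; push_cast; rfl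
    exact_mod_cast h3.symm
  have h4 : ∑ ξ ∈ F, a ξ • v ξ = ContinuousMap.toLp (E := ℂ) 2 (torusHaar d) ℂ
      (∑ ξ ∈ F, a ξ • UnitAddTorus.mFourier ξ) := by
    rw [map_sum]; simp [hv]
  rw [← h1, h4, Lp.norm_def, ← integral_norm_sq (Lp.aestronglyMeasurable _)]
  refine integral_congr_ae ?_
  filter_upwards [ContinuousMap.coeFn_toLp (p := 2) (𝕜 := ℂ) (torusHaar d)
    (∑ ξ ∈ F, a ξ • UnitAddTorus.mFourier ξ)] with q hq
  rw [hq]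
  simp [wave_ofTorus]

/-- The Fourier series of a square integrable function converges in the mean. -/
lemma tendsto_trigPoly_sub {d : ℕ} {f : Horiz d → ℝ} (hf : MemLp f 2 (torusMeasure d)) :
    Tendsto (fun F : Finset (Fin d → ℤ) =>
      eLpNorm (fun x => (∑ ξ ∈ F, fourierCoeff f ξ * wave ξ x).re - f x) 2 (torusMeasure d))
      atTop (𝓝 0) := by
  have hL := memLp_ofReal_ofTorus hf
  have h := hasSum_mFourier (hL.toLp _)
  have hcoef : ∀ ξ : Fin d → ℤ,
      ∫ q, UnitAddTorus.mFourier (-ξ) q * (hL.toLp _ : UnitAddTorus (Fin d) → ℂ) q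
        ∂(torusHaar d) = fourierCoeff f ξ := by
    intro ξ
    rw [fourierCoeff_eq_integral_haar hf.1]
    refine integral_congr_ae ?_
    filter_upwards [hL.coeFn_toLp] with q hq
    rw [hq]
  simp only [hcoef] at h
  have h1 : Tendsto (fun F : Finset (Fin d → ℤ) =>
      eLpNorm (fun q => ∑ ξ ∈ F, fourierCoeff f ξ * wave ξ (ofTorus q) - (f (ofTorus q) : ℂ)) 2
        (torusHaar d)) atTop (𝓝 0) := by
    have h2 := (Lp.tendsto_Lp_iff_tendsto_eLpNorm _ _ hL).1 h
    refine h2.congr fun F => eLpNorm_congr_ae ?_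
    have h4 : ∑ ξ ∈ F, fourierCoeff f ξ •
        ContinuousMap.toLp (E := ℂ) 2 (torusHaar d) ℂ (UnitAddTorus.mFourier ξ) =
        ContinuousMap.toLp (E := ℂ) 2 (torusHaar d) ℂ
        (∑ ξ ∈ F, fourierCoeff f ξ • UnitAddTorus.mFourier ξ) := by
      rw [map_sum]; simp
    rw [h4]
    filter_upwards [ContinuousMap.coeFn_toLp (p := 2) (𝕜 := ℂ) (torusHaar d)
      (∑ ξ ∈ F, fourierCoeff f ξ • UnitAddTorus.mFourier ξ)] with q hq
    rw [Pi.sub_apply, hq]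
    simp [wave_ofTorus]
  have hc : ENNReal.ofReal ((2 * Real.pi) ^ d) ^ (1 / (2 : ℝ≥0∞)).toReal ≠ ⊤ :=
    ENNReal.rpow_ne_top_of_nonneg ENNReal.toReal_nonneg ENNReal.ofReal_ne_top
  have h5 := ENNReal.Tendsto.const_mul h1 (Or.inr hc)
  rw [mul_zero] at h5
  refine tendsto_of_tendsto_of_tendsto_of_le_of_le tendsto_const_nhds h5 (fun _ => zero_le) ?_
  intro F
  beta_reduce
  have hm : AEStronglyMeasurable
      (fun x => (∑ ξ ∈ F, fourierCoeff f ξ * wave ξ x).re - f x) (torusMeasure d) := by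
    have hcont : Continuous fun x : Horiz d => (∑ ξ ∈ F, fourierCoeff f ξ * wave ξ x).re :=
      Complex.continuous_re.comp
        (continuous_finsetSum _ fun ξ _ => continuous_const.mul (continuous_wave ξ))
    exact hcont.aestronglyMeasurable.sub hf.1
  rw [← eLpNorm_comp_measurePreserving hm (measurePreserving_ofTorus d),
    eLpNorm_smul_measure_of_ne_top (by norm_num), smul_eq_mul]
  -- As `f` is real, the error of the real part is the real part of the complex error.
  refine mul_le_mul' le_rfl (eLpNorm_mono fun q => ?_)
  have := Complex.abs_re_le_norm
    (∑ ξ ∈ F, fourierCoeff f ξ * wave ξ (ofTorus q) - (f (ofTorus q) : ℂ))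
  simpa using this

lemma isBounded_cell (d : ℕ) : Bornology.IsBounded (cell d) := by
  rw [isBounded_iff_forall_norm_le]
  refine ⟨√(∑ _i : Fin d, (2 * Real.pi) ^ 2), fun x hx => ?_⟩
  rw [EuclideanSpace.norm_eq]
  refine Real.sqrt_le_sqrt (Finset.sum_le_sum fun i _ => ?_)
  have h := hx i
  rw [Real.norm_eq_abs]
  exact pow_le_pow_left₀ (abs_nonneg _) (abs_le.2 ⟨by linarith [h.1, Real.pi_pos], h.2.le⟩) 2

lemma exists_bound_cell {d : ℕ} {F : Type*} [NormedAddCommGroup F] {g : Horiz d → F}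
    (hg : Continuous g) : ∃ M, ∀ x ∈ cell d, ‖g x‖ ≤ M := by
  obtain ⟨M, hM⟩ := (isBounded_cell d).isCompact_closure.exists_bound_of_continuousOn
    hg.continuousOn
  exact ⟨M, fun x hx => hM x (subset_closure hx)⟩

lemma exists_bound_cell_prod {d : ℕ} {F : Type*} [NormedAddCommGroup F] {g : Horiz d × ℝ → F}
    (hg : Continuous g) (a b : ℝ) : ∃ M, ∀ x ∈ cell d, ∀ y ∈ Set.Icc a b, ‖g (x, y)‖ ≤ M := by
  obtain ⟨M, hM⟩ := ((isBounded_cell d).isCompact_closure.prod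
    (isCompact_Icc (a := a) (b := b))).exists_bound_of_continuousOn hg.continuousOn
  exact ⟨M, fun x hx y hy => hM (x, y) ⟨subset_closure hx, hy⟩⟩

lemma memLp_torusMeasure_of_continuous {d : ℕ} {F : Type*} [NormedAddCommGroup F]
    {g : Horiz d → F} (hg : Continuous g) {p : ℝ≥0∞} : MemLp g p (torusMeasure d) := by
  obtain ⟨M, hM⟩ := exists_bound_cell hg
  refine MemLp.of_bound hg.aestronglyMeasurable M ?_
  filter_upwards [ae_restrict_mem (measurableSet_cell d)] with x hx using hM x hx

/-- The gradient of a Lipschitz function controls its Fourier coefficients. -/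
lemma sum_sq_coord_mul_fourierCoeff_le {d : ℕ} {f : Horiz d → ℝ} {K : NNReal}
    (hf : LipschitzWith K f) (hp : IsPeriodic f) (F : Finset (Fin d → ℤ)) (j : Fin d) :
    ∑ ξ ∈ F, (ξ j : ℝ) ^ 2 * ‖fourierCoeff f ξ‖ ^ 2 ≤
      ((2 * Real.pi) ^ d)⁻¹ *
        ∫ x, (lineDeriv ℝ f x (EuclideanSpace.single j 1)) ^ 2 ∂(torusMeasure d) := by
  set e : Horiz d := EuclideanSpace.single j 1 with he
  have hcont := hf.continuous
  -- A translation multiplies each Fourier coefficient by a value of the character, by translation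
  -- invariance of the integral over a period.
  have htrans : ∀ (t : ℝ) ξ, fourierCoeff (fun x => f (x + t • e)) ξ =
      wave ξ (t • e) * fourierCoeff f ξ := by
    intro t ξ
    have h := integral_torusMeasure_add (d := d)
      (g := fun x => (starRingEnd ℂ) (wave ξ x) * (f x : ℂ))
      (fun n x => by simp only [isPeriodic_wave ξ n x, hp n x])
      ((RCLike.continuous_conj.comp (continuous_wave ξ)).mul
        (Complex.continuous_ofReal.comp hcont)) (t • e)
    rw [fourierCoeff_eq, fourierCoeff_eq, ← h, mul_left_comm]
    congr 1
    rw [← integral_const_mul]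
    congr 1
    funext x
    have h1 : wave ξ (t • e) * (starRingEnd ℂ) (wave ξ (t • e)) = 1 := by
      rw [Complex.mul_conj, Complex.normSq_eq_norm_sq, norm_wave]; simp
    rw [wave_add, map_mul]
    linear_combination (-(starRingEnd ℂ) (wave ξ x) * (f (x + t • e) : ℂ)) * h1
  -- Bessel's inequality for the difference quotients in direction `e`. The limit `t → 0` is taken
  -- on both sides afterwards.
  have hineq : ∀ t : ℝ, ∑ ξ ∈ F, ‖t⁻¹ • (wave ξ (t • e) - 1)‖ ^ 2 * ‖fourierCoeff f ξ‖ ^ 2 ≤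
      ((2 * Real.pi) ^ d)⁻¹ * ∫ x, (t⁻¹ • (f (x + t • e) - f x)) ^ 2 ∂(torusMeasure d) := by
    intro t
    have hm1 : MemLp (fun x => f (x + t • e)) 2 (torusMeasure d) :=
      memLp_torusMeasure_of_continuous (by fun_prop)
    have hm : MemLp f 2 (torusMeasure d) := memLp_torusMeasure_of_continuous hcont
    have h := sum_sq_fourierCoeff_le (hm1.sub hm) F
    have h2 : ∀ ξ, ‖fourierCoeff ((fun x => f (x + t • e)) - f) ξ‖ ^ 2 =
        ‖wave ξ (t • e) - 1‖ ^ 2 * ‖fourierCoeff f ξ‖ ^ 2 := by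
      intro ξ
      rw [show ((fun x => f (x + t • e)) - f) = fun x => f (x + t • e) - f x from rfl,
        fourierCoeff_sub hm1 hm, htrans, ← mul_pow, ← norm_mul]
      congr 2; ring
    simp only [h2] at h
    have h3 := mul_le_mul_of_nonneg_left h (sq_nonneg t⁻¹)
    rw [Finset.mul_sum, mul_left_comm, ← integral_const_mul] at h3
    refine (Eq.le ?_).trans (h3.trans_eq ?_)
    · refine Finset.sum_congr rfl fun ξ _ => ?_
      rw [norm_smul, mul_pow, Real.norm_eq_abs, sq_abs, mul_assoc]
    · congr 2; funext x; simp [mul_pow]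
  have hL : Tendsto (fun t : ℝ => ∑ ξ ∈ F, ‖t⁻¹ • (wave ξ (t • e) - 1)‖ ^ 2 *
      ‖fourierCoeff f ξ‖ ^ 2) (𝓝[≠] 0)
      (𝓝 (∑ ξ ∈ F, (ξ j : ℝ) ^ 2 * ‖fourierCoeff f ξ‖ ^ 2)) := by
    refine tendsto_finsetSum _ fun ξ _ => Tendsto.mul_const _ ?_
    have h1 : HasDerivAt (fun t : ℝ => wave ξ (t • e)) (Complex.I * (ξ j : ℂ)) 0 := by
      have h2 : (fun t : ℝ => wave ξ (t • e)) =
          fun t : ℝ => Complex.exp (Complex.I * ((t : ℂ) * (ξ j : ℂ))) := by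
        funext t
        simp [wave, he, inner_smul_left, latticeVec, EuclideanSpace.inner_single_left]
      rw [h2]
      have h3 : HasDerivAt (fun t : ℝ => Complex.I * ((t : ℂ) * (ξ j : ℂ)))
          (Complex.I * (1 * (ξ j : ℂ))) 0 :=
        ((HasDerivAt.ofReal_comp (hasDerivAt_id (0 : ℝ))).mul_const _).const_mul _
      simpa using h3.cexp
    have h4 := h1.tendsto_slope_zero
    have h5 := (h4.norm.pow 2)
    simpa [wave] using h5
  have hR : Tendsto (fun t : ℝ => ∫ x, (t⁻¹ • (f (x + t • e) - f x)) ^ 2 ∂(torusMeasure d))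
      (𝓝[≠] 0) (𝓝 (∫ x, (lineDeriv ℝ f x e) ^ 2 ∂(torusMeasure d))) := by
    -- Rademacher's theorem along `e` gives convergence almost everywhere, and the Lipschitz
    -- constant dominates the quotients.
    refine tendsto_integral_filter_of_dominated_convergence (fun _ => (K : ℝ) ^ 2) ?_ ?_ ?_ ?_
    · exact Eventually.of_forall fun t => by fun_prop
    · filter_upwards [self_mem_nhdsWithin] with t ht
      refine Eventually.of_forall fun x => ?_
      have h1 := hf.dist_le_mul (x + t • e) x
      rw [Real.dist_eq, dist_eq_norm, add_sub_cancel_left, norm_smul, he,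
        PiLp.norm_single, norm_one, mul_one, Real.norm_eq_abs] at h1
      have ht' : 0 < |t| := abs_pos.2 ht
      have h2 : |t⁻¹ • (f (x + t • e) - f x)| ≤ K := by
        rw [smul_eq_mul, abs_mul, abs_inv, inv_mul_le_iff₀ ht']
        linarith
      rw [Real.norm_eq_abs, abs_pow]
      exact pow_le_pow_left₀ (abs_nonneg _) h2 2
    · exact integrable_const _
    · have := hf.ae_lineDifferentiableAt (μ := (volume : Measure (Horiz d))) e
      filter_upwards [ae_restrict_of_ae this] with x hx
      have h1 := (hx.hasLineDerivAt).tendsto_slope_zero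
      exact h1.pow 2
  exact le_of_tendsto_of_tendsto hL (hR.const_mul _) (Eventually.of_forall hineq)

lemma norm_latticeVec_sq {d : ℕ} (ξ : Fin d → ℤ) :
    ‖(latticeVec ξ : Horiz d)‖ ^ 2 = ∑ j, (ξ j : ℝ) ^ 2 := by
  simp [EuclideanSpace.norm_sq_eq, latticeVec]

lemma lineDeriv_single_eq_gradient {d : ℕ} {f : Horiz d → ℝ} {x : Horiz d}
    (hf : DifferentiableAt ℝ f x) (j : Fin d) :
    lineDeriv ℝ f x (EuclideanSpace.single j 1) = gradient f x j := by
  rw [hf.lineDeriv_eq_fderiv, ← inner_gradient_left, EuclideanSpace.inner_single_right]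
  simp

lemma norm_gradient_le_of_lipschitz {d : ℕ} {f : Horiz d → ℝ} {K : NNReal}
    (hf : LipschitzWith K f) (x : Horiz d) : ‖gradient f x‖ ≤ K := by
  rw [gradient, LinearIsometryEquiv.norm_map]
  exact norm_fderiv_le_of_lipschitz ℝ hf

/-- The coordinate bounds are added over `j`. Almost everywhere `f` is differentiable, and its line
derivatives are then the components of the gradient. -/
lemma sum_normSq_mul_fourierCoeff_le {d : ℕ} {f : Horiz d → ℝ} {K : NNReal}
    (hf : LipschitzWith K f) (hp : IsPeriodic f) (F : Finset (Fin d → ℤ)) :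
    ∑ ξ ∈ F, ‖(latticeVec ξ : Horiz d)‖ ^ 2 * ‖fourierCoeff f ξ‖ ^ 2 ≤
      ((2 * Real.pi) ^ d)⁻¹ * ∫ x, ‖gradient f x‖ ^ 2 ∂(torusMeasure d) := by
  have h1 : ∑ ξ ∈ F, ‖(latticeVec ξ : Horiz d)‖ ^ 2 * ‖fourierCoeff f ξ‖ ^ 2 =
      ∑ j, ∑ ξ ∈ F, (ξ j : ℝ) ^ 2 * ‖fourierCoeff f ξ‖ ^ 2 := by
    rw [Finset.sum_comm]
    simp only [norm_latticeVec_sq, Finset.sum_mul]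
  have hint : ∀ j, Integrable
      (fun x => (lineDeriv ℝ f x (EuclideanSpace.single j 1 : Horiz d)) ^ 2) (torusMeasure d) := by
    intro j
    refine Integrable.of_bound
      ((measurable_lineDeriv hf.continuous).pow_const 2).aestronglyMeasurable ((K : ℝ) ^ 2) ?_
    refine Eventually.of_forall fun x => ?_
    rw [norm_pow]
    refine pow_le_pow_left₀ (norm_nonneg _) ?_ 2
    have := norm_lineDeriv_le_of_lipschitz ℝ (x₀ := x)
      (v := (EuclideanSpace.single j 1 : Horiz d)) hf
    simpa using this
  rw [h1]
  refine (Finset.sum_le_sum fun j _ => sum_sq_coord_mul_fourierCoeff_le hf hp F j).trans_eq ?_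
  rw [← Finset.mul_sum, ← integral_finsetSum _ fun j _ => hint j]
  congr 1
  refine integral_congr_ae ?_
  filter_upwards [ae_restrict_of_ae (hf.ae_differentiableAt (μ := volume))] with x hx
  rw [EuclideanSpace.norm_sq_eq]
  refine Finset.sum_congr rfl fun j _ => ?_
  rw [lineDeriv_single_eq_gradient hx, Real.norm_eq_abs, sq_abs]

/-! ### Smooth periodic functions and the fluid domain -/

section Smooth

variable {d : ℕ} {U : Horiz d × ℝ → ℝ}

lemma hasFDerivAt_section (hU : ContDiff ℝ ∞ U) (p : Horiz d × ℝ) :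
    HasFDerivAt (fun x => U (x, p.2))
      ((fderiv ℝ U p).comp (ContinuousLinearMap.inl ℝ (Horiz d) ℝ)) p.1 := by
  have h1 : HasFDerivAt U (fderiv ℝ U p) (p.1, p.2) :=
    (hU.differentiable (by simp) p).hasFDerivAt
  exact h1.comp p.1 (hasFDerivAt_prodMk_left p.1 p.2)

lemma gradX_eq (hU : ContDiff ℝ ∞ U) (p : Horiz d × ℝ) :
    gradX U p = (InnerProductSpace.toDual ℝ (Horiz d)).symm
      ((fderiv ℝ U p).comp (ContinuousLinearMap.inl ℝ (Horiz d) ℝ)) := by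
  rw [gradX, gradient, (hasFDerivAt_section hU p).fderiv]

lemma derivY_eq (hU : ContDiff ℝ ∞ U) (p : Horiz d × ℝ) :
    derivY U p = fderiv ℝ U p (0, 1) := by
  have h1 : HasFDerivAt U (fderiv ℝ U p) (p.1, p.2) :=
    (hU.differentiable (by simp) p).hasFDerivAt
  have h2 : HasDerivAt (fun y : ℝ => (p.1, y)) ((0 : Horiz d), (1 : ℝ)) p.2 :=
    (hasDerivAt_const p.2 p.1).prodMk (hasDerivAt_id p.2)
  exact (h1.comp_hasDerivAt p.2 h2).deriv

lemma hasDerivAt_derivY (hU : ContDiff ℝ ∞ U) (x : Horiz d) (y : ℝ) :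
    HasDerivAt (fun y => U (x, y)) (derivY U (x, y)) y := by
  have h2 : DifferentiableAt ℝ (fun y => U (x, y)) y := by
    have := hU.differentiable (by simp)
    fun_prop
  exact h2.hasDerivAt

lemma fderiv_apply_eq (hU : ContDiff ℝ ∞ U) (p : Horiz d × ℝ) (v : Horiz d) (t : ℝ) :
    fderiv ℝ U p (v, t) = inner ℝ (gradX U p) v + t * derivY U p := by
  rw [gradX_eq hU, derivY_eq hU, InnerProductSpace.toDual_symm_apply]
  have : ((v, t) : Horiz d × ℝ) = (v, 0) + t • (0, 1) := by simp
  rw [this, map_add, map_smul]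
  simp

lemma continuous_gradX (hU : ContDiff ℝ ∞ U) : Continuous (gradX U) := by
  rw [show gradX U = _ from funext (gradX_eq hU)]
  have := hU.continuous_fderiv (by simp)
  fun_prop

lemma continuous_derivY (hU : ContDiff ℝ ∞ U) : Continuous (derivY U) := by
  rw [show derivY U = _ from funext (derivY_eq hU)]
  have := hU.continuous_fderiv (by simp)
  fun_prop

lemma IsPeriodicX.gradX {U : Horiz d × ℝ → ℝ} (hU : IsPeriodicX U) :
    IsPeriodicX (WaterWaves.gradX U) := by
  intro y n x
  simp only [WaterWaves.gradX, gradient]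
  congr 1
  rw [← fderiv_comp_add_right]
  congr 1
  funext x'
  exact hU y n x'

lemma IsPeriodicX.derivY {U : Horiz d × ℝ → ℝ} (hU : IsPeriodicX U) :
    IsPeriodicX (WaterWaves.derivY U) := by
  intro y n x
  simp only [WaterWaves.derivY]
  congr 1
  funext y'
  exact hU y' n x

lemma IsPeriodicX.exists_bound {F : Type*} [NormedAddCommGroup F] {g : Horiz d × ℝ → F}
    (hg : IsPeriodicX g) (hc : Continuous g) (a b : ℝ) :
    ∃ M, ∀ x, ∀ y ∈ Set.Icc a b, ‖g (x, y)‖ ≤ M := by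
  obtain ⟨M, hM⟩ := exists_bound_cell_prod hc a b
  refine ⟨M, fun x y hy => ?_⟩
  rw [← (hg y).ofTorus_toTorus x]
  exact hM _ (ofTorus_mem_cell _) y hy

lemma IsPeriodic.exists_bound {F : Type*} [NormedAddCommGroup F] {g : Horiz d → F}
    (hg : IsPeriodic g) (hc : Continuous g) : ∃ M, ∀ x, ‖g x‖ ≤ M := by
  obtain ⟨M, hM⟩ := exists_bound_cell hc
  refine ⟨M, fun x => ?_⟩
  rw [← hg.ofTorus_toTorus x]
  exact hM _ (ofTorus_mem_cell _)

/-- The strip is unbounded in `x`, but periodicity reduces the bound on the derivative to a compact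
set, and convexity of the strip turns it into a Lipschitz bound. -/
lemma IsPeriodicX.exists_lipschitzOnWith (hU : ContDiff ℝ ∞ U) (hp : IsPeriodicX U) (a b : ℝ) :
    ∃ K, LipschitzOnWith K U (Set.univ ×ˢ Set.Icc a b) := by
  obtain ⟨M, hM⟩ := hp.gradX.exists_bound (continuous_gradX hU) a b
  obtain ⟨N, hN⟩ := hp.derivY.exists_bound (continuous_derivY hU) a b
  refine ⟨(|M| + |N|).toNNReal, ?_⟩
  refine (convex_univ.prod (convex_Icc a b)).lipschitzOnWith_of_nnnorm_fderiv_le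
    (fun p _ => hU.differentiable (by simp) p) (fun p hp => ?_)
  rw [← NNReal.coe_le_coe, coe_nnnorm, Real.coe_toNNReal _ (by positivity)]
  refine ContinuousLinearMap.opNorm_le_bound _ (by positivity) fun v => ?_
  obtain ⟨v, t⟩ := v
  rw [fderiv_apply_eq hU, add_mul]
  have hv : ‖v‖ ≤ ‖(v, t)‖ := norm_fst_le (v, t)
  have ht : ‖t‖ ≤ ‖(v, t)‖ := norm_snd_le (v, t)
  refine (norm_add_le _ _).trans (add_le_add ?_ ?_)
  · refine (norm_inner_le_norm _ _).trans ?_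
    exact mul_le_mul ((hM p.1 p.2 hp.2).trans (le_abs_self _)) hv (norm_nonneg _) (abs_nonneg _)
  · rw [norm_mul, mul_comm]
    exact mul_le_mul ((hN p.1 p.2 hp.2).trans (le_abs_self _)) ht (norm_nonneg _) (abs_nonneg _)

end Smooth

/-! ### Integration over one period of the fluid domain. -/

section Fluid

variable {d : ℕ} {h : ℝ} {η : Horiz d → ℝ}

lemma measurableSet_fluidCell (hη : Continuous η) :
    MeasurableSet (fluidDomain h η ∩ {p : Horiz d × ℝ | p.1 ∈ cell d}) := by
  refine MeasurableSet.inter ?_ (measurable_fst (measurableSet_cell d))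
  exact (measurableSet_lt measurable_const measurable_snd).inter
    (measurableSet_lt measurable_snd (hη.measurable.comp measurable_fst))

lemma lintegral_fluidMeasure (hη : Continuous η) {f : Horiz d × ℝ → ℝ≥0∞} (hf : Measurable f) :
    ∫⁻ p, f p ∂(fluidMeasure h η) =
      ∫⁻ x, (∫⁻ y in Set.Ioo (-h) (η x), f (x, y)) ∂(torusMeasure d) := by
  rw [fluidMeasure, ← lintegral_indicator (measurableSet_fluidCell hη), Measure.volume_eq_prod,
    lintegral_prod _ (hf.indicator (measurableSet_fluidCell hη)).aemeasurable, torusMeasure,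
    ← lintegral_indicator (measurableSet_cell d)]
  refine lintegral_congr fun x => ?_
  by_cases hx : x ∈ cell d
  · rw [Set.indicator_of_mem hx, ← lintegral_indicator measurableSet_Ioo]
    refine lintegral_congr fun y => ?_
    simp [Set.indicator, fluidDomain, hx]
  · rw [Set.indicator_of_notMem hx]
    simp [Set.indicator, hx]

lemma ae_fluidMeasure (hη : Continuous η) : ∀ᵐ p ∂(fluidMeasure h η),
    p.1 ∈ cell d ∧ -h < p.2 ∧ p.2 < η p.1 := by
  filter_upwards [ae_restrict_mem (measurableSet_fluidCell hη)] with p hp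
  exact ⟨hp.2, hp.1⟩

lemma isFiniteMeasure_fluidMeasure (hη : Continuous η) : IsFiniteMeasure (fluidMeasure h η) := by
  obtain ⟨M, hM⟩ := exists_bound_cell hη
  refine ⟨?_⟩
  have h1 := lintegral_fluidMeasure (h := h) hη (f := fun _ => 1) measurable_const
  rw [lintegral_one] at h1
  rw [h1]
  calc ∫⁻ x, (∫⁻ _ in Set.Ioo (-h) (η x), 1) ∂(torusMeasure d)
      ≤ ∫⁻ _x, ENNReal.ofReal (M + h) ∂(torusMeasure d) := by
        refine lintegral_mono_ae ?_
        filter_upwards [ae_restrict_mem (measurableSet_cell d)] with x hx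
        rw [setLIntegral_one, Real.volume_Ioo]
        exact ENNReal.ofReal_le_ofReal (by linarith [le_abs_self (η x), hM x hx, Real.norm_eq_abs (η x)])
    _ < ⊤ := by
        rw [lintegral_const]
        exact ENNReal.mul_lt_top ENNReal.ofReal_lt_top (measure_lt_top _ _)

lemma memLp_fluidMeasure_of_continuous (hη : Continuous η) {F : Type*} [NormedAddCommGroup F]
    {g : Horiz d × ℝ → F} (hg : Continuous g) {p : ℝ≥0∞} : MemLp g p (fluidMeasure h η) := by
  have := isFiniteMeasure_fluidMeasure (h := h) hη
  obtain ⟨M, hM⟩ := exists_bound_cell hη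
  obtain ⟨N, hN⟩ := exists_bound_cell_prod hg (-h) M
  refine MemLp.of_bound hg.aestronglyMeasurable N ?_
  filter_upwards [ae_fluidMeasure hη] with p hp
  exact hN p.1 hp.1 p.2 ⟨hp.2.1.le, hp.2.2.le.trans ((le_abs_self _).trans (hM _ hp.1))⟩

/-- The part of the fluid above a given level is parametrised by the depth below the surface. -/
lemma lintegral_depth_le (hη : Continuous η) {a : ℝ} (ha : -h ≤ a)
    {f : Horiz d × ℝ → ℝ≥0∞} (hf : Measurable f) (S : Set ℝ) (hS : MeasurableSet S)
    (hS0 : S ⊆ Set.Ioi 0) :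
    ∫⁻ x, (∫⁻ s in S, Set.indicator {s | a < η x - s} (fun s => f (x, η x - s)) s)
      ∂(torusMeasure d) ≤ ∫⁻ p, f p ∂(fluidMeasure h η) := by
  rw [lintegral_fluidMeasure hη hf]
  refine lintegral_mono fun x => ?_
  beta_reduce
  -- The reflection `y = η x - s` preserves Lebesgue measure on each vertical line.
  rw [← lintegral_indicator measurableSet_Ioo,
    ← lintegral_sub_left_eq_self (μ := volume) _ (η x), ← lintegral_indicator hS]
  refine lintegral_mono fun s => ?_
  by_cases hs : s ∈ S
  · have hs0 : 0 < s := hS0 hs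
    rw [Set.indicator_of_mem hs]
    by_cases h2 : a < η x - s
    · rw [Set.indicator_of_mem (show s ∈ {s | a < η x - s} from h2), Set.indicator_of_mem]
      exact ⟨ha.trans_lt h2, by linarith⟩
    · rw [Set.indicator_of_notMem (show s ∉ {s | a < η x - s} from h2)]
      exact zero_le
  · rw [Set.indicator_of_notMem hs]
    exact zero_le

end Fluid

/-! ### The lower bound for the energy of smooth functions -/

/-- Cauchy–Schwarz against the constant `1`, read off from the nonnegativity of the integral of `(m
f - A)²`, with `m` the total mass and `A` the integral of `f`. -/
lemma sq_integral_le {α : Type*} [MeasurableSpace α] {μ : Measure α} [IsFiniteMeasure μ]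
    {f : α → ℝ} (hf : Integrable f μ) (hf2 : Integrable (fun x => f x ^ 2) μ) :
    (∫ x, f x ∂μ) ^ 2 ≤ μ.real Set.univ * ∫ x, f x ^ 2 ∂μ := by
  set m := μ.real Set.univ
  set A := ∫ x, f x ∂μ
  have h1 : 0 ≤ ∫ x, (m * f x - A) ^ 2 ∂μ := integral_nonneg fun x => sq_nonneg _
  have h2 : ∫ x, (m * f x - A) ^ 2 ∂μ = m * (m * ∫ x, f x ^ 2 ∂μ - A ^ 2) := by
    have : ∀ x, (m * f x - A) ^ 2 = m ^ 2 * f x ^ 2 - 2 * m * A * f x + A ^ 2 := fun x => by ring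
    simp_rw [this]
    have i2 : Integrable (fun x => m ^ 2 * f x ^ 2 - 2 * m * A * f x) μ :=
      (hf2.const_mul _).sub (hf.const_mul _)
    rw [integral_add i2 (integrable_const _),
      integral_sub (hf2.const_mul _) (hf.const_mul _), integral_const_mul, integral_const_mul,
      integral_const, smul_eq_mul]
    ring
  rw [h2] at h1
  have hm : 0 ≤ m := measureReal_nonneg
  rcases hm.eq_or_lt with h0 | hpos
  · have : μ = 0 := by
      have h3 : μ.real Set.univ = 0 := h0.symm
      rwa [measureReal_eq_zero_iff, Measure.measure_univ_eq_zero] at h3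
    have hA : A = 0 := by simp [A, this]
    rw [hA, ← h0]; simp
  · nlinarith [nonneg_of_mul_nonneg_right h1 hpos]

lemma integrableOn_of_measurable_of_bound {F : Type*} [NormedAddCommGroup F] {f : ℝ → F}
    (hf : AEStronglyMeasurable f) {S : Set ℝ} (hS : MeasurableSet S) (hfin : volume S ≠ ⊤) {M : ℝ}
    (hM : ∀ s ∈ S, ‖f s‖ ≤ M) : IntegrableOn f S := by
  have : IsFiniteMeasure (volume.restrict S) := ⟨by simpa using hfin.lt_top⟩
  refine Integrable.of_bound hf.restrict M ?_
  filter_upwards [ae_restrict_mem hS] with s hs using hM s hs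

/-- The one-dimensional trace inequality at frequency `r`, on an interval of length `l ≥ l / r`. -/
lemma mul_norm_sq_le_of_eq_add_integral {w₀ : ℂ} {w q : ℝ → ℂ} {M l r : ℝ} (hl : 0 < l)
    (hr : 1 ≤ r) (hw : StronglyMeasurable w) (hq : StronglyMeasurable q)
    (bw : ∀ s ∈ Set.Ioo 0 l, ‖w s‖ ≤ M) (bq : ∀ s ∈ Set.Ioo 0 l, ‖q s‖ ≤ M)
    (hrel : ∀ s ∈ Set.Ioo 0 l, w₀ = w s + ∫ σ in Set.Ioo 0 s, q σ) :
    r * ‖w₀‖ ^ 2 ≤ (2 / l) * (r ^ 2 * ∫ s in Set.Ioo 0 l, ‖w s‖ ^ 2) +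
      2 * l * ∫ s in Set.Ioo 0 l, ‖q s‖ ^ 2 := by
  have hr0 : 0 < r := by linarith
  have hlr : l / r ≤ l := div_le_self hl.le hr
  have hsub : ∀ {s}, s ≤ l → Set.Ioo 0 s ⊆ Set.Ioo 0 l := fun hs => Set.Ioo_subset_Ioo_right hs
  have hfin : ∀ s : ℝ, volume (Set.Ioo 0 s) ≠ ⊤ := fun s => by simp
  have bsq : ∀ {z : ℂ}, ‖z‖ ≤ M → ‖‖z‖ ^ 2‖ ≤ M ^ 2 := fun {z} hz => by
    rw [Real.norm_of_nonneg (by positivity)]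
    exact pow_le_pow_left₀ (norm_nonneg _) hz 2
  have iw : IntegrableOn (fun s => ‖w s‖ ^ 2) (Set.Ioo 0 l) :=
    integrableOn_of_measurable_of_bound (hw.norm.pow 2).aestronglyMeasurable measurableSet_Ioo
      (hfin l) fun s hs => bsq (bw s hs)
  have iq2 : IntegrableOn (fun s => ‖q s‖ ^ 2) (Set.Ioo 0 l) :=
    integrableOn_of_measurable_of_bound (hq.norm.pow 2).aestronglyMeasurable measurableSet_Ioo
      (hfin l) fun s hs => bsq (bq s hs)
  have iq : IntegrableOn (fun s => ‖q s‖) (Set.Ioo 0 l) :=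
    integrableOn_of_measurable_of_bound hq.norm.aestronglyMeasurable measurableSet_Ioo
      (hfin l) fun s hs => by simpa using bq s hs
  set Q := ∫ s in Set.Ioo 0 l, ‖q s‖ ^ 2 with hQ
  have hQ0 : 0 ≤ Q := integral_nonneg fun _ => by positivity
  -- Only depths below `l / r` are used. There Cauchy–Schwarz bounds the squared integral of `q` by
  -- `(l / r) * Q`, and this gain of `1 / r` is what makes the last term free of `r` in the end.
  have hpt : ∀ s ∈ Set.Ioo 0 (l / r), ‖w₀‖ ^ 2 ≤ 2 * ‖w s‖ ^ 2 + 2 * (l / r) * Q := by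
    intro s hs
    have hsl : s ≤ l := hs.2.le.trans hlr
    have h1 : ‖∫ σ in Set.Ioo 0 s, q σ‖ ^ 2 ≤ s * Q := by
      refine (pow_le_pow_left₀ (norm_nonneg _) (norm_integral_le_integral_norm _) 2).trans ?_
      have : IsFiniteMeasure (volume.restrict (Set.Ioo 0 s)) := ⟨by simp⟩
      refine (sq_integral_le (iq.mono_set (hsub hsl)) (iq2.mono_set (hsub hsl))).trans ?_
      have h3 : (volume.restrict (Set.Ioo 0 s)).real Set.univ = s := by
        simp [hs.1.le]
      rw [h3]
      refine mul_le_mul_of_nonneg_left ?_ hs.1.le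
      exact setIntegral_mono_set iq2 (Eventually.of_forall fun _ => by positivity)
        (hsub hsl).eventuallyLE
    have h2 := hrel s ⟨hs.1, hs.2.trans_le hlr⟩
    have h3 : ‖w₀‖ ≤ ‖w s‖ + ‖∫ σ in Set.Ioo 0 s, q σ‖ := by
      conv_lhs => rw [h2]
      exact norm_add_le _ _
    have h4 : s * Q ≤ l / r * Q := mul_le_mul_of_nonneg_right hs.2.le hQ0
    nlinarith [sq_nonneg (‖w s‖ - ‖∫ σ in Set.Ioo 0 s, q σ‖), norm_nonneg w₀, norm_nonneg (w s),
      norm_nonneg (∫ σ in Set.Ioo 0 s, q σ)]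
  have hint : (l / r) * ‖w₀‖ ^ 2 ≤ 2 * (∫ s in Set.Ioo 0 l, ‖w s‖ ^ 2) + 2 * (l / r) ^ 2 * Q := by
    have iw' := iw.mono_set (hsub hlr)
    have : IsFiniteMeasure (volume.restrict (Set.Ioo 0 (l / r))) := ⟨by simp⟩
    have hmono := setIntegral_mono_on (μ := volume) (integrable_const (‖w₀‖ ^ 2))
      ((iw'.const_mul 2).add (integrable_const (2 * (l / r) * Q))) measurableSet_Ioo hpt
    simp only [Pi.add_apply] at hmono
    rw [integral_add (iw'.const_mul 2) (integrable_const _), integral_const_mul,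
      integral_const, integral_const] at hmono
    have hlr0 : 0 ≤ l / r := by positivity
    have h3 : (volume.restrict (Set.Ioo 0 (l / r))).real Set.univ = l / r := by
      simp [hlr0]
    rw [h3, smul_eq_mul, smul_eq_mul] at hmono
    have h4 : ∫ s in Set.Ioo 0 (l / r), ‖w s‖ ^ 2 ≤ ∫ s in Set.Ioo 0 l, ‖w s‖ ^ 2 :=
      setIntegral_mono_set iw (Eventually.of_forall fun _ => by positivity)
        (hsub hlr).eventuallyLE
    nlinarith
  -- The factor `r ^ 2 / l` normalises the left side to `r * ‖w₀‖ ^ 2`; the square of `l / r` in the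
  -- last term absorbs all powers of `r`.
  have h5 := mul_le_mul_of_nonneg_left hint (show 0 ≤ r ^ 2 / l by positivity)
  have e1 : r ^ 2 / l * (l / r * ‖w₀‖ ^ 2) = r * ‖w₀‖ ^ 2 := by field_simp
  have e2 : r ^ 2 / l * (2 * (∫ s in Set.Ioo 0 l, ‖w s‖ ^ 2) + 2 * (l / r) ^ 2 * Q) =
      (2 / l) * (r ^ 2 * ∫ s in Set.Ioo 0 l, ‖w s‖ ^ 2) + 2 * l * Q := by field_simp
  rwa [e1, e2] at h5

/-- The trace of `U` on the surface at depth `s` below the graph of `η`, cut off at the level `a`. -/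
noncomputable def depthTrace {d : ℕ} (U : Horiz d × ℝ → ℝ) (η : Horiz d → ℝ) (a s : ℝ)
    (x : Horiz d) : ℝ :=
  U (x, max (η x - s) a)

/-- The function `g`, above the level `a`, at depth `s` below the graph of `η`. -/
noncomputable def depthPart {d : ℕ} (g : Horiz d × ℝ → ℝ) (η : Horiz d → ℝ) (a s : ℝ)
    (x : Horiz d) : ℝ :=
  Set.indicator {s | a < η x - s} (fun s => g (x, η x - s)) s

/-! ### Traces at a given depth below the surface, and their Fourier coefficients. -/

section

variable {d : ℕ} {U : Horiz d × ℝ → ℝ} {η : Horiz d → ℝ} {a : ℝ}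

/-- The fundamental theorem of calculus down the vertical line through `x`. Once the level `a` is
reached the trace no longer changes and the cut-off derivative vanishes, so both sides stop at depth
`min s (η x - a)`. -/
lemma eq_depthTrace_add_integral (hU : ContDiff ℝ ∞ U) {x : Horiz d} (ha : a < η x) {s : ℝ}
    (hs : 0 < s) :
    U (x, η x) = depthTrace U η a s x + ∫ σ in Set.Ioo 0 s, depthPart (derivY U) η a σ x := by
  have hset : {s | a < η x - s} = Set.Iio (η x - a) := by
    ext s; simp only [Set.mem_ofPred_eq, Set.mem_Iio]; constructor <;> intro h <;> linarith
  have h1 : ∫ σ in Set.Ioo 0 s, depthPart (derivY U) η a σ x =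
      ∫ σ in (0 : ℝ)..(min s (η x - a)), derivY U (x, η x - σ) := by
    simp only [depthPart]
    rw [hset, setIntegral_indicator measurableSet_Iio, Set.Ioo_inter_Iio,
      intervalIntegral.integral_of_le (le_min hs.le (by linarith)), integral_Ioc_eq_integral_Ioo]
  have hd : ∀ σ, HasDerivAt (fun σ => -U (x, η x - σ)) (derivY U (x, η x - σ)) σ := by
    intro σ
    have h2 := (hasDerivAt_derivY hU x (η x - σ)).comp σ ((hasDerivAt_id σ).const_sub (η x))
    exact h2.neg.congr_deriv (by simp)
  rw [h1, intervalIntegral.integral_eq_sub_of_hasDerivAt (fun σ _ => hd σ)]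
  · have : max (η x - s) a = η x - min s (η x - a) := by
      rcases le_total s (η x - a) with h | h
      · rw [min_eq_left h, max_eq_left (by linarith)]
      · rw [min_eq_right h, max_eq_right (by linarith)]; ring
    rw [depthTrace, this]; simp
  · refine Continuous.intervalIntegrable ?_ _ _
    have := continuous_derivY hU
    fun_prop

lemma continuous_depthTrace (hU : ContDiff ℝ ∞ U) (hη : Continuous η) :
    Continuous fun p : ℝ × Horiz d => depthTrace U η a p.1 p.2 := by
  have := hU.continuous
  unfold depthTrace
  fun_prop

lemma measurable_depthPart {g : Horiz d × ℝ → ℝ} (hg : Continuous g) (hη : Continuous η) :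
    Measurable fun p : ℝ × Horiz d => depthPart g η a p.1 p.2 := by
  have h1 : (fun p : ℝ × Horiz d => depthPart g η a p.1 p.2) =
      Set.indicator {p : ℝ × Horiz d | a < η p.2 - p.1} fun p => g (p.2, η p.2 - p.1) := by
    funext p; simp [depthPart, Set.indicator]
  rw [h1]
  refine Measurable.indicator (by fun_prop) ?_
  exact measurableSet_lt measurable_const (by fun_prop)

lemma depthTrace_bound (hU : ContDiff ℝ ∞ U) (hη : Continuous η) (l : ℝ) :
    ∃ M, ∀ s ∈ Set.Ioo 0 l, ∀ x ∈ cell d, |depthTrace U η a s x| ≤ M := by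
  obtain ⟨N, hN⟩ := exists_bound_cell hη
  obtain ⟨M, hM⟩ := exists_bound_cell_prod hU.continuous (min (-N - l) a) (max N a)
  refine ⟨M, fun s hs x hx => hM x hx _ ⟨?_, ?_⟩⟩
  · exact (min_le_right _ _).trans (le_max_right _ _)
  · refine max_le_max ?_ le_rfl
    linarith [(abs_le.1 (hN x hx)).2, hs.1]

lemma depthPart_bound {g : Horiz d × ℝ → ℝ} (hg : Continuous g) (hη : Continuous η) (l : ℝ) :
    ∃ M, ∀ s ∈ Set.Ioo 0 l, ∀ x ∈ cell d, |depthPart g η a s x| ≤ M := by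
  obtain ⟨N, hN⟩ := exists_bound_cell hη
  obtain ⟨M, hM⟩ := exists_bound_cell_prod hg (-N - l) N
  refine ⟨max M 0, fun s hs x hx => ?_⟩
  have h := abs_le.1 (hN x hx)
  unfold depthPart
  by_cases h1 : s ∈ {s | a < η x - s}
  · rw [Set.indicator_of_mem h1]
    exact (hM x hx (η x - s) ⟨by linarith [hs.2], by linarith [hs.1]⟩).trans (le_max_left _ _)
  · rw [Set.indicator_of_notMem h1, abs_zero]
    exact le_max_right _ _

lemma integrable_prod_of_bound {F : Type*} [NormedAddCommGroup F] {l M : ℝ}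
    {f : ℝ × Horiz d → F} (hf : StronglyMeasurable f)
    (hM : ∀ s ∈ Set.Ioo 0 l, ∀ x ∈ cell d, ‖f (s, x)‖ ≤ M) :
    Integrable f ((volume.restrict (Set.Ioo 0 l)).prod (torusMeasure d)) := by
  have hfin : IsFiniteMeasure (volume.restrict (Set.Ioo 0 l)) := ⟨by simp⟩
  refine Integrable.of_bound hf.aestronglyMeasurable M ?_
  rw [torusMeasure, Measure.prod_restrict]
  filter_upwards [ae_restrict_mem (measurableSet_Ioo.prod (measurableSet_cell d))] with p hp
  exact hM p.1 hp.1 p.2 hp.2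

lemma integrable_depthPart {g : Horiz d × ℝ → ℝ} (hg : Continuous g) (hη : Continuous η) (l : ℝ) :
    Integrable (fun p : ℝ × Horiz d => depthPart g η a p.1 p.2)
      ((volume.restrict (Set.Ioo 0 l)).prod (torusMeasure d)) := by
  obtain ⟨M, hM⟩ := depthPart_bound (a := a) hg hη l
  exact integrable_prod_of_bound (measurable_depthPart hg hη).stronglyMeasurable hM

/-- For fixed `x` the substitution `y = η x - s` sends depths to heights between `a` and `η x`, all
inside the fluid because `a ≥ -h`. An integral over depths thus counts each point of the fluid at
most once, whatever `l` is. -/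
lemma integral_depthPart_le {g : Horiz d × ℝ → ℝ} (hg : Continuous g) (hg0 : ∀ p, 0 ≤ g p)
    (hη : Continuous η) {h : ℝ} (ha : -h ≤ a) (l : ℝ) :
    ∫ s in Set.Ioo 0 l, (∫ x, depthPart g η a s x ∂(torusMeasure d)) ≤
      ∫ p, g p ∂(fluidMeasure h η) := by
  have := isFiniteMeasure_fluidMeasure (h := h) hη
  have hnn : ∀ s x, 0 ≤ depthPart g η a s x := fun s x =>
    Set.indicator_nonneg (fun _ _ => hg0 _) _
  have hint := integrable_depthPart (a := a) hg hη l
  rw [integral_integral hint, integral_eq_lintegral_of_nonneg_ae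
    (Eventually.of_forall fun p => hnn _ _) hint.1,
    integral_eq_lintegral_of_nonneg_ae (Eventually.of_forall hg0) hg.aestronglyMeasurable]
  refine ENNReal.toReal_mono ?_ ?_
  · have hg1 : Integrable g (fluidMeasure h η) :=
      memLp_one_iff_integrable.1 (memLp_fluidMeasure_of_continuous hη hg)
    rw [← ofReal_integral_eq_lintegral_ofReal hg1 (Eventually.of_forall hg0)]
    exact ENNReal.ofReal_ne_top
  · rw [lintegral_prod_symm _ (measurable_depthPart hg hη).ennreal_ofReal.aemeasurable]
    refine le_trans (Eq.le ?_) (lintegral_depth_le (h := h) hη ha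
      (f := fun p => ENNReal.ofReal (g p)) hg.measurable.ennreal_ofReal (Set.Ioo 0 l)
      measurableSet_Ioo Set.Ioo_subset_Ioi_self)
    refine lintegral_congr fun x => lintegral_congr fun s => ?_
    simp only [depthPart, Set.indicator]
    split_ifs <;> simp

lemma fourierCoeff_measurable {v : ℝ → Horiz d → ℝ}
    (hv : Measurable fun p : ℝ × Horiz d => v p.1 p.2) (ξ : Fin d → ℤ) :
    StronglyMeasurable fun s => fourierCoeff (v s) ξ := by
  simp only [fourierCoeff_eq]
  refine StronglyMeasurable.const_mul ?_ _
  refine StronglyMeasurable.integral_prod_right (f := fun s x =>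
    (starRingEnd ℂ) (wave ξ x) * (v s x : ℂ)) ?_
  refine Measurable.stronglyMeasurable ?_
  have h1 := (continuous_wave ξ).measurable (α := Horiz d)
  have h2 : Measurable fun p : ℝ × Horiz d => (starRingEnd ℂ) (wave ξ p.2) :=
    RCLike.continuous_conj.measurable.comp (h1.comp measurable_snd)
  exact h2.mul (Complex.measurable_ofReal.comp hv)

lemma norm_fourierCoeff_le {f : Horiz d → ℝ} {M : ℝ} (hM : ∀ x ∈ cell d, |f x| ≤ M)
    (ξ : Fin d → ℤ) : ‖fourierCoeff f ξ‖ ≤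
      ((2 * Real.pi) ^ d)⁻¹ * (M * (torusMeasure d).real Set.univ) := by
  rw [fourierCoeff_eq, norm_mul, Complex.norm_real, Real.norm_of_nonneg (by positivity)]
  refine mul_le_mul_of_nonneg_left ?_ (by positivity)
  refine norm_integral_le_of_norm_le_const ?_
  filter_upwards [ae_restrict_mem (measurableSet_cell d)] with x hx
  simpa [norm_wave] using hM x hx

/-- The Fourier coefficient, by Fubini, of the pointwise identity `eq_depthTrace_add_integral`. This
is the relation to which the one-dimensional trace inequality applies. -/
lemma fourierCoeff_eq_add_integral (hU : ContDiff ℝ ∞ U) (hη : Continuous η)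
    (ha : ∀ x, a < η x) {s : ℝ} (hs : 0 < s) (ξ : Fin d → ℤ) :
    fourierCoeff (fun x => U (x, η x)) ξ = fourierCoeff (depthTrace U η a s) ξ +
      ∫ σ in Set.Ioo 0 s, fourierCoeff (depthPart (derivY U) η a σ) ξ := by
  obtain ⟨M, hM⟩ := depthPart_bound (a := a) (continuous_derivY hU) hη s
  have hm := measurable_depthPart (a := a) (continuous_derivY hU) hη
  have h1 := (continuous_wave ξ).measurable (α := Horiz d)
  have hint : Integrable (fun p : ℝ × Horiz d =>
      (starRingEnd ℂ) (wave ξ p.2) * (depthPart (derivY U) η a p.1 p.2 : ℂ))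
      ((volume.restrict (Set.Ioo 0 s)).prod (torusMeasure d)) := by
    refine integrable_prod_of_bound (M := M) ?_ ?_
    · have h2 : Measurable fun p : ℝ × Horiz d => (starRingEnd ℂ) (wave ξ p.2) :=
        RCLike.continuous_conj.measurable.comp (h1.comp measurable_snd)
      exact (h2.mul (Complex.measurable_ofReal.comp hm)).stronglyMeasurable
    · intro s hs x hx
      simpa [norm_wave] using hM s hs x hx
  simp only [fourierCoeff_eq]
  rw [integral_const_mul, integral_integral_swap hint, ← mul_add]
  congr 1
  rw [← integral_add]
  · refine integral_congr_ae (Eventually.of_forall fun x => ?_)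
    beta_reduce
    rw [eq_depthTrace_add_integral hU (ha x) hs, integral_const_mul, ← mul_add]
    push_cast
    rw [integral_complex_ofReal]
  · have hc : Continuous (depthTrace U η a s) :=
      (continuous_depthTrace (a := a) hU hη).comp (by fun_prop : Continuous fun x => (s, x))
    have := memLp_torusMeasure_of_continuous (p := 1)
      ((RCLike.continuous_conj.comp (continuous_wave ξ)).mul (Complex.continuous_ofReal.comp hc))
    exact memLp_one_iff_integrable.1 this
  · exact hint.integral_prod_right

end

/-! ### Tangential gradients at a given depth, and the energy bound for smooth functions. -/

section

variable {d : ℕ} {U : Horiz d × ℝ → ℝ} {η : Horiz d → ℝ} {a : ℝ}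

lemma isPeriodic_depthTrace (hp : IsPeriodicX U) (hηp : IsPeriodic η) (s : ℝ) :
    IsPeriodic (depthTrace U η a s) := by
  intro n x
  simp only [depthTrace]
  rw [hηp n x]
  exact hp _ n x

/-- The trace is `U` composed with the Lipschitz map `x ↦ (x, max (η x - s) a)`, whose values stay
in a horizontal strip where `U` is Lipschitz. Stopping with `max` creates a kink but keeps the
regularity needed to bound Fourier coefficients by the gradient. -/
lemma exists_lipschitzWith_depthTrace (hU : ContDiff ℝ ∞ U) (hp : IsPeriodicX U) {K : NNReal}
    (hη : LipschitzWith K η) (hηp : IsPeriodic η) (s : ℝ) :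
    ∃ K', LipschitzWith K' (depthTrace U η a s) := by
  obtain ⟨N, hN⟩ := hηp.exists_bound hη.continuous
  obtain ⟨K', hK'⟩ := hp.exists_lipschitzOnWith hU a (max (N - s) a)
  have h1 : LipschitzWith (max 1 K) fun x => (x, max (η x - s) a) := by
    refine LipschitzWith.id.prodMk ?_
    have h2 : LipschitzWith K fun x => η x - s := by
      have := hη.sub (LipschitzWith.const s)
      simpa using this
    exact h2.max_const a
  refine ⟨K' * max 1 K, ?_⟩
  rw [← lipschitzOnWith_univ] at h1 ⊢
  refine hK'.comp h1 fun x _ => ⟨Set.mem_univ _, le_max_right _ _, max_le_max ?_ le_rfl⟩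
  linarith [(abs_le.1 (hN x)).2]

/-- Off the contact set `η x - s = a` the trace agrees near `x` either with the flat slice `U (·,
a)` or with `U (·, η · - s)`. In the second case the chain rule gives `∇_x U + ∂_y U ∇η`, and `(α +
β)² ≤ 2α² + 2β²` concludes. -/
lemma norm_gradient_depthTrace_sq_le (hU : ContDiff ℝ ∞ U) {L s : ℝ} {x : Horiz d}
    (hη : DifferentiableAt ℝ η x) (hc : Continuous η) (hL : ‖gradient η x‖ ≤ L)
    (hne : η x - s ≠ a) :
    ‖gradient (depthTrace U η a s) x‖ ^ 2 ≤
      depthPart (fun p => 2 * ‖gradX U p‖ ^ 2 + 2 * L ^ 2 * derivY U p ^ 2) η a s x +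
        ‖gradX U (x, a)‖ ^ 2 := by
  rcases lt_or_gt_of_ne hne with h | h
  · have h1 : depthTrace U η a s =ᶠ[𝓝 x] fun x => U (x, a) := by
      have : ∀ᶠ x' in 𝓝 x, η x' - s < a :=
        (hc.sub continuous_const).continuousAt.eventually_lt continuousAt_const h
      filter_upwards [this] with x' hx'
      rw [depthTrace, max_eq_right hx'.le]
    have h2 : gradient (depthTrace U η a s) x = gradX U (x, a) := by
      rw [gradX, gradient, gradient, h1.fderiv_eq]
    rw [h2, depthPart, Set.indicator_of_notMem (by simpa using h.le), zero_add]
  · have h1 : depthTrace U η a s =ᶠ[𝓝 x] fun x => U (x, η x - s) := by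
      have : ∀ᶠ x' in 𝓝 x, a < η x' - s :=
        continuousAt_const.eventually_lt (hc.sub continuous_const).continuousAt h
      filter_upwards [this] with x' hx'
      rw [depthTrace, max_eq_left hx'.le]
    set p : Horiz d × ℝ := (x, η x - s) with hp
    have h2 : HasFDerivAt (fun x => U (x, η x - s))
        ((fderiv ℝ U p).comp ((ContinuousLinearMap.id ℝ (Horiz d)).prod (fderiv ℝ η x))) x := by
      have h3 : HasFDerivAt U (fderiv ℝ U p) (x, η x - s) :=
        (hU.differentiable (by simp) p).hasFDerivAt
      exact h3.comp x ((hasFDerivAt_id x).prodMk (hη.hasFDerivAt.sub_const s))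
    have h3 : gradient (depthTrace U η a s) x = gradX U p + derivY U p • gradient η x := by
      refine ext_inner_right ℝ fun v => ?_
      rw [inner_gradient_left, h1.fderiv_eq, h2.fderiv, inner_add_left, inner_smul_left,
        inner_gradient_left]
      simp only [ContinuousLinearMap.comp_apply, ContinuousLinearMap.prod_apply,
        ContinuousLinearMap.id_apply, fderiv_apply_eq hU, conj_trivial]
      ring
    rw [h3, depthPart, Set.indicator_of_mem (show s ∈ {s | a < η x - s} from h)]
    have h4 : ‖gradX U p + derivY U p • gradient η x‖ ≤ ‖gradX U p‖ + |derivY U p| * L := by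
      refine (norm_add_le _ _).trans (add_le_add_right ?_ _)
      rw [norm_smul, Real.norm_eq_abs]
      exact mul_le_mul_of_nonneg_left hL (abs_nonneg _)
    have h5 := pow_le_pow_left₀ (norm_nonneg _) h4 2
    have h6 := sq_abs (derivY U p)
    have h7 : 0 ≤ ‖gradX U (x, a)‖ ^ 2 := by positivity
    nlinarith [sq_nonneg (‖gradX U p‖ - |derivY U p| * L)]

/-- For fixed `x` a single depth meets the level `a`, so the contact set is null in the product. For
an exceptional `s` it may have positive measure, as when `η` has a plateau. -/
lemma ae_ae_depth_ne (hη : Continuous η) (a l : ℝ) :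
    ∀ᵐ s ∂(volume.restrict (Set.Ioo 0 l)), ∀ᵐ x ∂(torusMeasure d), η x - s ≠ a := by
  have hfin : IsFiniteMeasure (volume.restrict (Set.Ioo 0 l)) := ⟨by simp⟩
  refine Measure.ae_ae_of_ae_prod (p := fun q : ℝ × Horiz d => η q.2 - q.1 ≠ a) ?_
  have hm : MeasurableSet {q : ℝ × Horiz d | η q.2 - q.1 = a} :=
    measurableSet_eq_fun (by fun_prop) measurable_const
  rw [ae_iff]
  simp only [not_not]
  rw [Measure.prod_apply_symm hm]
  refine lintegral_eq_zero_of_ae_eq_zero (Eventually.of_forall fun x => ?_)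
  have : (fun s => (s, x)) ⁻¹' {q : ℝ × Horiz d | η q.2 - q.1 = a} = {η x - a} := by
    ext s; simp only [Set.mem_preimage, Set.mem_ofPred_eq, Set.mem_singleton_iff]
    constructor <;> intro h <;> linarith
  beta_reduce
  rw [this]
  exact measure_singleton _

/-- A horizontal slice near the bottom on which the gradient is controlled by the energy. -/
lemma exists_level (hU : ContDiff ℝ ∞ U) (hη : Continuous η) {h : ℝ} (hh : 0 < h)
    (hb : ∀ x, -(h / 2) < η x) :
    ∃ a, -h ≤ a ∧ a ≤ -(h / 2) ∧ ∫ x, ‖gradX U (x, a)‖ ^ 2 ∂(torusMeasure d) ≤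
      (2 / h) * ∫ p, (‖gradX U p‖ ^ 2 + derivY U p ^ 2) ∂(fluidMeasure h η) := by
  set g : Horiz d × ℝ → ℝ := fun p => ‖gradX U p‖ ^ 2 with hg
  have hgc : Continuous g := by
    have := continuous_gradX hU
    fun_prop
  have hec : Continuous fun p => ‖gradX U p‖ ^ 2 + derivY U p ^ 2 := by
    have := continuous_gradX hU
    have := continuous_derivY hU
    fun_prop
  set E := ∫ p, (‖gradX U p‖ ^ 2 + derivY U p ^ 2) ∂(fluidMeasure h η) with hE
  have hc : Continuous fun _ : Horiz d => -(h / 2) := continuous_const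
  -- The slab between `-h` and `-(h / 2)` lies in the fluid. It is sliced by the depth below its
  -- flat top.
  set f : ℝ → ℝ := fun s =>
    ∫ x, depthPart g (fun _ => -(h / 2)) (-h) s x ∂(torusMeasure d) with hf
  have hfi : IntegrableOn f (Set.Ioo 0 (h / 2)) :=
    (integrable_depthPart (a := -h) hgc hc (h / 2)).integral_prod_left
  have hle : fluidMeasure h (fun _ : Horiz d => -(h / 2)) ≤ fluidMeasure h η :=
    Measure.restrict_mono_set _
      fun p (hp : p ∈ _ ∩ _) => ⟨⟨hp.1.1, hp.1.2.trans (hb p.1)⟩, hp.2⟩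
  have hint : ∫ s in Set.Ioo 0 (h / 2), f s ≤ E := by
    refine (integral_depthPart_le hgc (fun p => by positivity) hc le_rfl (h / 2)).trans ?_
    have i1 : Integrable g (fluidMeasure h η) :=
      memLp_one_iff_integrable.1 (memLp_fluidMeasure_of_continuous hη hgc)
    have i2 : Integrable (fun p => ‖gradX U p‖ ^ 2 + derivY U p ^ 2) (fluidMeasure h η) :=
      memLp_one_iff_integrable.1 (memLp_fluidMeasure_of_continuous hη hec)
    refine (integral_mono_measure hle (Eventually.of_forall fun p => by positivity) i1).trans ?_
    exact integral_mono i1 i2 fun p => by simp only [hg]; nlinarith [sq_nonneg (derivY U p)]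
  -- Some slice is at most the average over the slab, which has width `h / 2`; hence the factor `2 /
  -- h`.
  obtain ⟨s, hs, hs2⟩ := exists_le_setAverage (μ := volume) (s := Set.Ioo 0 (h / 2))
    (by simp [hh]) (by simp) hfi
  refine ⟨-(h / 2) - s, by linarith [hs.2], by linarith [hs.1], ?_⟩
  have h1 : f s = ∫ x, ‖gradX U (x, -(h / 2) - s)‖ ^ 2 ∂(torusMeasure d) := by
    refine integral_congr_ae (Eventually.of_forall fun x => ?_)
    beta_reduce
    rw [depthPart, Set.indicator_of_mem]
    change -h < -(h / 2) - s
    linarith [hs.2]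
  rw [← h1]
  refine hs2.trans ?_
  rw [setAverage_eq, smul_eq_mul]
  have h2 : volume.real (Set.Ioo 0 (h / 2)) = h / 2 := by
    simp only [Real.volume_real_Ioo, sub_zero]
    exact max_eq_left (by positivity)
  rw [h2, inv_div]
  exact mul_le_mul_of_nonneg_left hint (by positivity)

lemma one_le_norm_latticeVec {ξ : Fin d → ℤ} (hξ : ξ ≠ 0) : 1 ≤ ‖(latticeVec ξ : Horiz d)‖ := by
  obtain ⟨j, hj⟩ := Function.ne_iff.1 hξ
  have h1 : (1 : ℝ) ≤ (ξ j : ℝ) ^ 2 := by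
    have : 1 ≤ (ξ j) ^ 2 := by
      have := Int.one_le_abs hj
      nlinarith [sq_abs (ξ j)]
    exact_mod_cast this
  have h2 : (ξ j : ℝ) ^ 2 ≤ ‖(latticeVec ξ : Horiz d)‖ ^ 2 := by
    rw [norm_latticeVec_sq]
    exact Finset.single_le_sum (f := fun j => (ξ j : ℝ) ^ 2) (fun _ _ => sq_nonneg _)
      (Finset.mem_univ j)
  nlinarith [norm_nonneg (latticeVec ξ : Horiz d)]

/-- The lower bound for the Dirichlet energy, for functions smooth up to the boundary. -/
theorem sum_hHalfTerm_le_of_smooth (hU : ContDiff ℝ ∞ U) (hp : IsPeriodicX U) {K : NNReal}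
    (hη : LipschitzWith K η) (hηp : IsPeriodic η) {h : ℝ} (hh : 0 < h)
    (hb : ∀ x, -(h / 2) < η x) {L : ℝ} (hL0 : 0 ≤ L)
    (hL : ∀ᵐ x ∂(torusMeasure d), ‖gradient η x‖ ≤ L) (F : Finset (Fin d → ℤ)) :
    ∑ ξ ∈ F, hHalfTerm (fun x => U (x, η x)) ξ ≤
      ((2 * Real.pi) ^ d)⁻¹ * ((1 + L) * (6 + 4 / h) *
        ∫ p, (‖gradX U p‖ ^ 2 + derivY U p ^ 2) ∂(fluidMeasure h η)) := by
  have hηc := hη.continuous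
  have hgX := continuous_gradX hU
  have hdY := continuous_derivY hU
  obtain ⟨a, ha, ha2, hslice⟩ := exists_level hU hηc hh hb
  have haη : ∀ x, a < η x := fun x => ha2.trans_lt (hb x)
  set E := ∫ p, (‖gradX U p‖ ^ 2 + derivY U p ^ 2) ∂(fluidMeasure h η) with hE
  set c := ((2 * Real.pi) ^ d)⁻¹ with hc
  have hc0 : 0 ≤ c := by positivity
  -- This length balances `(2 / l) * 2 * l ^ 2`, from the tangential gradients, against `2 * l`,
  -- from the vertical derivative, so the final constant is linear in the slope.
  set l := 1 + L with hl
  have hl0 : 0 < l := by positivity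
  set w : (Fin d → ℤ) → ℝ → ℂ := fun ξ s => fourierCoeff (depthTrace U η a s) ξ with hw
  set q : (Fin d → ℤ) → ℝ → ℂ := fun ξ s => fourierCoeff (depthPart (derivY U) η a s) ξ with hq
  obtain ⟨M₁, hM₁⟩ := depthTrace_bound (a := a) hU hηc l
  obtain ⟨M₂, hM₂⟩ := depthPart_bound (a := a) hdY hηc l
  set M := c * (max M₁ M₂ * (torusMeasure d).real Set.univ) with hM
  have bw : ∀ ξ, ∀ s ∈ Set.Ioo 0 l, ‖w ξ s‖ ≤ M := fun ξ s hs =>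
    norm_fourierCoeff_le (fun x hx => (hM₁ s hs x hx).trans (le_max_left _ _)) ξ
  have bq : ∀ ξ, ∀ s ∈ Set.Ioo 0 l, ‖q ξ s‖ ≤ M := fun ξ s hs =>
    norm_fourierCoeff_le (fun x hx => (hM₂ s hs x hx).trans (le_max_right _ _)) ξ
  have mw : ∀ ξ, StronglyMeasurable (w ξ) := fun ξ =>
    fourierCoeff_measurable (continuous_depthTrace (a := a) hU hηc).measurable ξ
  have mq : ∀ ξ, StronglyMeasurable (q ξ) := fun ξ =>
    fourierCoeff_measurable (measurable_depthPart (a := a) hdY hηc) ξ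
  have bsq : ∀ {z : ℂ}, ‖z‖ ≤ M → ‖‖z‖ ^ 2‖ ≤ M ^ 2 := fun {z} hz => by
    rw [Real.norm_of_nonneg (by positivity)]
    exact pow_le_pow_left₀ (norm_nonneg _) hz 2
  have iw : ∀ ξ, IntegrableOn (fun s => ‖w ξ s‖ ^ 2) (Set.Ioo 0 l) := fun ξ =>
    integrableOn_of_measurable_of_bound ((mw ξ).norm.pow 2).aestronglyMeasurable measurableSet_Ioo
      (by simp) fun s hs => bsq (bw ξ s hs)
  have iq : ∀ ξ, IntegrableOn (fun s => ‖q ξ s‖ ^ 2) (Set.Ioo 0 l) := fun ξ =>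
    integrableOn_of_measurable_of_bound ((mq ξ).norm.pow 2).aestronglyMeasurable measurableSet_Ioo
      (by simp) fun s hs => bsq (bq ξ s hs)
  have hterm : ∀ ξ ∈ F, hHalfTerm (fun x => U (x, η x)) ξ ≤
      (2 / l) * (∫ s in Set.Ioo 0 l, ‖(latticeVec ξ : Horiz d)‖ ^ 2 * ‖w ξ s‖ ^ 2) +
        2 * l * ∫ s in Set.Ioo 0 l, ‖q ξ s‖ ^ 2 := by
    intro ξ _
    rw [hHalfTerm, integral_const_mul]
    -- The trace inequality requires `|ξ| ≥ 1`, true for nonzero integer vectors; the zero frequency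
    -- has weight `0`.
    by_cases hξ : ξ = 0
    · have h0 : (latticeVec ξ : Horiz d) = 0 := by ext i; simp [hξ, latticeVec]
      rw [h0, norm_zero, zero_mul]
      have : 0 ≤ ∫ s in Set.Ioo 0 l, ‖q ξ s‖ ^ 2 := integral_nonneg fun _ => by positivity
      simp only [ne_eq, OfNat.ofNat_ne_zero, not_false_eq_true, zero_pow, zero_mul, mul_zero,
        zero_add]
      positivity
    · exact mul_norm_sq_le_of_eq_add_integral hl0 (one_le_norm_latticeVec hξ) (mw ξ) (mq ξ)
        (bw ξ) (bq ξ) fun s hs => fourierCoeff_eq_add_integral hU hηc haη hs.1 ξ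
  set g₁ : Horiz d × ℝ → ℝ := fun p => 2 * ‖gradX U p‖ ^ 2 + 2 * L ^ 2 * derivY U p ^ 2 with hg₁
  set g₂ : Horiz d × ℝ → ℝ := fun p => derivY U p ^ 2 with hg₂
  have cg₁ : Continuous g₁ := by fun_prop
  have cg₂ : Continuous g₂ := by fun_prop
  set T := ∫ x, ‖gradX U (x, a)‖ ^ 2 ∂(torusMeasure d) with hT
  -- At almost every depth, the gradient of the trace dominates the weighted sum of its
  -- coefficients. The frozen slice contributes `T` per unit of depth, hence `l * T`.
  have hW : ∑ ξ ∈ F, ∫ s in Set.Ioo 0 l, ‖(latticeVec ξ : Horiz d)‖ ^ 2 * ‖w ξ s‖ ^ 2 ≤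
      c * ((∫ s in Set.Ioo 0 l, (∫ x, depthPart g₁ η a s x ∂(torusMeasure d))) + l * T) := by
    rw [← integral_finsetSum _ fun ξ _ => (iw ξ).const_mul _]
    have hint := (integrable_depthPart (a := a) cg₁ hηc l)
    have hint1 : IntegrableOn (fun s => ∫ x, depthPart g₁ η a s x ∂(torusMeasure d))
      (Set.Ioo 0 l) := hint.integral_prod_left
    have iT : Integrable (fun x => ‖gradX U (x, a)‖ ^ 2) (torusMeasure d) :=
      memLp_one_iff_integrable.1 (memLp_torusMeasure_of_continuous (by fun_prop))
    have hfin : IsFiniteMeasure (volume.restrict (Set.Ioo 0 l)) := ⟨by simp⟩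
    have hl' : (volume.restrict (Set.Ioo 0 l)).real Set.univ = l := by simp [hl0.le]
    have e1 : c * ((∫ s in Set.Ioo 0 l, (∫ x, depthPart g₁ η a s x ∂(torusMeasure d))) + l * T) =
        ∫ s in Set.Ioo 0 l, c * ((∫ x, depthPart g₁ η a s x ∂(torusMeasure d)) + T) := by
      rw [integral_const_mul, integral_add hint1 (integrable_const _), integral_const, hl',
        smul_eq_mul]
    rw [e1]
    refine integral_mono_ae (integrable_finsetSum _ fun ξ _ => (iw ξ).const_mul _)
      ((hint1.add (integrable_const _)).const_mul _) ?_
    have hint2 : ∀ᵐ s ∂(volume.restrict (Set.Ioo 0 l)),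
        Integrable (fun x => depthPart g₁ η a s x) (torusMeasure d) :=
      hint.prod_right_ae
    filter_upwards [ae_ae_depth_ne hηc a l, hint2] with s hs hs2
    obtain ⟨K', hK'⟩ := exists_lipschitzWith_depthTrace (a := a) hU hp hη hηp s
    refine (sum_normSq_mul_fourierCoeff_le hK' (isPeriodic_depthTrace hp hηp s) F).trans ?_
    refine mul_le_mul_of_nonneg_left ?_ hc0
    rw [hT, ← integral_add hs2 iT]
    refine integral_mono_of_nonneg (Eventually.of_forall fun x => by positivity)
      (hs2.add iT) ?_
    filter_upwards [hs, hL, ae_restrict_of_ae (hη.ae_differentiableAt (μ := volume))]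
      with x hx hx2 hx3
    exact norm_gradient_depthTrace_sq_le hU hx3 hηc hx2 hx
  have hQ : ∑ ξ ∈ F, ∫ s in Set.Ioo 0 l, ‖q ξ s‖ ^ 2 ≤
      c * ∫ s in Set.Ioo 0 l, (∫ x, depthPart g₂ η a s x ∂(torusMeasure d)) := by
    rw [← integral_finsetSum _ fun ξ _ => iq ξ, ← integral_const_mul]
    have hint := (integrable_depthPart (a := a) cg₂ hηc l)
    have hint1 : IntegrableOn (fun s => ∫ x, depthPart g₂ η a s x ∂(torusMeasure d))
      (Set.Ioo 0 l) := hint.integral_prod_left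
    refine setIntegral_mono_on (integrable_finsetSum _ fun ξ _ => iq ξ) (hint1.const_mul _)
      measurableSet_Ioo fun s hs => ?_
    have hm : MemLp (depthPart (derivY U) η a s) 2 (torusMeasure d) := by
      refine MemLp.of_bound ?_ M₂ ?_
      · exact ((measurable_depthPart (a := a) hdY hηc).comp
          measurable_prodMk_left).aestronglyMeasurable
      · filter_upwards [ae_restrict_mem (measurableSet_cell d)] with x hx using hM₂ s hs x hx
    refine (sum_sq_fourierCoeff_le hm F).trans_eq ?_
    congr 2
    funext x
    simp only [depthPart, Set.indicator, hg₂]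
    split_ifs <;> simp
  have he : Continuous fun p => ‖gradX U p‖ ^ 2 + derivY U p ^ 2 := by fun_prop
  have ie : Integrable (fun p => ‖gradX U p‖ ^ 2 + derivY U p ^ 2) (fluidMeasure h η) :=
    memLp_one_iff_integrable.1 (memLp_fluidMeasure_of_continuous hηc he)
  have hE₁ : ∫ s in Set.Ioo 0 l, (∫ x, depthPart g₁ η a s x ∂(torusMeasure d)) ≤
      2 * l ^ 2 * E := by
    refine (integral_depthPart_le cg₁ (fun p => by positivity) hηc ha l).trans ?_
    rw [hE, ← integral_const_mul]
    refine integral_mono (memLp_one_iff_integrable.1 (memLp_fluidMeasure_of_continuous hηc cg₁))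
      (ie.const_mul _) fun p => ?_
    simp only [hg₁, hl]
    nlinarith [mul_nonneg hL0 (sq_nonneg ‖gradX U p‖), mul_nonneg hL0 (sq_nonneg (derivY U p)),
      mul_nonneg (sq_nonneg L) (sq_nonneg ‖gradX U p‖), sq_nonneg (derivY U p)]
  have hE₂ : ∫ s in Set.Ioo 0 l, (∫ x, depthPart g₂ η a s x ∂(torusMeasure d)) ≤ E := by
    refine (integral_depthPart_le cg₂ (fun p => by positivity) hηc ha l).trans ?_
    refine integral_mono (memLp_one_iff_integrable.1 (memLp_fluidMeasure_of_continuous hηc cg₂))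
      ie fun p => ?_
    simp only [hg₂]
    nlinarith [sq_nonneg ‖gradX U p‖]
  refine (Finset.sum_le_sum hterm).trans ?_
  rw [Finset.sum_add_distrib, ← Finset.mul_sum, ← Finset.mul_sum]
  -- The tangential gradients give `4 * l`, the frozen slice `4 / h`, and the vertical derivative `2
  -- * l`.
  calc (2 / l) * (∑ ξ ∈ F, ∫ s in Set.Ioo 0 l, ‖(latticeVec ξ : Horiz d)‖ ^ 2 * ‖w ξ s‖ ^ 2) +
        2 * l * ∑ ξ ∈ F, ∫ s in Set.Ioo 0 l, ‖q ξ s‖ ^ 2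
      ≤ (2 / l) * (c * (2 * l ^ 2 * E + l * (2 / h * E))) + 2 * l * (c * E) := by
        gcongr
        · exact hW.trans (by gcongr)
        · exact hQ.trans (by gcongr)
    _ = c * ((6 * l + 4 / h) * E) := by field_simp; ring
    _ ≤ c * (l * (6 + 4 / h) * E) := by
        have hE0 : 0 ≤ E := integral_nonneg fun p => by positivity
        have : 4 / h ≤ l * (4 / h) := le_mul_of_one_le_left (by positivity) (by linarith)
        gcongr
        linarith

end

/-! ### Limits of smooth functions -/

section L2

variable {α F : Type*} [MeasurableSpace α] {μ : Measure α} [NormedAddCommGroup F]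

lemma tendsto_integral_norm_sq {f : ℕ → α → F} {g : α → F} (hf : ∀ n, MemLp (f n) 2 μ)
    (hg : MemLp g 2 μ) (h : Tendsto (fun n => eLpNorm (fun x => f n x - g x) 2 μ) atTop (𝓝 0)) :
    Tendsto (fun n => ∫ x, ‖f n x‖ ^ 2 ∂μ) atTop (𝓝 (∫ x, ‖g x‖ ^ 2 ∂μ)) := by
  have h1 := ((Lp.tendsto_Lp_iff_tendsto_eLpNorm'' f hf g hg).2 h).norm.pow 2
  simp only [Lp.norm_toLp] at h1
  rw [integral_norm_sq hg.1]
  refine h1.congr fun n => ?_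
  rw [integral_norm_sq (hf n).1]

variable [NormedSpace ℝ F]

lemma integrable_smul_of_memLp_two {f : α → ℝ} {g : α → F} (hf : MemLp f 2 μ)
    (hg : MemLp g 2 μ) : Integrable (fun x => f x • g x) μ :=
  memLp_one_iff_integrable.1 (hg.smul hf)

lemma tendsto_integral_smul_right {f : α → ℝ} {g : ℕ → α → F} {g' : α → F} (hf : MemLp f 2 μ)
    (hg : ∀ n, MemLp (g n) 2 μ) (hg' : MemLp g' 2 μ)
    (h : Tendsto (fun n => eLpNorm (fun x => g n x - g' x) 2 μ) atTop (𝓝 0)) :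
    Tendsto (fun n => ∫ x, f x • g n x ∂μ) atTop (𝓝 (∫ x, f x • g' x ∂μ)) := by
  refine tendsto_integral_of_L1' _ (integrable_smul_of_memLp_two hf hg').1
    (Eventually.of_forall fun n => integrable_smul_of_memLp_two hf (hg n)) ?_
  have h1 := ENNReal.Tendsto.const_mul (a := eLpNorm f 2 μ) h (Or.inr hf.eLpNorm_ne_top)
  rw [mul_zero] at h1
  refine tendsto_of_tendsto_of_tendsto_of_le_of_le tendsto_const_nhds h1 (fun _ => zero_le) ?_
  intro n
  have : (fun x => f x • g n x) - (fun x => f x • g' x) = f • (fun x => g n x - g' x) := by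
    funext x; simp [smul_sub]
  beta_reduce
  rw [this]
  exact eLpNorm_smul_le_mul_eLpNorm ((hg n).sub hg').1 hf.1

lemma tendsto_integral_smul_left {f : ℕ → α → ℝ} {f' : α → ℝ} {g : α → F} (hg : MemLp g 2 μ)
    (hf : ∀ n, MemLp (f n) 2 μ) (hf' : MemLp f' 2 μ)
    (h : Tendsto (fun n => eLpNorm (fun x => f n x - f' x) 2 μ) atTop (𝓝 0)) :
    Tendsto (fun n => ∫ x, f n x • g x ∂μ) atTop (𝓝 (∫ x, f' x • g x ∂μ)) := by
  refine tendsto_integral_of_L1' _ (integrable_smul_of_memLp_two hf' hg).1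
    (Eventually.of_forall fun n => integrable_smul_of_memLp_two (hf n) hg) ?_
  have h1 := ENNReal.Tendsto.mul_const (b := eLpNorm g 2 μ) h (Or.inr hg.eLpNorm_ne_top)
  rw [zero_mul] at h1
  refine tendsto_of_tendsto_of_tendsto_of_le_of_le tendsto_const_nhds h1 (fun _ => zero_le) ?_
  intro n
  have : (fun x => f n x • g x) - (fun x => f' x • g x) = (fun x => f n x - f' x) • g := by
    funext x; simp [sub_smul]
  beta_reduce
  rw [this]
  exact eLpNorm_smul_le_mul_eLpNorm hg.1 ((hf n).sub hf').1

end L2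

section

variable {d : ℕ} {h : ℝ} {η : Horiz d → ℝ}

lemma IsLipschitzSurface.bddBelow (hη : IsLipschitzSurface η) : BddBelow (Set.range η) := by
  obtain ⟨hp, K, hK⟩ := hη
  obtain ⟨M, hM⟩ := hp.exists_bound hK.continuous
  refine ⟨-M, ?_⟩
  rintro _ ⟨x, rfl⟩
  exact (abs_le.1 (hM x)).1

lemma IsLipschitzSurface.lt_of_lt_iInf (hη : IsLipschitzSurface η) {m : ℝ}
    (hm : m < ⨅ x, η x) (x : Horiz d) : m < η x :=
  hm.trans_le (ciInf_le hη.bddBelow x)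

/-- The real number `gradSupNorm η` represents the essential supremum only when the latter is
finite, which the Lipschitz bound ensures. -/
lemma ae_norm_gradient_le_gradSupNorm (hη : IsLipschitzSurface η) :
    ∀ᵐ x ∂(torusMeasure d), ‖gradient η x‖ ≤ gradSupNorm η := by
  obtain ⟨hp, K, hK⟩ := hη
  have hfin : eLpNorm (fun x => gradient η x) ⊤ (torusMeasure d) ≠ ⊤ := by
    refine ne_top_of_le_ne_top ENNReal.coe_ne_top
      (eLpNormEssSup_le_of_ae_nnnorm_bound (C := K) (Eventually.of_forall fun x => ?_))
    exact_mod_cast norm_gradient_le_of_lipschitz hK x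
  filter_upwards [ae_le_eLpNormEssSup (f := fun x => gradient η x) (μ := torusMeasure d)]
    with x hx
  rw [gradSupNorm, ← ENNReal.ofReal_le_iff_le_toReal hfin, ofReal_norm, eLpNorm_exponent_top]
  exact hx

lemma gradSupNorm_le {C : ℝ} (hC : 0 ≤ C) (h : ∀ x, ‖gradient η x‖ ≤ C) : gradSupNorm η ≤ C := by
  refine ENNReal.toReal_le_of_le_ofReal hC ?_
  exact eLpNormEssSup_le_of_ae_bound (Eventually.of_forall h)

/-- The lower bound for the Dirichlet energy. -/
theorem hHalfNormSq_le_dirichletForm (hη : IsLipschitzSurface η) (hh : 0 < h)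
    (hb : ∀ x, -(h / 2) < η x) {ψ : Horiz d → ℝ} (hψ : MemHHalf ψ) {φ : FunWithGrad d}
    (hφ : MemH1 h η φ) (ht : HasTrace h η φ ψ) :
    hHalfNormSq ψ ≤ ((2 * Real.pi) ^ d)⁻¹ * ((1 + gradSupNorm η) * (6 + 4 / h) *
        dirichletForm h η φ φ) := by
  obtain ⟨U, hU, -, hx, hy, hs⟩ := ht
  have hae := ae_norm_gradient_le_gradSupNorm hη
  obtain ⟨hp, K, hK⟩ := hη
  have hηc := hK.continuous
  have := isFiniteMeasure_fluidMeasure (h := h) hηc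
  have hmx : ∀ n, MemLp (gradX (U n)) 2 (fluidMeasure h η) := fun n =>
    memLp_fluidMeasure_of_continuous hηc (continuous_gradX (hU n).1)
  have hmy : ∀ n, MemLp (derivY (U n)) 2 (fluidMeasure h η) := fun n =>
    memLp_fluidMeasure_of_continuous hηc (continuous_derivY (hU n).1)
  have hE : Tendsto (fun n => ∫ p, (‖gradX (U n) p‖ ^ 2 + derivY (U n) p ^ 2)
      ∂(fluidMeasure h η)) atTop (𝓝 (dirichletForm h η φ φ)) := by
    have h1 := (tendsto_integral_norm_sq hmx hφ.memLp_dx hx).add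
      (tendsto_integral_norm_sq hmy hφ.memLp_dy hy)
    have h2 : dirichletForm h η φ φ = ∫ p, ‖φ.dx p‖ ^ 2 ∂(fluidMeasure h η) +
        ∫ p, ‖φ.dy p‖ ^ 2 ∂(fluidMeasure h η) := by
      rw [← integral_add hφ.memLp_dx.integrable_norm_pow' hφ.memLp_dy.integrable_norm_pow']
      refine integral_congr_ae (Eventually.of_forall fun p => ?_)
      simp [← pow_two]
    rw [h2]
    refine h1.congr fun n => ?_
    rw [← integral_add (hmx n).integrable_norm_pow' (hmy n).integrable_norm_pow']
    simp
  have hψn : ∀ n, MemLp (fun x => U n (x, η x)) 2 (torusMeasure d) := fun n =>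
    memLp_torusMeasure_of_continuous ((hU n).1.continuous.comp (by fun_prop))
  -- The approximating traces converge only in `L²`, so their seminorms need not converge. On
  -- finitely many frequencies they do, and the bound for finite sums passes to the series.
  refine Real.tsum_le_of_sum_le (fun ξ => by unfold hHalfTerm; positivity) fun F => ?_
  refine le_of_tendsto_of_tendsto (b := atTop) (tendsto_finsetSum (f := fun ξ n =>
    hHalfTerm (fun x => U n (x, η x)) ξ) F fun ξ _ => ?_) ((hE.const_mul _).const_mul _)
    (Eventually.of_forall fun n => ?_)
  · exact ((tendsto_fourierCoeff hψn hψ.memLp hs ξ).norm.pow 2).const_mul _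
  · exact sum_hHalfTerm_le_of_smooth (hU n).1 (hU n).2 hK hp hh hb ENNReal.toReal_nonneg hae F

end

/-! ### Weak gradients -/

instance (d : ℕ) : (volume : Measure (Horiz d × ℝ)).IsAddHaarMeasure :=
  inferInstanceAs ((volume : Measure (Horiz d)).prod (volume : Measure ℝ)).IsAddHaarMeasure

section

variable {d : ℕ} {h : ℝ} {η : Horiz d → ℝ}

/-- Translation of `ℝ^d × ℝ` by a period. -/
noncomputable def shift {d : ℕ} (n : Fin d → ℤ) (p : Horiz d × ℝ) : Horiz d × ℝ :=
  p + ((2 * Real.pi) • latticeVec n, 0)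

lemma measurableEmbedding_shift (n : Fin d → ℤ) : MeasurableEmbedding (shift n) :=
  measurableEmbedding_addRight _

lemma IsPeriodicX.comp_shift {α : Type*} {f : Horiz d × ℝ → α} (hf : IsPeriodicX f)
    (n : Fin d → ℤ) : f ∘ shift n = f := by
  funext p
  obtain ⟨x, y⟩ := p
  simpa [shift] using hf y n x

lemma exists_shift_mem {K : Set (Horiz d × ℝ)} (hK : IsCompact K) :
    ∃ T : Finset (Fin d → ℤ), ∀ p ∈ K, ∃ n ∈ T, ∃ q : Horiz d × ℝ, q.1 ∈ cell d ∧ shift n q = p := by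
  obtain ⟨R, hR⟩ := hK.isBounded.exists_norm_le
  obtain ⟨N, hN⟩ := exists_nat_gt (R / (2 * Real.pi))
  have hp : 0 < 2 * Real.pi := by positivity
  refine ⟨Fintype.piFinset fun _ => Finset.Icc (-(N + 1) : ℤ) (N + 1), fun p hpK => ?_⟩
  refine ⟨fun i => ⌊p.1 i / (2 * Real.pi)⌋, ?_,
    shift (-fun i => ⌊p.1 i / (2 * Real.pi)⌋) p, fun i => ?_, ?_⟩
  · rw [Fintype.mem_piFinset]
    intro i
    have h1 : |p.1 i| ≤ R :=
      ((PiLp.norm_apply_le p.1 i).trans (norm_fst_le p)).trans (hR p hpK)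
    have h2 : |p.1 i / (2 * Real.pi)| ≤ N := by
      rw [abs_div, abs_of_pos hp]
      exact (div_le_div_of_nonneg_right h1 hp.le).trans hN.le
    have h3 := abs_le.1 h2
    rw [Finset.mem_Icc]
    constructor
    · rw [Int.le_floor]; push_cast; linarith [h3.1]
    · have : (⌊p.1 i / (2 * Real.pi)⌋ : ℝ) ≤ ((N + 1 : ℤ) : ℝ) := by
        push_cast
        exact (Int.floor_le _).trans (by linarith [h3.2])
      exact_mod_cast this
  · have e : p.1 i = (p.1 i / (2 * Real.pi)) * (2 * Real.pi) := by field_simp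
    have h1 := Int.floor_le (p.1 i / (2 * Real.pi))
    have h2 := Int.lt_floor_add_one (p.1 i / (2 * Real.pi))
    simp only [shift, Prod.fst_add, PiLp.add_apply, PiLp.smul_apply, latticeVec, smul_eq_mul,
      Pi.neg_apply, Set.mem_Ico]
    push_cast
    constructor <;> nlinarith
  · have : latticeVec (-fun i => ⌊p.1 i / (2 * Real.pi)⌋) =
        -(latticeVec (fun i => ⌊p.1 i / (2 * Real.pi)⌋) : Horiz d) := by
      ext i; simp [latticeVec]
    simp [shift, this, add_assoc]

/-- A compact part of the lifted fluid domain is covered by finitely many periods. -/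
lemma exists_restrict_le_sum (hp : IsPeriodic η) {K : Set (Horiz d × ℝ)}
    (hK : IsCompact K) (hKs : K ⊆ fluidDomain h η) :
    ∃ T : Finset (Fin d → ℤ), volume.restrict K ≤
      ∑ n ∈ T, (fluidMeasure h η).map (shift n) := by
  obtain ⟨T, hT⟩ := exists_shift_mem hK
  refine ⟨T, Measure.le_iff.2 fun A hA => ?_⟩
  rw [Measure.restrict_apply hA, Measure.finsetSum_apply]
  have h1 : A ∩ K ⊆ ⋃ n ∈ T, shift n '' (shift n ⁻¹' A ∩
      (fluidDomain h η ∩ {p | p.1 ∈ cell d})) := by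
    intro p hpA
    obtain ⟨n, hn, q, hq, rfl⟩ := hT p hpA.2
    have h2 : q ∈ fluidDomain h η := by
      have h3 := hKs hpA.2
      simp only [fluidDomain, shift, Set.mem_ofPred_eq, Prod.snd_add, Prod.fst_add, add_zero] at h3 ⊢
      rwa [hp n q.1] at h3
    simp only [Set.mem_iUnion]
    exact ⟨n, hn, q, ⟨hpA.1, h2, hq⟩, rfl⟩
  refine (measure_mono h1).trans ((measure_biUnion_finset_le _ _).trans
    (Finset.sum_le_sum fun n _ => ?_))
  rw [(measurableEmbedding_shift n).map_apply, fluidMeasure,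
    Measure.restrict_apply ((measurableEmbedding_shift n).measurable hA)]
  unfold shift
  rw [Set.image_add_right, measure_preimage_add_right]

lemma memLp_map_shift {F : Type*} [NormedAddCommGroup F] {f : Horiz d × ℝ → F}
    (hf : IsPeriodicX f) (n : Fin d → ℤ) {p : ℝ≥0∞} (hm : MemLp f p (fluidMeasure h η)) :
    MemLp f p ((fluidMeasure h η).map (shift n)) := by
  rw [(measurableEmbedding_shift n).memLp_map_measure_iff, hf.comp_shift]
  exact hm

/-- Norms on `Ω` are taken over one period, while a compact subset of the lift may meet several. The
constant counts the translates that cover it. -/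
lemma exists_eLpNorm_restrict_le (hp : IsPeriodic η)
    {K : Set (Horiz d × ℝ)} (hK : IsCompact K) (hKs : K ⊆ fluidDomain h η)
    (F : Type*) [NormedAddCommGroup F] :
    ∃ N : ℕ, ∀ f : Horiz d × ℝ → F, IsPeriodicX f →
      eLpNorm f 2 (volume.restrict K) ^ 2 ≤ N * eLpNorm f 2 (fluidMeasure h η) ^ 2 := by
  obtain ⟨T, hT⟩ := exists_restrict_le_sum hp hK hKs
  refine ⟨T.card, fun f hf => ?_⟩
  simp only [eLpNorm_two_sq]
  refine (lintegral_mono' hT le_rfl).trans ?_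
  rw [lintegral_finsetSum_measure, ← nsmul_eq_mul]
  refine Finset.sum_le_card_nsmul _ _ _ fun n _ => ?_
  rw [(measurableEmbedding_shift n).lintegral_map]
  refine lintegral_mono fun p => ?_
  have := congrFun (hf.comp_shift n) p
  simp only [Function.comp_apply] at this
  rw [this]

lemma memLp_restrict_of_periodic (hp : IsPeriodic η) {K : Set (Horiz d × ℝ)}
    (hK : IsCompact K) (hKs : K ⊆ fluidDomain h η) {F : Type*} [NormedAddCommGroup F]
    {f : Horiz d × ℝ → F} (hf : IsPeriodicX f) (hm : MemLp f 2 (fluidMeasure h η)) :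
    MemLp f 2 (volume.restrict K) := by
  obtain ⟨T, hT⟩ := exists_restrict_le_sum hp hK hKs
  obtain ⟨N, hN⟩ := exists_eLpNorm_restrict_le hp hK hKs F
  refine ⟨AEStronglyMeasurable.mono_measure ?_ hT, ?_⟩
  · clear hT
    induction T using Finset.induction_on with
    | empty => simp
    | insert n T hn ih =>
      rw [Finset.sum_insert hn]
      exact (memLp_map_shift hf n hm).1.add_measure ih
  · have h1 := (hN f hf).trans_lt (ENNReal.mul_lt_top (ENNReal.natCast_lt_top N)
      (ENNReal.pow_lt_top hm.2))
    exact (ENNReal.pow_lt_top_iff.1 h1).resolve_right (by norm_num)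

lemma tendsto_eLpNorm_restrict (hp : IsPeriodic η)
    {K : Set (Horiz d × ℝ)} (hK : IsCompact K) (hKs : K ⊆ fluidDomain h η)
    {F : Type*} [NormedAddCommGroup F] {f : ℕ → Horiz d × ℝ → F} (hf : ∀ n, IsPeriodicX (f n))
    (ht : Tendsto (fun n => eLpNorm (f n) 2 (fluidMeasure h η)) atTop (𝓝 0)) :
    Tendsto (fun n => eLpNorm (f n) 2 (volume.restrict K)) atTop (𝓝 0) := by
  obtain ⟨N, hN⟩ := exists_eLpNorm_restrict_le hp hK hKs F
  have h1 : Tendsto (fun n => (N : ℝ≥0∞) * eLpNorm (f n) 2 (fluidMeasure h η) ^ 2) atTop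
      (𝓝 0) := by
    have := ENNReal.Tendsto.const_mul (a := (N : ℝ≥0∞)) (ENNReal.Tendsto.pow (n := 2) ht)
      (Or.inr (ENNReal.natCast_ne_top N))
    simpa using this
  have h2 : Tendsto (fun n => eLpNorm (f n) 2 (volume.restrict K) ^ 2) atTop (𝓝 0) :=
    tendsto_of_tendsto_of_tendsto_of_le_of_le tendsto_const_nhds h1 (fun _ => zero_le)
      fun n => hN (f n) (hf n)
  have h3 := h2.ennrpow_const (1 / 2 : ℝ)
  rw [ENNReal.zero_rpow_of_pos (by norm_num)] at h3
  refine h3.congr fun n => ?_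
  rw [← ENNReal.rpow_natCast, ← ENNReal.rpow_mul]
  norm_num

/-- Integration by parts for smooth functions. -/
lemma integral_mul_fderiv_eq {U θ : Horiz d × ℝ → ℝ} (hU : ContDiff ℝ ∞ U)
    (hθ : ContDiff ℝ ∞ θ) (hc : HasCompactSupport θ) (v : Horiz d × ℝ) :
    ∫ p, U p * fderiv ℝ θ p v = -∫ p, θ p * fderiv ℝ U p v := by
  have h1 : Continuous fun p => fderiv ℝ U p v := (hU.continuous_fderiv (by simp)).clm_apply
    continuous_const
  have h2 : Continuous fun p => fderiv ℝ θ p v := (hθ.continuous_fderiv (by simp)).clm_apply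
    continuous_const
  rw [integral_mul_fderiv_eq_neg_fderiv_mul_of_integrable
    ((h1.mul hθ.continuous).integrable_of_hasCompactSupport hc.mul_left)
    ((hU.continuous.mul h2).integrable_of_hasCompactSupport (hc.fderiv_apply ℝ v).mul_left)
    ((hU.continuous.mul hθ.continuous).integrable_of_hasCompactSupport hc.mul_left)
    (fun x _ => hU.differentiable (by simp) x) (fun x _ => hθ.differentiable (by simp) x)]
  simp only [mul_comm]

lemma hasCompactSupport_gradX {θ : Horiz d × ℝ → ℝ} (hθ : ContDiff ℝ ∞ θ)
    (hc : HasCompactSupport θ) : HasCompactSupport (gradX θ) := by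
  refine (hc.fderiv ℝ).mono ?_
  intro p hp
  contrapose! hp
  simp only [Function.mem_support, not_not] at hp ⊢
  rw [gradX_eq hθ, hp]; simp

lemma integral_smul_gradX_eq {U θ : Horiz d × ℝ → ℝ} (hU : ContDiff ℝ ∞ U)
    (hθ : ContDiff ℝ ∞ θ) (hc : HasCompactSupport θ) :
    ∫ p, U p • gradX θ p = -∫ p, θ p • gradX U p := by
  have i1 : Integrable fun p => U p • gradX θ p :=
    (hU.continuous.smul (continuous_gradX hθ)).integrable_of_hasCompactSupport
      (hasCompactSupport_gradX hθ hc).smul_left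
  have i2 : Integrable fun p => θ p • gradX U p :=
    (hθ.continuous.smul (continuous_gradX hU)).integrable_of_hasCompactSupport hc.smul_right
  refine ext_inner_left ℝ fun v => ?_
  rw [inner_neg_right, ← integral_inner i1, ← integral_inner i2]
  have e : ∀ {W : Horiz d × ℝ → ℝ}, ContDiff ℝ ∞ W → ∀ p,
      inner ℝ v (gradX W p) = fderiv ℝ W p (v, 0) := fun hW p => by
    rw [fderiv_apply_eq hW, zero_mul, add_zero, real_inner_comm]
  simp only [inner_smul_right, e hU, e hθ]
  exact integral_mul_fderiv_eq hU hθ hc (v, 0)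

lemma integral_mul_derivY_eq {U θ : Horiz d × ℝ → ℝ} (hU : ContDiff ℝ ∞ U)
    (hθ : ContDiff ℝ ∞ θ) (hc : HasCompactSupport θ) :
    ∫ p, U p * derivY θ p = -∫ p, θ p * derivY U p := by
  simp only [derivY_eq hU, derivY_eq hθ]
  exact integral_mul_fderiv_eq hU hθ hc (0, 1)

lemma tsupport_gradX_subset (θ : Horiz d × ℝ → ℝ) (hθ : ContDiff ℝ ∞ θ) :
    Function.support (gradX θ) ⊆ tsupport θ := by
  intro p hp
  by_contra h
  have h1 : fderiv ℝ θ p = 0 := by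
    have := support_fderiv_subset ℝ (f := θ)
    by_contra h2
    exact h (this h2)
  exact hp (by rw [gradX_eq hθ, h1]; simp)

lemma tsupport_derivY_subset (θ : Horiz d × ℝ → ℝ) (hθ : ContDiff ℝ ∞ θ) :
    Function.support (derivY θ) ⊆ tsupport θ := by
  intro p hp
  by_contra h
  have h1 : fderiv ℝ θ p = 0 := by
    have := support_fderiv_subset ℝ (f := θ)
    by_contra h2
    exact h (this h2)
  exact hp (by rw [derivY_eq hθ, h1]; simp)

lemma IsPeriodicX.sub {F : Type*} [AddGroup F] {f g : Horiz d × ℝ → F} (hf : IsPeriodicX f)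
    (hg : IsPeriodicX g) : IsPeriodicX fun p => f p - g p := fun y n x => by
  have h1 := hf y n x
  have h2 := hg y n x
  simp only at h1 h2 ⊢
  rw [h1, h2]

/-- A limit of smooth functions is in `H¹(Ω)`. -/
lemma MemH1.of_hasTrace (hp : IsPeriodic η) {u : FunWithGrad d}
    (pv : IsPeriodicX u.val) (px : IsPeriodicX u.dx) (py : IsPeriodicX u.dy)
    (mv : MemLp u.val 2 (fluidMeasure h η)) (mx : MemLp u.dx 2 (fluidMeasure h η))
    (my : MemLp u.dy 2 (fluidMeasure h η)) {ψ : Horiz d → ℝ} (ht : HasTrace h η u ψ) :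
    MemH1 h η u := by
  obtain ⟨U, hU, hv, hx, hy, -⟩ := ht
  -- The integrals against a test function only see its compact support, where the approximating
  -- functions and their gradients converge in `L²`. Integration by parts for smooth functions then
  -- passes to the limit.
  have hrestr : ∀ {F : Type _} [NormedAddCommGroup F] [NormedSpace ℝ F]
      {θ : Horiz d × ℝ → ℝ} {g : Horiz d × ℝ → F}, Function.support g ⊆ tsupport θ →
      ∫ p, g p = ∫ p in tsupport θ, g p := fun {F _ _ θ g} hs =>
    (setIntegral_eq_integral_of_forall_compl_eq_zero fun p hp => by
      by_contra h
      exact hp (hs h)).symm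
  have hcont : ∀ {F : Type _} [NormedAddCommGroup F] {K : Set (Horiz d × ℝ)}
      {g : Horiz d × ℝ → F}, IsCompact K → Continuous g → MemLp g 2 (volume.restrict K) :=
    fun {F _ K g} hK hg => by
      obtain ⟨M, hM⟩ := hK.exists_bound_of_continuousOn hg.continuousOn
      have : IsFiniteMeasure (volume.restrict K) := ⟨by simpa using hK.measure_lt_top⟩
      refine MemLp.of_bound hg.aestronglyMeasurable M ?_
      filter_upwards [ae_restrict_mem hK.measurableSet] with p hp using hM p hp
  refine ⟨pv, px, py, mv, mx, my, fun θ hθ hc hs => ?_, fun θ hθ hc hs => ?_⟩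
  · have hK : IsCompact (tsupport θ) := hc
    have hgθ := continuous_gradX hθ
    have L1 := tendsto_integral_smul_left (μ := volume.restrict (tsupport θ))
      (f := U) (g := gradX θ) (hcont hK hgθ) (fun n => hcont hK (hU n).1.continuous)
      (memLp_restrict_of_periodic hp hK hs pv mv)
      (tendsto_eLpNorm_restrict hp hK hs (fun n => (hU n).2.sub pv) hv)
    have L2 := tendsto_integral_smul_right (μ := volume.restrict (tsupport θ))
      (f := θ) (g := fun n => gradX (U n)) (hcont hK hθ.continuous)
      (fun n => hcont hK (continuous_gradX (hU n).1))
      (memLp_restrict_of_periodic hp hK hs px mx)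
      (tendsto_eLpNorm_restrict hp hK hs (fun n => (hU n).2.gradX.sub px) hx)
    have s1 : ∀ f : Horiz d × ℝ → ℝ, Function.support (fun p => f p • gradX θ p) ⊆ tsupport θ :=
      fun f => (Function.support_smul_subset_right f (gradX θ)).trans (tsupport_gradX_subset θ hθ)
    have s2 : ∀ f : Horiz d × ℝ → Horiz d, Function.support (fun p => θ p • f p) ⊆ tsupport θ :=
      fun f => (Function.support_smul_subset_left _ _).trans (subset_tsupport θ)
    rw [hrestr (s1 _), hrestr (s2 _)]
    refine tendsto_nhds_unique (L1.congr fun n => ?_) L2.neg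
    rw [← hrestr (s1 _), ← hrestr (s2 _)]
    exact integral_smul_gradX_eq (hU n).1 hθ hc
  · have hK : IsCompact (tsupport θ) := hc
    have hgθ := continuous_derivY hθ
    have L1 := tendsto_integral_smul_left (μ := volume.restrict (tsupport θ))
      (f := U) (g := derivY θ) (hcont hK hgθ) (fun n => hcont hK (hU n).1.continuous)
      (memLp_restrict_of_periodic hp hK hs pv mv)
      (tendsto_eLpNorm_restrict hp hK hs (fun n => (hU n).2.sub pv) hv)
    have L2 := tendsto_integral_smul_right (μ := volume.restrict (tsupport θ))
      (f := θ) (g := fun n => derivY (U n)) (hcont hK hθ.continuous)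
      (fun n => hcont hK (continuous_derivY (hU n).1))
      (memLp_restrict_of_periodic hp hK hs py my)
      (tendsto_eLpNorm_restrict hp hK hs (fun n => (hU n).2.derivY.sub py) hy)
    have s1 : ∀ f : Horiz d × ℝ → ℝ, Function.support (fun p => f p * derivY θ p) ⊆ tsupport θ :=
      fun f => (Function.support_mul_subset_right _ _).trans (tsupport_derivY_subset θ hθ)
    have s2 : ∀ f : Horiz d × ℝ → ℝ, Function.support (fun p => θ p * f p) ⊆ tsupport θ :=
      fun f => (Function.support_mul_subset_left _ _).trans (subset_tsupport θ)
    simp only [smul_eq_mul] at L1 L2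
    rw [hrestr (s1 _), hrestr (s2 _)]
    refine tendsto_nhds_unique (L1.congr fun n => ?_) L2.neg
    rw [← hrestr (s1 _), ← hrestr (s2 _)]
    exact integral_mul_derivY_eq (hU n).1 hθ hc

end

/-! ### Existence of variational solutions -/

/-- Bounded sequences in a Hilbert space factor have limits in closed subspaces of a product. -/
lemma exists_mem_of_bounded {B Γ : Type*} [NormedAddCommGroup B] [InnerProductSpace ℝ B]
    [CompleteSpace B] [NormedAddCommGroup Γ] [NormedSpace ℝ Γ] {W : Submodule ℝ (B × Γ)}
    (hW : IsClosed (W : Set (B × Γ))) {b : ℕ → B} {γ : ℕ → Γ} {γ' : Γ}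
    (hmem : ∀ n, (b n, γ n) ∈ W) {C : ℝ} (hC : ∀ n, ‖b n‖ ≤ C)
    (hγ : Tendsto γ atTop (𝓝 γ')) : ∃ b', (b', γ') ∈ W := by
  -- By Banach–Alaoglu these functionals lie in a weak-* compact ball, so they converge along an
  -- ultrafilter and no subsequence has to be extracted.
  set u : ℕ → WeakDual ℝ B := fun n =>
    StrongDual.toWeakDual (InnerProductSpace.toDual ℝ B (b n)) with hu
  have hcomp := WeakDual.isCompact_closedBall (𝕜 := ℝ) (E := B) 0 C
  have hle : ((hyperfilter ℕ).map u : Filter (WeakDual ℝ B)) ≤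
      𝓟 (WeakDual.toStrongDual ⁻¹' Metric.closedBall 0 C) := by
    rw [le_principal_iff]
    change ∀ᶠ n in hyperfilter ℕ, u n ∈ WeakDual.toStrongDual ⁻¹' Metric.closedBall 0 C
    refine Eventually.of_forall fun n => ?_
    rw [Set.mem_preimage, mem_closedBall_zero_iff]
    change ‖InnerProductSpace.toDual ℝ B (b n)‖ ≤ C
    rw [LinearIsometryEquiv.norm_map]
    exact hC n
  obtain ⟨x, -, hx⟩ := hcomp.ultrafilter_le_nhds ((hyperfilter ℕ).map u) hle
  set b' := (InnerProductSpace.toDual ℝ B).symm (WeakDual.toStrongDual x) with hb'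
  refine ⟨b', ?_⟩
  by_contra hnot
  -- A functional separating the limit pair from `W` is bounded above on a subspace, so it vanishes
  -- there. Taken along the sequence, weakly convergent in the first factor and strongly in the
  -- second, it must vanish at the limit pair too.
  obtain ⟨f, s, hf, hs⟩ := geometric_hahn_banach_closed_point W.convex hW hnot
  have hf0 : ∀ w ∈ W, f w = 0 := by
    intro w hw
    by_contra hne
    have := hf (((s / f w) : ℝ) • w) (W.smul_mem _ hw)
    rw [map_smul, smul_eq_mul, div_mul_cancel₀ _ hne] at this
    exact lt_irrefl _ this
  have hs0 : 0 < s := by simpa using hf 0 W.zero_mem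
  set c := (InnerProductSpace.toDual ℝ B).symm (f.comp (ContinuousLinearMap.inl ℝ B Γ)) with hc
  have hsplit : ∀ (v : B) (g : Γ), f (v, g) = inner ℝ c v + f (0, g) := by
    intro v g
    rw [hc, InnerProductSpace.toDual_symm_apply]
    simp [← map_add]
  have l1 : Tendsto (fun n => u n c) (hyperfilter ℕ) (𝓝 (x c)) :=
    ((WeakDual.eval_continuous c).tendsto x).comp hx
  have l2 : Tendsto (fun n => -f (0, γ n)) (hyperfilter ℕ) (𝓝 (-f (0, γ'))) := by
    have h1 : Continuous fun g : Γ => -f (0, g) := by fun_prop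
    exact (h1.tendsto γ').comp (hγ.mono_left Nat.hyperfilter_le_atTop)
  have e : ∀ n, u n c = -f (0, γ n) := by
    intro n
    have h1 := hf0 _ (hmem n)
    rw [hsplit] at h1
    have h2 : u n c = inner ℝ (b n) c := rfl
    rw [h2, real_inner_comm]
    linarith
  have h3 : x c = -f (0, γ') := tendsto_nhds_unique (l1.congr e) l2
  have h4 : inner ℝ c b' = x c := by
    rw [real_inner_comm, hb', InnerProductSpace.toDual_symm_apply]; rfl
  rw [hsplit, h4, h3] at hs
  linarith

/-- The space of values of `(∇_x, ∂_y)`. -/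
abbrev GradSpace (d : ℕ) : Type := WithLp 2 (Horiz d × ℝ)

/-- The gradient as one vector field. -/
noncomputable def FunWithGrad.grad {d : ℕ} (u : FunWithGrad d) (p : Horiz d × ℝ) : GradSpace d :=
  WithLp.toLp 2 (u.dx p, u.dy p)

/-- A smooth function with its classical gradient. -/
noncomputable def classical {d : ℕ} (U : Horiz d × ℝ → ℝ) : FunWithGrad d :=
  ⟨U, gradX U, derivY U⟩

/-- The difference of two functions. -/
noncomputable def FunWithGrad.sub {d : ℕ} (u v : FunWithGrad d) : FunWithGrad d :=
  ⟨fun p => u.val p - v.val p, fun p => u.dx p - v.dx p, fun p => u.dy p - v.dy p⟩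

/-! ### The Dirichlet form as an inner product of gradients, and Dirichlet's principle. -/

section

variable {d : ℕ} {h : ℝ} {η : Horiz d → ℝ}

lemma FunWithGrad.memLp_grad {μ : Measure (Horiz d × ℝ)} {u : FunWithGrad d}
    (hx : MemLp u.dx 2 μ) (hy : MemLp u.dy 2 μ) : MemLp u.grad 2 μ :=
  memLp_prodLp_iff.2 ⟨hx, hy⟩

lemma MemH1.memLp_grad {u : FunWithGrad d} (hu : MemH1 h η u) :
    MemLp u.grad 2 (fluidMeasure h η) :=
  FunWithGrad.memLp_grad hu.memLp_dx hu.memLp_dy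

lemma dirichletForm_eq_integral_inner (u v : FunWithGrad d) :
    dirichletForm h η u v = ∫ p, inner ℝ (u.grad p) (v.grad p) ∂(fluidMeasure h η) := by
  refine integral_congr_ae (Eventually.of_forall fun p => ?_)
  simp [FunWithGrad.grad, WithLp.prod_inner_apply, mul_comm]

lemma dirichletForm_eq_inner {u v : FunWithGrad d} (hu : MemH1 h η u) (hv : MemH1 h η v) :
    dirichletForm h η u v = inner ℝ (hu.memLp_grad.toLp u.grad) (hv.memLp_grad.toLp v.grad) := by
  rw [dirichletForm_eq_integral_inner, L2.inner_def]
  refine integral_congr_ae ?_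
  filter_upwards [hu.memLp_grad.coeFn_toLp, hv.memLp_grad.coeFn_toLp] with p h1 h2
  rw [h1, h2]

lemma eLpNorm_tendsto_sub {α F : Type*} [MeasurableSpace α] {μ : Measure α}
    [NormedAddCommGroup F] {f g : ℕ → α → F} {f' g' : α → F}
    (mf : ∀ n, AEStronglyMeasurable (f n) μ) (mg : ∀ n, AEStronglyMeasurable (g n) μ)
    (mf' : AEStronglyMeasurable f' μ) (mg' : AEStronglyMeasurable g' μ)
    (hf : Tendsto (fun n => eLpNorm (fun x => f n x - f' x) 2 μ) atTop (𝓝 0))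
    (hg : Tendsto (fun n => eLpNorm (fun x => g n x - g' x) 2 μ) atTop (𝓝 0)) :
    Tendsto (fun n => eLpNorm (fun x => (f n x - g n x) - (f' x - g' x)) 2 μ) atTop (𝓝 0) := by
  have h1 := hf.add hg
  rw [add_zero] at h1
  refine tendsto_of_tendsto_of_tendsto_of_le_of_le tendsto_const_nhds h1 (fun _ => zero_le) ?_
  intro n
  have : (fun x => (f n x - g n x) - (f' x - g' x)) =
      (fun x => f n x - f' x) - fun x => g n x - g' x := by
    funext x; simp only [Pi.sub_apply]; abel
  beta_reduce
  rw [this]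
  exact eLpNorm_sub_le ((mf n).sub mf') ((mg n).sub mg') (by norm_num)

lemma gradX_sub {U V : Horiz d × ℝ → ℝ} (hU : ContDiff ℝ ∞ U) (hV : ContDiff ℝ ∞ V)
    (p : Horiz d × ℝ) : gradX (fun p => U p - V p) p = gradX U p - gradX V p := by
  rw [gradX_eq (hU.sub hV), gradX_eq hU, gradX_eq hV,
    fderiv_fun_sub (hU.differentiable (by simp) p) (hV.differentiable (by simp) p)]
  simp

lemma derivY_sub {U V : Horiz d × ℝ → ℝ} (hU : ContDiff ℝ ∞ U) (hV : ContDiff ℝ ∞ V)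
    (p : Horiz d × ℝ) : derivY (fun p => U p - V p) p = derivY U p - derivY V p := by
  rw [derivY_eq (hU.sub hV), derivY_eq hU, derivY_eq hV,
    fderiv_fun_sub (hU.differentiable (by simp) p) (hV.differentiable (by simp) p)]
  simp

lemma HasTrace.sub (hη : Continuous η) {u v : FunWithGrad d} {ψ χ : Horiz d → ℝ}
    (hu : MemH1 h η u) (hv : MemH1 h η v) (hψ : MemLp ψ 2 (torusMeasure d))
    (hχ : MemLp χ 2 (torusMeasure d)) (tu : HasTrace h η u ψ) (tv : HasTrace h η v χ) :
    HasTrace h η (u.sub v) (fun x => ψ x - χ x) := by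
  obtain ⟨U, hU, u1, u2, u3, u4⟩ := tu
  obtain ⟨V, hV, v1, v2, v3, v4⟩ := tv
  have ms : ∀ {W : Horiz d × ℝ → ℝ}, ContDiff ℝ ∞ W →
      AEStronglyMeasurable (fun x => W (x, η x)) (torusMeasure d) := fun {W} hW =>
    (hW.continuous.comp (by fun_prop : Continuous fun x => (x, η x))).aestronglyMeasurable
  refine ⟨fun n p => U n p - V n p, fun n => ⟨(hU n).1.sub (hV n).1, (hU n).2.sub (hV n).2⟩,
    ?_, ?_, ?_, ?_⟩
  · exact eLpNorm_tendsto_sub (fun n => (hU n).1.continuous.aestronglyMeasurable)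
      (fun n => (hV n).1.continuous.aestronglyMeasurable) hu.memLp_val.1 hv.memLp_val.1 u1 v1
  · simp only [gradX_sub (hU _).1 (hV _).1]
    exact eLpNorm_tendsto_sub (fun n => (continuous_gradX (hU n).1).aestronglyMeasurable)
      (fun n => (continuous_gradX (hV n).1).aestronglyMeasurable) hu.memLp_dx.1 hv.memLp_dx.1 u2 v2
  · simp only [derivY_sub (hU _).1 (hV _).1]
    exact eLpNorm_tendsto_sub (fun n => (continuous_derivY (hU n).1).aestronglyMeasurable)
      (fun n => (continuous_derivY (hV n).1).aestronglyMeasurable) hu.memLp_dy.1 hv.memLp_dy.1 u3 v3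
  · exact eLpNorm_tendsto_sub (fun n => ms (hU n).1) (fun n => ms (hV n).1) hψ.1 hχ.1 u4 v4

lemma MemH1.sub (hp : IsPeriodic η) {u v : FunWithGrad d} {ψ : Horiz d → ℝ}
    (hu : MemH1 h η u) (hv : MemH1 h η v) (ht : HasTrace h η (u.sub v) ψ) :
    MemH1 h η (u.sub v) :=
  MemH1.of_hasTrace hp (hu.periodic_val.sub hv.periodic_val) (hu.periodic_dx.sub hv.periodic_dx)
    (hu.periodic_dy.sub hv.periodic_dy) (hu.memLp_val.sub hv.memLp_val)
    (hu.memLp_dx.sub hv.memLp_dx) (hu.memLp_dy.sub hv.memLp_dy) ht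

/-- The energy identity: the Dirichlet form against any extension of the data is the energy. -/
lemma IsVariationalSolution.dirichletForm_eq (hη : Continuous η) (hp : IsPeriodic η)
    {ψ : Horiz d → ℝ} (hψ : MemLp ψ 2 (torusMeasure d)) {φ Φ : FunWithGrad d}
    (hφ : IsVariationalSolution h η ψ φ) (hΦ : MemH1 h η Φ) (tΦ : HasTrace h η Φ ψ) :
    dirichletForm h η φ Φ = dirichletForm h η φ φ := by
  have t := HasTrace.sub hη hφ.memH1 hΦ hψ hψ hφ.trace tΦ
  -- The difference of two extensions of `ψ` has zero trace, so it is an admissible test function.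
  simp only [sub_self] at t
  have m := MemH1.sub hp hφ.memH1 hΦ t
  have e := hφ.weak _ m t
  rw [dirichletForm_eq_inner hφ.memH1 m] at e
  have e2 : m.memLp_grad.toLp (φ.sub Φ).grad =
      hφ.memH1.memLp_grad.toLp φ.grad - hΦ.memLp_grad.toLp Φ.grad := by
    rw [← MemLp.toLp_sub]
    rfl
  rw [e2, inner_sub_right, ← dirichletForm_eq_inner hφ.memH1 hφ.memH1,
    ← dirichletForm_eq_inner hφ.memH1 hΦ] at e
  linarith

/-- Dirichlet's principle. -/
lemma IsVariationalSolution.dirichletForm_le (hη : Continuous η) (hp : IsPeriodic η)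
    {ψ : Horiz d → ℝ} (hψ : MemLp ψ 2 (torusMeasure d)) {φ Φ : FunWithGrad d}
    (hφ : IsVariationalSolution h η ψ φ) (hΦ : MemH1 h η Φ) (tΦ : HasTrace h η Φ ψ) :
    dirichletForm h η φ φ ≤ dirichletForm h η Φ Φ := by
  have e := hφ.dirichletForm_eq hη hp hψ hΦ tΦ
  rw [dirichletForm_eq_inner hφ.memH1 hΦ, dirichletForm_eq_inner hφ.memH1 hφ.memH1] at e
  rw [dirichletForm_eq_inner hφ.memH1 hφ.memH1, dirichletForm_eq_inner hΦ hΦ]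
  -- Expanding the squared norm of the difference of gradients: by the energy identity both cross
  -- terms equal the energy of `φ`.
  have h1 := real_inner_self_nonneg
    (x := hφ.memH1.memLp_grad.toLp φ.grad - hΦ.memLp_grad.toLp Φ.grad)
  rw [inner_sub_left, inner_sub_right, inner_sub_right, e, real_inner_comm _ (hΦ.memLp_grad.toLp _),
    e] at h1
  linarith

end

/-! ### The Poincaré inequality, and variational solutions by orthogonal projection. -/

section

variable {d : ℕ} {h : ℝ} {η : Horiz d → ℝ}

/-- The value at height `y` differs from the surface value by the integral of `∂_y U`, which
Cauchy–Schwarz bounds over the fluid column. -/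
lemma sq_le_surface_add {U : Horiz d × ℝ → ℝ} (hU : ContDiff ℝ ∞ U) (x : Horiz d) {y : ℝ}
    (hy : y ∈ Set.Ioo (-h) (η x)) :
    U (x, y) ^ 2 ≤ 2 * U (x, η x) ^ 2 +
      2 * ((η x + h) * ∫ t in Set.Ioo (-h) (η x), derivY U (x, t) ^ 2) := by
  have hc : Continuous fun t => derivY U (x, t) :=
    (continuous_derivY hU).comp (by fun_prop)
  have h1 : ∫ t in Set.Ioo y (η x), derivY U (x, t) = U (x, η x) - U (x, y) := by
    rw [← integral_Ioc_eq_integral_Ioo, ← intervalIntegral.integral_of_le hy.2.le]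
    exact intervalIntegral.integral_eq_sub_of_hasDerivAt (fun t _ => hasDerivAt_derivY hU x t)
      (hc.intervalIntegrable _ _)
  have hi : ∀ {f : ℝ → ℝ}, Continuous f → ∀ a b, IntegrableOn f (Set.Ioo a b) := fun hf a b =>
    (hf.integrableOn_Icc).mono_set Set.Ioo_subset_Icc_self
  have hfin : IsFiniteMeasure (volume.restrict (Set.Ioo y (η x))) := ⟨by simp⟩
  have h2 := sq_integral_le (hi hc y (η x)) (hi (hc.pow 2) y (η x))
  have h3 : (volume.restrict (Set.Ioo y (η x))).real Set.univ = η x - y := by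
    simp [hy.2.le]
  have h4 : ∫ t in Set.Ioo y (η x), derivY U (x, t) ^ 2 ≤
      ∫ t in Set.Ioo (-h) (η x), derivY U (x, t) ^ 2 :=
    setIntegral_mono_set (hi (hc.pow 2) _ _) (Eventually.of_forall fun _ => by positivity)
      (Set.Ioo_subset_Ioo_left hy.1.le).eventuallyLE
  have h5 : 0 ≤ ∫ t in Set.Ioo y (η x), derivY U (x, t) ^ 2 :=
    integral_nonneg fun _ => by positivity
  rw [h1, h3] at h2
  have h6 : (η x - y) * (∫ t in Set.Ioo y (η x), derivY U (x, t) ^ 2) ≤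
      (η x + h) * ∫ t in Set.Ioo (-h) (η x), derivY U (x, t) ^ 2 :=
    mul_le_mul (by linarith [hy.1]) h4 h5 (by linarith [hy.1, hy.2])
  -- With `u₀` the surface value and `u` the value at `y`, this uses `2u₀² + 2(u₀ - u)² - u² = (u -
  -- 2u₀)²`.
  nlinarith [sq_nonneg (U (x, y) - 2 * U (x, η x))]

/-- The Poincaré inequality, for functions smooth up to the boundary. -/
lemma exists_poincare (hη : Continuous η) : ∃ M : ℝ≥0∞, M ≠ ⊤ ∧
    ∀ U : Horiz d × ℝ → ℝ, ContDiff ℝ ∞ U → eLpNorm U 2 (fluidMeasure h η) ^ 2 ≤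
      M * (eLpNorm (fun x => U (x, η x)) 2 (torusMeasure d) ^ 2 +
        eLpNorm (derivY U) 2 (fluidMeasure h η) ^ 2) := by
  obtain ⟨N, hN⟩ := exists_bound_cell hη
  -- This bounds the height of every fluid column. It is kept at least `1` so that the single factor
  -- `2 * m ^ 2` covers both terms.
  set m : ℝ := max (N + h) 1 with hm
  have hm1 : 1 ≤ m := le_max_right _ _
  refine ⟨ENNReal.ofReal (2 * m ^ 2), ENNReal.ofReal_ne_top, fun U hU => ?_⟩
  have hdY := continuous_derivY hU
  simp only [eLpNorm_two_sq]
  rw [lintegral_fluidMeasure hη (by have := hU.continuous; fun_prop),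
    lintegral_fluidMeasure hη (by fun_prop),
    ← lintegral_add_left (f := fun x => ‖U (x, η x)‖ₑ ^ 2) ((hU.continuous.comp
      (by fun_prop : Continuous fun x => (x, η x))).measurable.enorm.pow_const 2),
    ← lintegral_const_mul' _ _ ENNReal.ofReal_ne_top]
  refine lintegral_mono_ae ?_
  filter_upwards [ae_restrict_mem (measurableSet_cell d)] with x hx
  have hlen : η x + h ≤ m := le_trans (by linarith [(abs_le.1 (hN x hx)).2]) (le_max_left _ _)
  have hc : Continuous fun t => derivY U (x, t) := hdY.comp (by fun_prop)
  have hI : ∫⁻ y in Set.Ioo (-h) (η x), ‖derivY U (x, y)‖ₑ ^ 2 =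
      ENNReal.ofReal (∫ t in Set.Ioo (-h) (η x), derivY U (x, t) ^ 2) := by
    rw [ofReal_integral_eq_lintegral_ofReal]
    · refine lintegral_congr fun t => ?_
      rw [← sq_abs, ENNReal.ofReal_pow (abs_nonneg _), ← Real.norm_eq_abs, ofReal_norm]
    · exact ((hc.pow 2).integrableOn_Icc).mono_set Set.Ioo_subset_Icc_self
    · exact Eventually.of_forall fun _ => by positivity
  set I := ∫ t in Set.Ioo (-h) (η x), derivY U (x, t) ^ 2
  have hI0 : 0 ≤ I := integral_nonneg fun _ => by positivity
  have hsq : ∀ r : ℝ, ‖r‖ₑ ^ 2 = ENNReal.ofReal (r ^ 2) := fun r => by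
    rw [← sq_abs, ENNReal.ofReal_pow (abs_nonneg _), ← Real.norm_eq_abs, ofReal_norm]
  rw [hI, hsq]
  calc ∫⁻ y in Set.Ioo (-h) (η x), ‖U (x, y)‖ₑ ^ 2
      ≤ ∫⁻ _ in Set.Ioo (-h) (η x), ENNReal.ofReal (2 * U (x, η x) ^ 2 + 2 * (m * I)) := by
        refine setLIntegral_mono measurable_const fun y hy => ?_
        rw [hsq]
        refine ENNReal.ofReal_le_ofReal ((sq_le_surface_add hU x hy).trans ?_)
        gcongr
    _ ≤ ENNReal.ofReal (2 * m ^ 2) * (ENNReal.ofReal (U (x, η x) ^ 2) + ENNReal.ofReal I) := by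
        rw [setLIntegral_const, Real.volume_Ioo, ← ENNReal.ofReal_add (by positivity) hI0,
          ← ENNReal.ofReal_mul (by positivity), ← ENNReal.ofReal_mul (by positivity)]
        refine ENNReal.ofReal_le_ofReal ?_
        have hU0 : 0 ≤ U (x, η x) ^ 2 := by positivity
        calc (2 * U (x, η x) ^ 2 + 2 * (m * I)) * (η x - -h)
            ≤ (2 * U (x, η x) ^ 2 + 2 * (m * I)) * m := by
              gcongr; linarith
          _ ≤ 2 * m ^ 2 * (U (x, η x) ^ 2 + I) := by nlinarith [mul_nonneg hU0 (sub_nonneg.2 hm1)]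

/-- Gradients and traces of the functions which are smooth up to the boundary. -/
noncomputable def smoothTraces {d : ℕ} (h : ℝ) (η : Horiz d → ℝ) :
    Submodule ℝ (Lp (GradSpace d) 2 (fluidMeasure h η) × Lp ℝ 2 (torusMeasure d)) where
  carrier := {p | ∃ U : Horiz d × ℝ → ℝ, ContDiff ℝ ∞ U ∧ IsPeriodicX U ∧
    p.1 =ᵐ[fluidMeasure h η] (classical U).grad ∧ p.2 =ᵐ[torusMeasure d] fun x => U (x, η x)}
  zero_mem' := by
    refine ⟨fun _ => 0, contDiff_const, fun _ _ _ => rfl, ?_, ?_⟩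
    · filter_upwards [Lp.coeFn_zero (GradSpace d) 2 (fluidMeasure h η)] with p hp
      rw [Prod.fst_zero, hp]
      simp [classical, FunWithGrad.grad, gradX_eq contDiff_const, derivY_eq contDiff_const]
      rfl
    · exact Lp.coeFn_zero ℝ 2 (torusMeasure d)
  add_mem' := by
    rintro ⟨b, γ⟩ ⟨b', γ'⟩ ⟨U, hU, pU, h1, h2⟩ ⟨V, hV, pV, h3, h4⟩
    refine ⟨fun p => U p + V p, hU.add hV, fun y n x => ?_, ?_, ?_⟩
    · have e1 := pU y n x
      have e2 := pV y n x
      simp only at e1 e2 ⊢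
      rw [e1, e2]
    · filter_upwards [h1, h3, Lp.coeFn_add b b'] with p e1 e2 e3
      simp only [Prod.mk_add_mk] at e1 e2 ⊢
      rw [e3, Pi.add_apply, e1, e2]
      simp only [classical, FunWithGrad.grad, gradX_eq (hU.add hV), derivY_eq (hU.add hV),
        gradX_eq hU, gradX_eq hV, derivY_eq hU, derivY_eq hV,
        fderiv_fun_add (hU.differentiable (by simp) p) (hV.differentiable (by simp) p)]
      rw [← WithLp.toLp_add]
      simp
    · filter_upwards [h2, h4, Lp.coeFn_add γ γ'] with p e1 e2 e3
      simp only [Prod.mk_add_mk] at e1 e2 ⊢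
      rw [e3, Pi.add_apply, e1, e2]
  smul_mem' := by
    rintro c ⟨b, γ⟩ ⟨U, hU, pU, h1, h2⟩
    have hcU : ContDiff ℝ ∞ fun p => c • U p := hU.const_smul c
    refine ⟨fun p => c • U p, hcU, fun y n x => ?_, ?_, ?_⟩
    · have e1 := pU y n x
      simp only at e1 ⊢
      rw [e1]
    · filter_upwards [h1, Lp.coeFn_smul c b] with p e1 e3
      simp only [Prod.smul_mk] at e1 ⊢
      rw [e3, Pi.smul_apply, e1]
      simp only [classical, FunWithGrad.grad, gradX_eq hcU, derivY_eq hcU, gradX_eq hU,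
        derivY_eq hU, fderiv_fun_const_smul (hU.differentiable (by simp) p) c]
      rw [← WithLp.toLp_smul]
      simp
    · filter_upwards [h2, Lp.coeFn_smul c γ] with p e1 e3
      simp only [Prod.smul_mk] at e1 ⊢
      rw [e3, Pi.smul_apply, e1]

lemma memLp_classical_grad (hη : Continuous η) {U : Horiz d × ℝ → ℝ} (hU : ContDiff ℝ ∞ U) :
    MemLp (classical U).grad 2 (fluidMeasure h η) :=
  FunWithGrad.memLp_grad (memLp_fluidMeasure_of_continuous hη (continuous_gradX hU))
    (memLp_fluidMeasure_of_continuous hη (continuous_derivY hU))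

lemma memLp_surface (hη : Continuous η) {U : Horiz d × ℝ → ℝ} (hU : ContDiff ℝ ∞ U) :
    MemLp (fun x => U (x, η x)) 2 (torusMeasure d) :=
  memLp_torusMeasure_of_continuous
    (hU.continuous.comp (by fun_prop : Continuous fun x => (x, η x)))

lemma toLp_mem_smoothTraces (hη : Continuous η) {U : Horiz d × ℝ → ℝ} (hU : ContDiff ℝ ∞ U)
    (hp : IsPeriodicX U) :
    ((memLp_classical_grad (h := h) hη hU).toLp _, (memLp_surface hη hU).toLp _) ∈
      smoothTraces h η :=
  ⟨U, hU, hp, MemLp.coeFn_toLp (memLp_classical_grad hη hU),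
    MemLp.coeFn_toLp (memLp_surface hη hU)⟩

lemma eLpNorm_grad_le {μ : Measure (Horiz d × ℝ)} {u : FunWithGrad d}
    (hx : AEStronglyMeasurable u.dx μ) (hy : AEStronglyMeasurable u.dy μ) :
    eLpNorm u.grad 2 μ ≤ eLpNorm u.dx 2 μ + eLpNorm u.dy 2 μ := by
  have h1 : eLpNorm u.grad 2 μ ≤ eLpNorm (fun p => ‖u.dx p‖ + ‖u.dy p‖) 2 μ := by
    refine eLpNorm_mono fun p => ?_
    rw [Real.norm_of_nonneg (by positivity)]
    refine le_of_sq_le_sq ?_ (by positivity)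
    rw [WithLp.prod_norm_sq_eq_of_L2]
    simp only [FunWithGrad.grad, WithLp.toLp_fst, WithLp.toLp_snd]
    nlinarith [norm_nonneg (u.dx p), norm_nonneg (u.dy p)]
  refine h1.trans ((eLpNorm_add_le hx.norm hy.norm (by norm_num)).trans ?_)
  rw [eLpNorm_norm, eLpNorm_norm]

/-- Only gradient and trace are recorded in the closure. The values of the function are dropped here
and recovered from the Poincaré inequality in `exists_memH1_of_mem_closure`. -/
lemma HasTrace.mem_closure (hη : Continuous η) {u : FunWithGrad d} {ψ : Horiz d → ℝ}
    (hu : MemH1 h η u) (hψ : MemLp ψ 2 (torusMeasure d)) (ht : HasTrace h η u ψ) :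
    (hu.memLp_grad.toLp _, hψ.toLp _) ∈ (smoothTraces h η).topologicalClosure := by
  obtain ⟨U, hU, -, hx, hy, hs⟩ := ht
  refine mem_closure_of_tendsto (b := atTop) (f := fun n =>
    ((memLp_classical_grad (h := h) hη (hU n).1).toLp _, (memLp_surface hη (hU n).1).toLp _))
    (Tendsto.prodMk_nhds ?_ ?_) (Eventually.of_forall fun n =>
      toLp_mem_smoothTraces hη (hU n).1 (hU n).2)
  · refine (Lp.tendsto_Lp_iff_tendsto_eLpNorm'' _ _ _ _).2 ?_
    have h1 := hx.add hy
    rw [add_zero] at h1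
    refine tendsto_of_tendsto_of_tendsto_of_le_of_le tendsto_const_nhds h1 (fun _ => zero_le) ?_
    intro n
    exact eLpNorm_grad_le (u := (classical (U n)).sub u)
      ((continuous_gradX (hU n).1).aestronglyMeasurable.sub hu.memLp_dx.1)
      ((continuous_derivY (hU n).1).aestronglyMeasurable.sub hu.memLp_dy.1)
  · exact (Lp.tendsto_Lp_iff_tendsto_eLpNorm'' _ _ _ _).2 hs

/-- The periodic extension of the restriction to a period. -/
noncomputable def periodize {d : ℕ} {α : Type*} (f : Horiz d × ℝ → α) (p : Horiz d × ℝ) : α :=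
  f (ofTorus (toTorus p.1), p.2)

lemma isPeriodicX_periodize {α : Type*} (f : Horiz d × ℝ → α) : IsPeriodicX (periodize f) := by
  intro y n x
  have : toTorus (x + (2 * Real.pi) • latticeVec n) = toTorus x := by
    have h0 : toTorus ((2 * Real.pi) • latticeVec n : Horiz d) = 0 := by
      funext i
      have hp : (2 * Real.pi) ≠ 0 := by positivity
      simp only [toTorus, latticeVec, PiLp.smul_apply, smul_eq_mul, Pi.zero_apply]
      rw [mul_comm, inv_mul_cancel_left₀ hp]
      exact (AddCircle.coe_eq_zero_iff (1 : ℝ)).2 ⟨n i, by simp⟩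
    rw [toTorus_add, h0, add_zero]
  simp only [periodize, this]

lemma periodize_ae_eq (hη : Continuous η) {α : Type*} (f : Horiz d × ℝ → α) :
    periodize f =ᵐ[fluidMeasure h η] f := by
  filter_upwards [ae_fluidMeasure hη] with p hp
  simp only [periodize, ofTorus_toTorus_of_mem hp.1]

/-- Limits of gradients and traces are gradients and traces of functions in `H¹(Ω)`. -/
lemma exists_memH1_of_mem_closure (hη : Continuous η) (hp : IsPeriodic η)
    {b : Lp (GradSpace d) 2 (fluidMeasure h η)} {γ : Lp ℝ 2 (torusMeasure d)}
    (hb : (b, γ) ∈ (smoothTraces h η).topologicalClosure) :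
    ∃ u : FunWithGrad d, MemH1 h η u ∧ u.grad =ᵐ[fluidMeasure h η] b ∧ HasTrace h η u γ := by
  obtain ⟨r, hr, hlim⟩ := mem_closure_iff_seq_limit.1 hb
  choose U hU pU h1 h2 using hr
  have mU : ∀ n, MemLp (U n) 2 (fluidMeasure h η) := fun n =>
    memLp_fluidMeasure_of_continuous hη (hU n).continuous
  obtain ⟨M, hM, hpoin⟩ := exists_poincare (d := d) (h := h) hη
  have hlim1 : Tendsto (fun n => eLpNorm (fun p => (classical (U n)).grad p - b p) 2
      (fluidMeasure h η)) atTop (𝓝 0) := by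
    have := (Lp.tendsto_Lp_iff_tendsto_eLpNorm' _ _).1 ((continuous_fst.tendsto _).comp hlim)
    refine this.congr fun n => eLpNorm_congr_ae ?_
    filter_upwards [h1 n] with p e
    simp only [Function.comp_apply, Pi.sub_apply, e]
  have hlim2 : Tendsto (fun n => eLpNorm (fun x => U n (x, η x) - γ x) 2
      (torusMeasure d)) atTop (𝓝 0) := by
    have := (Lp.tendsto_Lp_iff_tendsto_eLpNorm' _ _).1 ((continuous_snd.tendsto _).comp hlim)
    refine this.congr fun n => eLpNorm_congr_ae ?_
    filter_upwards [h2 n] with p e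
    simp only [Function.comp_apply, Pi.sub_apply, e]
  -- Applied to differences `U n - U m`, the Poincaré inequality turns convergence of gradients and
  -- traces into convergence of the functions.
  have hcau : CauchySeq fun n => (mU n).toLp := by
    have hbd : ∀ n m, dist ((mU n).toLp) ((mU m).toLp) ≤
        √(2 * M.toReal) * dist (r n) (r m) := by
      intro n m
      have k1 := hpoin _ ((hU n).sub (hU m))
      have k2 : eLpNorm (fun x => U n (x, η x) - U m (x, η x)) 2 (torusMeasure d) ≤
          ‖r n - r m‖ₑ := by
        have : eLpNorm (fun x => U n (x, η x) - U m (x, η x)) 2 (torusMeasure d) =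
            ‖(r n).2 - (r m).2‖ₑ := by
          rw [Lp.enorm_def]
          refine eLpNorm_congr_ae ?_
          filter_upwards [h2 n, h2 m, Lp.coeFn_sub (r n).2 (r m).2] with x e1 e2 e3
          rw [e3, Pi.sub_apply, e1, e2]
        rw [this, ← ofReal_norm, ← ofReal_norm]
        exact ENNReal.ofReal_le_ofReal (norm_snd_le (r n - r m))
      have k3 : eLpNorm (derivY fun p => U n p - U m p) 2 (fluidMeasure h η) ≤
          ‖r n - r m‖ₑ := by
        have : eLpNorm (derivY fun p => U n p - U m p) 2 (fluidMeasure h η) ≤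
            ‖(r n).1 - (r m).1‖ₑ := by
          rw [Lp.enorm_def]
          refine eLpNorm_mono_ae ?_
          filter_upwards [h1 n, h1 m, Lp.coeFn_sub (r n).1 (r m).1] with p e1 e2 e3
          rw [e3, Pi.sub_apply, e1, e2]
          refine le_of_eq_of_le ?_ (WithLp.norm_snd_le _ _)
          simp only [derivY_eq ((hU n).sub (hU m)), derivY_eq (hU n), derivY_eq (hU m),
            fderiv_fun_sub ((hU n).differentiable (by simp) p)
              ((hU m).differentiable (by simp) p), classical, FunWithGrad.grad]
          rfl
        refine this.trans ?_
        rw [← ofReal_norm, ← ofReal_norm]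
        exact ENNReal.ofReal_le_ofReal (norm_fst_le (r n - r m))
      have k4 : eLpNorm (fun p => U n p - U m p) 2 (fluidMeasure h η) ^ 2 ≤
          2 * M * ‖r n - r m‖ₑ ^ 2 := by
        refine k1.trans ?_
        rw [mul_comm 2 M, mul_assoc, two_mul]
        gcongr
      have k5 : ‖(mU n).toLp - (mU m).toLp‖ₑ =
          eLpNorm (fun p => U n p - U m p) 2 (fluidMeasure h η) := by
        rw [← MemLp.toLp_sub, Lp.enorm_toLp]
        rfl
      rw [dist_eq_norm, dist_eq_norm]
      refine le_of_sq_le_sq ?_ (by positivity)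
      rw [mul_pow, Real.sq_sqrt (by positivity)]
      rw [← k5] at k4
      have k6 := ENNReal.toReal_mono (by finiteness) k4
      simpa using k6
    refine Metric.cauchySeq_iff.2 fun ε hε => ?_
    obtain ⟨N, hN⟩ := Metric.cauchySeq_iff.1 hlim.cauchySeq (ε / (√(2 * M.toReal) + 1))
      (by positivity)
    refine ⟨N, fun m hm n hn => (hbd m n).trans_lt ?_⟩
    have k7 := (lt_div_iff₀ (by positivity)).1 (hN m hm n hn)
    nlinarith [dist_nonneg (x := r m) (y := r n)]
  obtain ⟨a, ha⟩ := cauchySeq_tendsto_of_complete hcau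
  have hlim0 : Tendsto (fun n => eLpNorm (fun p => U n p - a p) 2 (fluidMeasure h η)) atTop
      (𝓝 0) := by
    have := (Lp.tendsto_Lp_iff_tendsto_eLpNorm' _ _).1 ha
    refine this.congr fun n => eLpNorm_congr_ae ?_
    filter_upwards [(mU n).coeFn_toLp] with p e
    simp only [Pi.sub_apply, e]
  -- An `L²` limit is determined only almost everywhere on one period, whereas `MemH1` asks for
  -- periodicity at every point; hence the periodic extensions.
  set u : FunWithGrad d := ⟨periodize a, periodize fun p => (b p).fst, periodize fun p => (b p).snd⟩
    with hu
  have mb := memLp_prodLp_iff.1 (Lp.memLp b)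
  have ev := periodize_ae_eq (h := h) hη a
  have ex := periodize_ae_eq (h := h) hη fun p => (b p).fst
  have ey := periodize_ae_eq (h := h) hη fun p => (b p).snd
  have ht : HasTrace h η u γ := by
    refine ⟨U, fun n => ⟨hU n, pU n⟩, ?_, ?_, ?_, hlim2⟩
    · refine hlim0.congr fun n => eLpNorm_congr_ae ?_
      filter_upwards [ev] with p e
      simp only [hu, e]
    · refine tendsto_of_tendsto_of_tendsto_of_le_of_le tendsto_const_nhds hlim1
        (fun _ => zero_le) fun n => eLpNorm_mono_ae ?_
      filter_upwards [ex] with p e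
      simp only [hu, e]
      exact WithLp.norm_fst_le _ ((classical (U n)).grad p - b p)
    · refine tendsto_of_tendsto_of_tendsto_of_le_of_le tendsto_const_nhds hlim1
        (fun _ => zero_le) fun n => eLpNorm_mono_ae ?_
      filter_upwards [ey] with p e
      simp only [hu, e]
      exact WithLp.norm_snd_le _ ((classical (U n)).grad p - b p)
  refine ⟨u, MemH1.of_hasTrace hp (isPeriodicX_periodize (a : Horiz d × ℝ → ℝ))
    (isPeriodicX_periodize fun p => (b p).fst) (isPeriodicX_periodize fun p => (b p).snd)
    ((memLp_congr_ae ev).2 (Lp.memLp a)) ((memLp_congr_ae ex).2 mb.1)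
    ((memLp_congr_ae ey).2 mb.2) ht, ?_, ht⟩
  filter_upwards [ex, ey] with p e1 e2
  simp only [hu, FunWithGrad.grad, e1, e2]
  rfl

lemma HasTrace.congr {u : FunWithGrad d} {ψ χ : Horiz d → ℝ} (ht : HasTrace h η u ψ)
    (he : ψ =ᵐ[torusMeasure d] χ) : HasTrace h η u χ := by
  obtain ⟨U, hU, hv, hx, hy, hs⟩ := ht
  refine ⟨U, hU, hv, hx, hy, hs.congr fun n => eLpNorm_congr_ae ?_⟩
  filter_upwards [he] with x e
  rw [e]

/-- Data which are limits of smooth functions of bounded energy have variational solutions. -/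
theorem exists_isVariationalSolution (hη : Continuous η) (hp : IsPeriodic η)
    {ψ : Horiz d → ℝ} (hψ : MemLp ψ 2 (torusMeasure d)) {U : ℕ → Horiz d × ℝ → ℝ}
    (hU : ∀ n, ContDiff ℝ ∞ (U n)) (pU : ∀ n, IsPeriodicX (U n)) {C : ℝ≥0∞} (hC : C ≠ ⊤)
    (hE : ∀ n, eLpNorm (classical (U n)).grad 2 (fluidMeasure h η) ≤ C)
    (ht : Tendsto (fun n => eLpNorm (fun x => U n (x, η x) - ψ x) 2 (torusMeasure d))
      atTop (𝓝 0)) : ∃ φ, IsVariationalSolution h η ψ φ := by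
  set W := (smoothTraces h η).topologicalClosure with hW
  have hWc : IsClosed (W : Set (Lp (GradSpace d) 2 (fluidMeasure h η) ×
    Lp ℝ 2 (torusMeasure d))) := Submodule.isClosed_topologicalClosure _
  -- The energies are bounded but the gradients need not converge in norm. A weak limit suffices
  -- because `W` is a closed subspace.
  obtain ⟨b₀, hb₀⟩ : ∃ b₀, (b₀, hψ.toLp ψ) ∈ W := by
    refine exists_mem_of_bounded hWc
      (b := fun n => (memLp_classical_grad (h := h) hη (hU n)).toLp _)
      (γ := fun n => (memLp_surface hη (hU n)).toLp _) (C := C.toReal)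
      (fun n => Submodule.le_topologicalClosure _ (toLp_mem_smoothTraces hη (hU n) (pU n)))
      (fun n => ?_) ?_
    · rw [Lp.norm_toLp]
      exact ENNReal.toReal_mono hC (hE n)
    · exact (Lp.tendsto_Lp_iff_tendsto_eLpNorm'' _ _ _ _).2 ht
  -- These are the limit gradients with zero trace. Subtracting from `b₀` its projection on `N`
  -- keeps the trace and makes the gradient orthogonal to those of all test functions, which is the
  -- weak equation.
  set N : Submodule ℝ (Lp (GradSpace d) 2 (fluidMeasure h η)) :=
    W.comap (LinearMap.inl ℝ _ _) with hN
  have hNc : IsClosed (N : Set (Lp (GradSpace d) 2 (fluidMeasure h η))) :=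
    hWc.preimage (by fun_prop : Continuous fun b : Lp (GradSpace d) 2 (fluidMeasure h η) =>
      (b, (0 : Lp ℝ 2 (torusMeasure d))))
  have : CompleteSpace N := hNc.completeSpace_coe
  have hmem : (b₀ - N.starProjection b₀, hψ.toLp ψ) ∈ W := by
    have h1 : (N.starProjection b₀, (0 : Lp ℝ 2 (torusMeasure d))) ∈ W :=
      N.starProjection_apply_mem b₀
    have h2 := W.sub_mem hb₀ h1
    simpa using h2
  obtain ⟨φ, mφ, eφ, tφ⟩ := exists_memH1_of_mem_closure hη hp hmem
  refine ⟨φ, mφ, tφ.congr hψ.coeFn_toLp, fun θ mθ tθ => ?_⟩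
  have h0 : MemLp (fun _ : Horiz d => (0 : ℝ)) 2 (torusMeasure d) := MemLp.zero
  have h1 : mθ.memLp_grad.toLp θ.grad ∈ N := by
    have h2 := tθ.mem_closure hη mθ h0
    have h3 : h0.toLp _ = 0 := MemLp.toLp_zero h0
    rw [h3] at h2
    exact h2
  rw [dirichletForm_eq_inner mφ mθ]
  have h4 : mφ.memLp_grad.toLp φ.grad = b₀ - N.starProjection b₀ := by
    refine Lp.ext ?_
    filter_upwards [mφ.memLp_grad.coeFn_toLp, eφ] with p e1 e2
    rw [e1, e2]
  rw [h4]
  exact (N.mem_orthogonal' _).1 (N.sub_starProjection_mem_orthogonal b₀) _ h1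

end

/-! ### Extension of `Ḣ^{1/2}` data with bounded energy. -/

section

variable {d : ℕ}

/-- A Lipschitz function on the torus is uniformly approximated from above by smooth functions
with the same Lipschitz constant. -/
lemma exists_smooth_approx {η : Horiz d → ℝ} {K : NNReal} (hL : LipschitzWith K η)
    (hp : IsPeriodic η) {ε : ℝ} (hε : 0 < ε) :
    ∃ ζ : Horiz d → ℝ, ContDiff ℝ ∞ ζ ∧ IsPeriodic ζ ∧ LipschitzWith K ζ ∧
      ∀ x, η x ≤ ζ x ∧ ζ x ≤ η x + 2 * ε := by
  -- On a ball of this radius `η` varies by at most `ε`; adding `1` covers `K = 0`.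
  have hr : 0 < ε / (K + 1) := by positivity
  let φ : ContDiffBump (0 : Horiz d) := ⟨ε / (K + 1) / 2, ε / (K + 1), by positivity, by linarith⟩
  set g : Horiz d → ℝ :=
    convolution (φ.normed volume) η (ContinuousLinearMap.lsmul ℝ ℝ) volume with hg
  have hgx : ∀ x, g x = ∫ t, φ.normed volume t * η (x - t) := fun x => rfl
  have hint : ∀ x, Integrable fun t => φ.normed volume t * η (x - t) := fun x =>
    (φ.continuous_normed.mul (hL.continuous.comp (by fun_prop))).integrable_of_hasCompactSupport
      φ.hasCompactSupport_normed.mul_right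
  have hdist : ∀ x, dist (g x) (η x) ≤ ε := by
    intro x
    refine φ.dist_normed_convolution_le hL.continuous.aestronglyMeasurable fun z hz => ?_
    refine (hL.dist_le_mul z x).trans ?_
    have h1 : dist z x ≤ ε / (K + 1) := (Metric.mem_ball.1 hz).le
    have h2 := (le_div_iff₀ (by positivity)).1 h1
    nlinarith [dist_nonneg (x := z) (y := x)]
  -- The mollification is within `ε` of `η`. Raising it by `ε` puts it above `η` without changing
  -- its Lipschitz constant.
  refine ⟨fun x => g x + ε, ?_, ?_, ?_, ?_⟩
  · exact (φ.hasCompactSupport_normed.contDiff_convolution_left _ φ.contDiff_normed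
      hL.continuous.locallyIntegrable).add contDiff_const
  · intro n x
    simp only [hgx]
    congr 2
    funext t
    rw [add_sub_right_comm, hp]
  · refine LipschitzWith.of_dist_le_mul fun x y => ?_
    rw [dist_add_right, dist_eq_norm, hgx, hgx, ← integral_sub (hint x) (hint y)]
    have h1 : ∀ t, ‖φ.normed volume t * η (x - t) - φ.normed volume t * η (y - t)‖ ≤
        φ.normed volume t * (K * dist x y) := by
      intro t
      rw [← mul_sub, norm_mul, Real.norm_of_nonneg (φ.nonneg_normed t), ← dist_eq_norm]
      refine mul_le_mul_of_nonneg_left ?_ (φ.nonneg_normed t)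
      simpa using hL.dist_le_mul (x - t) (y - t)
    refine (norm_integral_le_of_norm_le (φ.integrable_normed.mul_const _)
      (Eventually.of_forall h1)).trans ?_
    rw [integral_mul_const, φ.integral_normed, one_mul]
  · intro x
    have := abs_le.1 (hdist x)
    constructor <;> linarith [this.1, this.2]

/-- The trigonometric sum `∑ c_ξ e^{ix·ξ} e^{|ξ|(y-ζ(x))}`. -/
noncomputable def extSum (F : Finset (Fin d → ℤ)) (c : (Fin d → ℤ) → ℂ) (ζ : Horiz d → ℝ)
    (p : Horiz d × ℝ) : ℂ :=
  ∑ ξ ∈ F, c ξ * wave ξ p.1 * (Real.exp (‖(latticeVec ξ : Horiz d)‖ * (p.2 - ζ p.1)) : ℂ)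

lemma continuous_extSum (F : Finset (Fin d → ℤ)) (c : (Fin d → ℤ) → ℂ) {ζ : Horiz d → ℝ}
    (hζ : Continuous ζ) : Continuous (extSum F c ζ) := by
  refine continuous_finsetSum _ fun ξ _ => (continuous_const.mul
    ((continuous_wave ξ).comp continuous_fst)).mul ?_
  fun_prop

lemma contDiff_extSum (F : Finset (Fin d → ℤ)) (c : (Fin d → ℤ) → ℂ) {ζ : Horiz d → ℝ}
    (hζ : ContDiff ℝ ∞ ζ) : ContDiff ℝ ∞ (extSum F c ζ) := by
  refine ContDiff.sum fun ξ _ => (contDiff_const.mul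
    ((contDiff_wave ξ).comp contDiff_fst)).mul ?_
  exact Complex.ofRealCLM.contDiff.comp (Real.contDiff_exp.comp (contDiff_const.mul
    (contDiff_snd.sub (hζ.comp contDiff_fst))))

lemma isPeriodicX_extSum (F : Finset (Fin d → ℤ)) (c : (Fin d → ℤ) → ℂ) {ζ : Horiz d → ℝ}
    (hζ : IsPeriodic ζ) : IsPeriodicX (extSum F c ζ) := by
  intro y n x
  simp only [extSum, isPeriodic_wave _ n x, hζ n x]

lemma lintegral_exp_mul_Iio {a : ℝ} (ha : 0 < a) :
    ∫⁻ z in Set.Iio (0 : ℝ), ENNReal.ofReal (Real.exp (a * z)) = ENNReal.ofReal a⁻¹ := by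
  rw [← ofReal_integral_eq_lintegral_ofReal]
  · rw [← integral_Iic_eq_integral_Iio, integral_exp_mul_Iic ha]
    simp
  · exact (integrableOn_exp_mul_Iic ha 0).mono_set Set.Iio_subset_Iic_self
  · exact Eventually.of_forall fun _ => (Real.exp_pos _).le

lemma lintegral_enorm_sq_trigPoly (F : Finset (Fin d → ℤ)) (a : (Fin d → ℤ) → ℂ) :
    ∫⁻ x, ‖∑ ξ ∈ F, a ξ * wave ξ x‖ₑ ^ 2 ∂(torusMeasure d) =
      ENNReal.ofReal ((2 * Real.pi) ^ d * ∑ ξ ∈ F, ‖a ξ‖ ^ 2) := by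
  have hc : Continuous fun x : Horiz d => ∑ ξ ∈ F, a ξ * wave ξ x :=
    continuous_finsetSum _ fun ξ _ => continuous_const.mul (continuous_wave ξ)
  rw [← integral_norm_sq_trigPoly, ofReal_integral_eq_lintegral_ofReal]
  · refine lintegral_congr fun x => ?_
    rw [ENNReal.ofReal_pow (norm_nonneg _), ofReal_norm]
  · exact (memLp_two_iff_integrable_sq_norm hc.aestronglyMeasurable).1
      (memLp_torusMeasure_of_continuous hc)
  · exact Eventually.of_forall fun _ => by positivity

/-- The symbol `m` stands for a derivative of order one. In the variable `z = y - ζ(x)` the fluid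
lies in `z < 0`, because `η ≤ ζ`. Parseval at each `z` and the integral `1/(2|ξ|)` of `e^{2|ξ|z}`
leave `|m|²/(2|ξ|) ≤ |ξ|`. -/
lemma eLpNorm_extSum_le (F : Finset (Fin d → ℤ)) (c m : (Fin d → ℤ) → ℂ) (h : ℝ)
    {η ζ : Horiz d → ℝ} (hη : Continuous η) (hζ : Continuous ζ) (hle : ∀ x, η x ≤ ζ x)
    (hm : ∀ ξ, ‖m ξ‖ ≤ ‖(latticeVec ξ : Horiz d)‖) :
    eLpNorm (extSum F (fun ξ => c ξ * m ξ) ζ) 2 (fluidMeasure h η) ^ 2 ≤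
      ENNReal.ofReal ((2 * Real.pi) ^ d *
        ∑ ξ ∈ F, ‖(latticeVec ξ : Horiz d)‖ * ‖c ξ‖ ^ 2) := by
  set T : Horiz d × ℝ → ℂ := extSum F (fun ξ => c ξ * m ξ) (fun _ => 0) with hT
  have hTc : Continuous T := continuous_extSum F _ continuous_const
  have hc := continuous_extSum F (fun ξ => c ξ * m ξ) hζ
  rw [eLpNorm_two_sq, lintegral_fluidMeasure hη (by fun_prop)]
  have h1 : ∀ x, ∫⁻ y in Set.Ioo (-h) (η x), ‖extSum F (fun ξ => c ξ * m ξ) ζ (x, y)‖ₑ ^ 2 ≤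
      ∫⁻ z in Set.Iio (0 : ℝ), ‖T (x, z)‖ₑ ^ 2 := by
    intro x
    calc ∫⁻ y in Set.Ioo (-h) (η x), ‖extSum F (fun ξ => c ξ * m ξ) ζ (x, y)‖ₑ ^ 2
        ≤ ∫⁻ y in Set.Iio (ζ x), ‖T (x, y - ζ x)‖ₑ ^ 2 := by
          refine (lintegral_mono_set (t := Set.Iio (ζ x))
            fun y hy => hy.2.trans_le (hle x)).trans_eq ?_
          simp only [hT, extSum, sub_zero]
      _ = ∫⁻ z in Set.Iio (0 : ℝ), ‖T (x, z)‖ₑ ^ 2 := by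
          rw [← lintegral_indicator measurableSet_Iio, ← lintegral_indicator measurableSet_Iio,
            
            ← lintegral_sub_right_eq_self ((Set.Iio (0 : ℝ)).indicator _) (ζ x)]
          refine lintegral_congr fun y => ?_
          simp only [Set.indicator, Set.mem_Iio, sub_neg]
  refine (lintegral_mono h1).trans ?_
  rw [lintegral_lintegral_swap (hTc.measurable.enorm.pow_const 2).aemeasurable]
  have h2 : ∀ z, ∫⁻ x, ‖T (x, z)‖ₑ ^ 2 ∂(torusMeasure d) = ENNReal.ofReal ((2 * Real.pi) ^ d) *
      ∑ ξ ∈ F, ENNReal.ofReal (‖c ξ * m ξ‖ ^ 2) *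
        ENNReal.ofReal (Real.exp (2 * ‖(latticeVec ξ : Horiz d)‖ * z)) := by
    intro z
    have h3 := lintegral_enorm_sq_trigPoly F fun ξ =>
      c ξ * m ξ * (Real.exp (‖(latticeVec ξ : Horiz d)‖ * z) : ℂ)
    have h4 : ∀ x, T (x, z) = ∑ ξ ∈ F, c ξ * m ξ *
        (Real.exp (‖(latticeVec ξ : Horiz d)‖ * z) : ℂ) * wave ξ x := fun x => by
      simp only [hT, extSum, sub_zero]
      exact Finset.sum_congr rfl fun ξ _ => by ring
    simp only [h4, h3]
    rw [ENNReal.ofReal_mul (by positivity), ENNReal.ofReal_sum_of_nonneg fun _ _ => by positivity]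
    congr 1
    refine Finset.sum_congr rfl fun ξ _ => ?_
    rw [← ENNReal.ofReal_mul (by positivity), norm_mul _ (Complex.ofReal _), mul_pow,
      Complex.norm_real, Real.norm_of_nonneg (Real.exp_pos _).le, ← Real.exp_nat_mul]
    congr 3
    push_cast
    ring
  simp only [h2]
  rw [lintegral_const_mul' _ _ ENNReal.ofReal_ne_top, lintegral_finsetSum _ (by fun_prop),
    ENNReal.ofReal_mul (by positivity), ENNReal.ofReal_sum_of_nonneg fun _ _ => by positivity]
  gcongr with ξ _
  rw [lintegral_const_mul' _ _ ENNReal.ofReal_ne_top]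
  -- At frequency zero there is no decay in `z`, but the symbol vanishes.
  rcases (norm_nonneg (latticeVec ξ : Horiz d)).eq_or_lt with h0 | h0
  · have : m ξ = 0 := norm_le_zero_iff.1 (h0 ▸ hm ξ)
    simp [this]
  · rw [lintegral_exp_mul_Iio (by positivity), ← ENNReal.ofReal_mul (by positivity)]
    refine ENNReal.ofReal_le_ofReal ?_
    rw [← div_eq_mul_inv, div_le_iff₀ (by positivity), norm_mul, mul_pow]
    have h5 : ‖m ξ‖ ^ 2 ≤ ‖(latticeVec ξ : Horiz d)‖ ^ 2 := by gcongr; exact hm ξ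
    nlinarith [mul_le_mul_of_nonneg_left h5 (sq_nonneg ‖c ξ‖),
      mul_nonneg (sq_nonneg ‖c ξ‖) (sq_nonneg ‖(latticeVec ξ : Horiz d)‖)]

lemma hasDerivAt_wave_line (ξ : Fin d → ℤ) (x v : Horiz d) :
    HasDerivAt (fun t : ℝ => wave ξ (x + t • v))
      (wave ξ x * (Complex.I * ((inner ℝ v (latticeVec ξ) : ℝ) : ℂ))) 0 := by
  have h1 : HasDerivAt (fun t : ℝ => inner ℝ x (latticeVec ξ : Horiz d) +
      t * inner ℝ v (latticeVec ξ : Horiz d)) (inner ℝ v (latticeVec ξ : Horiz d)) 0 := by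
    simpa using ((hasDerivAt_id (0 : ℝ)).mul_const
      (inner ℝ v (latticeVec ξ : Horiz d))).const_add (inner ℝ x (latticeVec ξ : Horiz d))
  have h2 := ((h1.ofReal_comp).const_mul Complex.I).cexp
  simpa [wave, inner_add_left, inner_smul_left] using h2

lemma hasDerivAt_extSum_y (F : Finset (Fin d → ℤ)) (c : (Fin d → ℤ) → ℂ) (ζ : Horiz d → ℝ)
    (x : Horiz d) (y : ℝ) : HasDerivAt (fun y => extSum F c ζ (x, y))
      (extSum F (fun ξ => c ξ * (‖(latticeVec ξ : Horiz d)‖ : ℂ)) ζ (x, y)) y := by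
  simp only [extSum]
  refine HasDerivAt.fun_sum fun ξ _ => ?_
  have h1 : HasDerivAt (fun y => Real.exp (‖(latticeVec ξ : Horiz d)‖ * (y - ζ x)))
      (Real.exp (‖(latticeVec ξ : Horiz d)‖ * (y - ζ x)) * ‖(latticeVec ξ : Horiz d)‖) y := by
    simpa using (((hasDerivAt_id y).sub_const (ζ x)).const_mul
      ‖(latticeVec ξ : Horiz d)‖).exp
  refine ((h1.ofReal_comp).const_mul (c ξ * wave ξ x)).congr_deriv ?_
  push_cast
  ring

/-- A horizontal derivative acts on the character and, through `ζ`, on the exponential. The second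
contribution is the vertical derivative times minus the slope of `ζ`. -/
lemma hasDerivAt_extSum_x (F : Finset (Fin d → ℤ)) (c : (Fin d → ℤ) → ℂ) {ζ : Horiz d → ℝ}
    (hζ : ContDiff ℝ ∞ ζ) (x v : Horiz d) (y : ℝ) :
    HasDerivAt (fun t : ℝ => extSum F c ζ (x + t • v, y))
      (extSum F (fun ξ => c ξ * (Complex.I * ((inner ℝ v (latticeVec ξ) : ℝ) : ℂ))) ζ (x, y) -
        (fderiv ℝ ζ x v : ℂ) *
          extSum F (fun ξ => c ξ * (‖(latticeVec ξ : Horiz d)‖ : ℂ)) ζ (x, y)) 0 := by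
  simp only [extSum, Finset.mul_sum, ← Finset.sum_sub_distrib]
  refine HasDerivAt.fun_sum fun ξ _ => ?_
  have h0 : HasDerivAt (fun t : ℝ => ζ (x + t • v)) (fderiv ℝ ζ x v) 0 :=
    ((hζ.differentiable (by simp) x).hasFDerivAt.hasLineDerivAt v)
  have h1 : HasDerivAt (fun t : ℝ => Real.exp (‖(latticeVec ξ : Horiz d)‖ * (y - ζ (x + t • v))))
      (Real.exp (‖(latticeVec ξ : Horiz d)‖ * (y - ζ x)) *
        (‖(latticeVec ξ : Horiz d)‖ * -fderiv ℝ ζ x v)) 0 := by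
    simpa using ((h0.const_sub y).const_mul ‖(latticeVec ξ : Horiz d)‖).exp
  refine (((hasDerivAt_wave_line ξ x v).const_mul (c ξ)).mul h1.ofReal_comp).congr_deriv ?_
  simp only [zero_smul, add_zero]
  push_cast
  ring

lemma hasDerivAt_re {f : ℝ → ℂ} {f' : ℂ} {t : ℝ} (hf : HasDerivAt f f' t) :
    HasDerivAt (fun t => (f t).re) f'.re t :=
  Complex.reCLM.hasFDerivAt.comp_hasDerivAt t hf

lemma norm_le_sum_abs_inner (v : Horiz d) :
    ‖v‖ ≤ ∑ j, |inner ℝ v (EuclideanSpace.single j 1)| := by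
  conv_lhs => rw [← (EuclideanSpace.basisFun (Fin d) ℝ).sum_repr v]
  refine (norm_sum_le _ _).trans (Finset.sum_le_sum fun j _ => ?_)
  rw [norm_smul]
  simp [EuclideanSpace.inner_single_right]

/-- Each component of the gradient is controlled by two sums with symbols `iξ_j` and `|ξ|`, both
bounded by `|ξ|`, so `eLpNorm_extSum_le` applies to each. -/
lemma norm_gradX_re_extSum_le (F : Finset (Fin d → ℤ)) (c : (Fin d → ℤ) → ℂ) {ζ : Horiz d → ℝ}
    {K : NNReal} (hζ : ContDiff ℝ ∞ ζ) (hK : LipschitzWith K ζ) (p : Horiz d × ℝ) :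
    ‖gradX (fun p => (extSum F c ζ p).re) p‖ ≤ ∑ j : Fin d,
      (‖extSum F (fun ξ => c ξ * (Complex.I * ((ξ j : ℝ) : ℂ))) ζ p‖ +
        K * ‖extSum F (fun ξ => c ξ * (‖(latticeVec ξ : Horiz d)‖ : ℂ)) ζ p‖) := by
  have hU : ContDiff ℝ ∞ fun p => (extSum F c ζ p).re :=
    Complex.reCLM.contDiff.comp (contDiff_extSum F c hζ)
  refine (norm_le_sum_abs_inner _).trans (Finset.sum_le_sum fun j _ => ?_)
  set v : Horiz d := EuclideanSpace.single j 1 with hv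
  have hvξ : ∀ ξ : Fin d → ℤ, inner ℝ v (latticeVec ξ) = (ξ j : ℝ) := fun ξ => by
    simp [hv, EuclideanSpace.inner_single_left, latticeVec]
  have h1 := hasDerivAt_re (hasDerivAt_extSum_x F c hζ p.1 v p.2)
  have h2 : HasDerivAt (fun t : ℝ => (extSum F c ζ (p.1 + t • v, p.2)).re)
      (inner ℝ (gradX (fun p => (extSum F c ζ p).re) p) v) 0 := by
    have h3 := (hasFDerivAt_section hU p).hasLineDerivAt v
    refine HasDerivAt.congr_deriv h3 ?_
    rw [gradX_eq hU, InnerProductSpace.toDual_symm_apply]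
  rw [h2.unique h1]
  simp only [hvξ]
  refine (Complex.abs_re_le_norm _).trans ((norm_sub_le _ _).trans ?_)
  gcongr
  rw [norm_mul, Complex.norm_real]
  gcongr
  refine (ContinuousLinearMap.le_opNorm _ _).trans ?_
  have : ‖v‖ = 1 := by simp [hv]
  rw [this, mul_one]
  exact norm_fderiv_le_of_lipschitz ℝ hK

lemma abs_derivY_re_extSum_le (F : Finset (Fin d → ℤ)) (c : (Fin d → ℤ) → ℂ) (ζ : Horiz d → ℝ)
    (p : Horiz d × ℝ) : ‖derivY (fun p => (extSum F c ζ p).re) p‖ ≤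
      ‖extSum F (fun ξ => c ξ * (‖(latticeVec ξ : Horiz d)‖ : ℂ)) ζ p‖ := by
  rw [derivY, (hasDerivAt_re (hasDerivAt_extSum_y F c ζ p.1 p.2)).deriv]
  exact Complex.abs_re_le_norm _

lemma abs_coord_le_norm_latticeVec (ξ : Fin d → ℤ) (j : Fin d) :
    |(ξ j : ℝ)| ≤ ‖(latticeVec ξ : Horiz d)‖ := by
  simpa [latticeVec] using PiLp.norm_apply_le (latticeVec ξ : Horiz d) j

/-- The energy of the harmonic extension of a trigonometric sum, flattened along a surface. -/
lemma eLpNorm_grad_extSum_le (F : Finset (Fin d → ℤ)) (c : (Fin d → ℤ) → ℂ) (h : ℝ)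
    {η ζ : Horiz d → ℝ} {K : NNReal} (hη : Continuous η) (hζ : ContDiff ℝ ∞ ζ)
    (hK : LipschitzWith K ζ) (hle : ∀ x, η x ≤ ζ x) :
    eLpNorm (classical fun p => (extSum F c ζ p).re).grad 2 (fluidMeasure h η) ≤
      (d * (1 + K) + 1) * ENNReal.ofReal
        √((2 * Real.pi) ^ d * ∑ ξ ∈ F, ‖(latticeVec ξ : Horiz d)‖ * ‖c ξ‖ ^ 2) := by
  set B := ENNReal.ofReal
    √((2 * Real.pi) ^ d * ∑ ξ ∈ F, ‖(latticeVec ξ : Horiz d)‖ * ‖c ξ‖ ^ 2) with hB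
  have hU : ContDiff ℝ ∞ fun p => (extSum F c ζ p).re :=
    Complex.reCLM.contDiff.comp (contDiff_extSum F c hζ)
  have key : ∀ m : (Fin d → ℤ) → ℂ, (∀ ξ, ‖m ξ‖ ≤ ‖(latticeVec ξ : Horiz d)‖) →
      eLpNorm (extSum F (fun ξ => c ξ * m ξ) ζ) 2 (fluidMeasure h η) ≤ B := by
    intro m hm
    have h1 := eLpNorm_extSum_le F c m h hη hζ.continuous hle hm
    have h2 : B ^ 2 = ENNReal.ofReal ((2 * Real.pi) ^ d *
        ∑ ξ ∈ F, ‖(latticeVec ξ : Horiz d)‖ * ‖c ξ‖ ^ 2) := by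
      rw [hB, ← ENNReal.ofReal_pow (by positivity), Real.sq_sqrt (by positivity)]
    rw [← h2] at h1
    exact (ENNReal.pow_le_pow_left_iff two_ne_zero).1 h1
  have hcont := fun c' => (continuous_extSum F c' hζ.continuous).aestronglyMeasurable
    (μ := fluidMeasure h η)
  set S := extSum F (fun ξ => c ξ * (‖(latticeVec ξ : Horiz d)‖ : ℂ)) ζ with hS
  have hSB : eLpNorm S 2 (fluidMeasure h η) ≤ B := key _ fun ξ => by simp
  refine (eLpNorm_grad_le (continuous_gradX hU).aestronglyMeasurable
    (continuous_derivY hU).aestronglyMeasurable).trans ?_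
  rw [add_mul, one_mul]
  refine add_le_add ?_ ((eLpNorm_mono fun p => abs_derivY_re_extSum_le F c ζ p).trans hSB)
  have h3 : eLpNorm (gradX fun p => (extSum F c ζ p).re) 2 (fluidMeasure h η) ≤
      eLpNorm (∑ j : Fin d, fun p =>
        (‖extSum F (fun ξ => c ξ * (Complex.I * ((ξ j : ℝ) : ℂ))) ζ p‖ + K * ‖S p‖)) 2
        (fluidMeasure h η) := by
    refine eLpNorm_mono_real fun p => ?_
    rw [Finset.sum_apply]
    exact norm_gradX_re_extSum_le F c hζ hK p
  refine h3.trans ((eLpNorm_sum_le (fun j _ => ?_) (by norm_num)).trans ?_)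
  · exact (hcont _).norm.add ((hcont _).norm.const_mul _)
  have h4 : ∀ j : Fin d, eLpNorm (fun p =>
      ‖extSum F (fun ξ => c ξ * (Complex.I * ((ξ j : ℝ) : ℂ))) ζ p‖ + K * ‖S p‖) 2
      (fluidMeasure h η) ≤ (1 + K) * B := by
    intro j
    refine (eLpNorm_add_le (hcont _).norm ((hcont _).norm.const_mul _) (by norm_num)).trans ?_
    rw [add_mul, one_mul, eLpNorm_norm]
    refine add_le_add (key _ fun ξ => ?_) ?_
    · simpa using abs_coord_le_norm_latticeVec ξ j
    · have h5 : eLpNorm (fun p => (K : ℝ) * ‖S p‖) 2 (fluidMeasure h η) ≤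
          K * eLpNorm S 2 (fluidMeasure h η) := by
        have := eLpNorm_const_smul_le (c := (K : ℝ)) (f := fun p => ‖S p‖) (p := 2)
          (μ := fluidMeasure h η)
        rw [eLpNorm_norm] at this
        simpa [Pi.smul_def] using this
      exact h5.trans (by gcongr)
  refine (Finset.sum_le_sum fun j _ => h4 j).trans ?_
  simp [mul_assoc]

/-- The damping factor equals `1` on the graph of `ζ`, not of `η`. The error at distance at most `δ`
is controlled by `1 - e^{-t} ≤ t`. -/
lemma abs_extSum_surface_sub_le (F : Finset (Fin d → ℤ)) (c : (Fin d → ℤ) → ℂ)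
    {ζ : Horiz d → ℝ} {x : Horiz d} {y δ : ℝ} (h1 : y ≤ ζ x) (h2 : ζ x ≤ y + δ) :
    |(extSum F c ζ (x, y)).re - (∑ ξ ∈ F, c ξ * wave ξ x).re| ≤
      δ * ∑ ξ ∈ F, ‖(latticeVec ξ : Horiz d)‖ * ‖c ξ‖ := by
  rw [← Complex.sub_re]
  refine (Complex.abs_re_le_norm _).trans ?_
  rw [extSum, ← Finset.sum_sub_distrib, Finset.mul_sum]
  refine (norm_sum_le _ _).trans (Finset.sum_le_sum fun ξ _ => ?_)
  set r := ‖(latticeVec ξ : Horiz d)‖ with hr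
  have hr0 : 0 ≤ r := norm_nonneg _
  have h3 : |Real.exp (r * (y - ζ x)) - 1| ≤ r * δ := by
    have h4 := Real.add_one_le_exp (r * (y - ζ x))
    have h5 : Real.exp (r * (y - ζ x)) ≤ 1 := Real.exp_le_one_iff.2
      (mul_nonpos_of_nonneg_of_nonpos hr0 (by linarith))
    rw [abs_of_nonpos (by linarith)]
    nlinarith [mul_le_mul_of_nonneg_left h2 hr0]
  have h6 : c ξ * wave ξ x * (Real.exp (r * (y - ζ x)) : ℂ) - c ξ * wave ξ x =
      c ξ * wave ξ x * ((Real.exp (r * (y - ζ x)) - 1 : ℝ) : ℂ) := by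
    push_cast; ring
  simp only
  rw [h6, norm_mul, norm_mul, norm_wave, mul_one, Complex.norm_real, Real.norm_eq_abs]
  calc ‖c ξ‖ * |Real.exp (r * (y - ζ x)) - 1| ≤ ‖c ξ‖ * (r * δ) := by gcongr
    _ = δ * (r * ‖c ξ‖) := by ring

/-- Functions in `Ḣ^{1/2}` are traces of bounded sequences of smooth functions. -/
lemma MemHHalf.exists_extension {η ψ : Horiz d → ℝ} (hη : IsLipschitzSurface η)
    (hψ : MemHHalf ψ) (h : ℝ) :
    ∃ U : ℕ → Horiz d × ℝ → ℝ, (∀ n, ContDiff ℝ ∞ (U n)) ∧ (∀ n, IsPeriodicX (U n)) ∧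
      (∃ C : ℝ≥0∞, C ≠ ⊤ ∧
        ∀ n, eLpNorm (classical (U n)).grad 2 (fluidMeasure h η) ≤ C) ∧
      Tendsto (fun n => eLpNorm (fun x => U n (x, η x) - ψ x) 2 (torusMeasure d))
        atTop (𝓝 0) := by
  obtain ⟨hp, K, hK⟩ := hη
  obtain ⟨F, hF⟩ := exists_seq_tendsto (atTop : Filter (Finset (Fin d → ℤ)))
  set c := fourierCoeff ψ with hc
  set s : ℕ → ℝ := fun n => ∑ ξ ∈ F n, ‖(latticeVec ξ : Horiz d)‖ * ‖c ξ‖ with hs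
  have hs0 : ∀ n, 0 ≤ s n := fun n => by positivity
  -- Chosen after the truncation `F n`, so that the error `2 * ε n * s n` on the surface is at most
  -- `1 / (n + 1)`.
  set ε : ℕ → ℝ := fun n => 1 / ((n + 1) * (2 * (1 + s n))) with hε
  have hε0 : ∀ n, 0 < ε n := fun n => by have := hs0 n; positivity
  choose ζ hζ pζ lζ bζ using fun n => exists_smooth_approx hK hp (hε0 n)
  have hU : ∀ n, ContDiff ℝ ∞ fun p => (extSum (F n) c (ζ n) p).re := fun n =>
    Complex.reCLM.contDiff.comp (contDiff_extSum (F n) c (hζ n))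
  refine ⟨fun n p => (extSum (F n) c (ζ n) p).re, hU, fun n y k x => ?_,
    ⟨(d * (1 + K) + 1) * ENNReal.ofReal √((2 * Real.pi) ^ d * hHalfNormSq ψ), by finiteness,
      fun n => ?_⟩, ?_⟩
  · exact congrArg Complex.re (isPeriodicX_extSum (F n) c (pζ n) y k x)
  · refine (eLpNorm_grad_extSum_le (F n) c h hK.continuous (hζ n) (lζ n)
      fun x => (bζ n x).1).trans ?_
    gcongr
    exact hψ.summable.sum_le_tsum _ fun ξ _ => by positivity
  · have h1 := (tendsto_trigPoly_sub hψ.memLp).comp hF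
    have h2 : Tendsto (fun n : ℕ => torusMeasure d Set.univ ^ (2 : ℝ≥0∞).toReal⁻¹ *
        ENNReal.ofReal (1 / ((n : ℝ) + 1))) atTop (𝓝 0) := by
      have h3 := (ENNReal.continuous_ofReal.tendsto _).comp
        (tendsto_one_div_add_atTop_nhds_zero_nat (𝕜 := ℝ))
      rw [ENNReal.ofReal_zero] at h3
      have h4 := ENNReal.Tendsto.const_mul (a := torusMeasure d Set.univ ^ (2 : ℝ≥0∞).toReal⁻¹) h3
        (Or.inr (by finiteness))
      simpa using h4
    have h5 := h2.add h1
    rw [add_zero] at h5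
    refine tendsto_of_tendsto_of_tendsto_of_le_of_le tendsto_const_nhds h5 (fun _ => zero_le)
      fun n => ?_
    have hw : Continuous fun x : Horiz d => (∑ ξ ∈ F n, c ξ * wave ξ x).re :=
      Complex.continuous_re.comp
        (continuous_finsetSum _ fun ξ _ => continuous_const.mul (continuous_wave ξ))
    have hsurf : Continuous fun x => (extSum (F n) c (ζ n) (x, η x)).re :=
      (hU n).continuous.comp (by have := hK.continuous; fun_prop)
    calc eLpNorm (fun x => (extSum (F n) c (ζ n) (x, η x)).re - ψ x) 2 (torusMeasure d)
        = eLpNorm ((fun x => (extSum (F n) c (ζ n) (x, η x)).re -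
            (∑ ξ ∈ F n, c ξ * wave ξ x).re) +
            fun x => (∑ ξ ∈ F n, c ξ * wave ξ x).re - ψ x) 2 (torusMeasure d) := by
          congr 1; funext x; simp
      _ ≤ _ := (eLpNorm_add_le (hsurf.sub hw).aestronglyMeasurable
          (hw.aestronglyMeasurable.sub hψ.memLp.1) (by norm_num))
      _ ≤ _ := by
          refine add_le_add (eLpNorm_le_of_ae_bound (Eventually.of_forall fun x => ?_)) le_rfl
          refine (abs_extSum_surface_sub_le (F n) c (bζ n x).1 (bζ n x).2).trans ?_
          have hsn := hs0 n
          change 2 * ε n * s n ≤ _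
          have : 2 * ε n * s n = 1 / ((n : ℝ) + 1) * (s n / (1 + s n)) := by
            simp only [hε]; field_simp
          rw [this]
          refine mul_le_of_le_one_right (by positivity) ((div_le_one (by positivity)).2 ?_)
          linarith

/-- The variational solution of the boundary value problem exists. -/
theorem MemHHalf.exists_isVariationalSolution {η ψ : Horiz d → ℝ} (hη : IsLipschitzSurface η)
    (hψ : MemHHalf ψ) (h : ℝ) : ∃ φ, IsVariationalSolution h η ψ φ := by
  obtain ⟨U, hU, pU, ⟨C, hC, hE⟩, ht⟩ := hψ.exists_extension hη h
  exact WaterWaves.exists_isVariationalSolution hη.2.choose_spec.continuous hη.1 hψ.memLp hU pU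
    hC hE ht

end

/-! ### The quadratic form of `G(η)` and its lower bound. -/

section

variable {d : ℕ} {h : ℝ} {η ψ : Horiz d → ℝ}

lemma IsLipschitzSurface.continuous (hη : IsLipschitzSurface η) : Continuous η :=
  hη.2.choose_spec.continuous

/-- `⟨G(η)ψ, ψ⟩` is the Dirichlet energy of the variational solution. -/
lemma exists_dirichletToNeumann_eq (hη : IsLipschitzSurface η) (hψ : MemHHalf ψ) (h : ℝ) :
    ∃ φ, IsVariationalSolution h η ψ φ ∧
      dirichletToNeumann h η ψ ψ = dirichletForm h η φ φ := by
  obtain ⟨φ₀, hφ₀⟩ := hψ.exists_isVariationalSolution hη h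
  -- Existence excludes the default value `0`. The extension picked by choice is arbitrary, and the
  -- energy identity removes the dependence on it.
  have H : ∃ r, IsDNValue h η ψ ψ r :=
    ⟨_, φ₀, hφ₀, φ₀, hφ₀.memH1, hφ₀.trace, rfl⟩
  obtain ⟨φ, hφ, Φ, hΦ, tΦ, hr⟩ := H.choose_spec
  refine ⟨φ, hφ, ?_⟩
  rw [dirichletToNeumann, dif_pos H, ← hr]
  exact hφ.dirichletForm_eq hη.continuous hη.1 hψ.memLp hΦ tΦ

lemma tanh_pos {h : ℝ} (hh : 0 < h) : 0 < Real.tanh h := by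
  rw [Real.tanh_eq_sinh_div_cosh]
  exact div_pos (Real.sinh_pos_iff.2 hh) (Real.cosh_pos h)

lemma tanh_le_self {h : ℝ} (hh : 0 ≤ h) : Real.tanh h ≤ h := by
  rw [Real.tanh_eq_sinh_div_cosh, div_le_iff₀ (Real.cosh_pos h), mul_comm]
  -- Mean value inequality for `sinh`, whose derivative on `[0, h]` is at most `cosh h`.
  have h1 := (convex_Icc 0 h).image_sub_le_mul_sub_of_deriv_le (C := Real.cosh h)
    Real.continuous_sinh.continuousOn Real.differentiable_sinh.differentiableOn
    (fun x hx => by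
      rw [interior_Icc] at hx
      rw [Real.deriv_sinh]
      exact Real.cosh_le_cosh.2 (abs_le_abs_of_nonneg hx.1.le hx.2.le))
    0 ⟨le_rfl, hh⟩ h ⟨hh, le_rfl⟩ hh
  simpa using h1

/-- The lower bound for the Dirichlet-to-Neumann operator. -/
theorem lower_bound_dirichletToNeumann (hη : IsLipschitzSurface η) (hh : 0 < h)
    (hb : -(h / 2) < ⨅ x, η x) (hψ : MemHHalf ψ) :
    (2 * Real.pi) ^ d / 10 * Real.tanh h / (1 + gradSupNorm η) * hHalfNormSq ψ ≤
      dirichletToNeumann h η ψ ψ := by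
  obtain ⟨φ, hφ, he⟩ := exists_dirichletToNeumann_eq hη hψ h
  have h1 := hHalfNormSq_le_dirichletForm hη hh (hη.lt_of_lt_iInf hb) hψ hφ.memH1 hφ.trace
  rw [he]
  set D := dirichletForm h η φ φ
  have hD : 0 ≤ D := integral_nonneg fun p =>
    add_nonneg real_inner_self_nonneg (mul_self_nonneg _)
  have hL : 0 ≤ gradSupNorm η := ENNReal.toReal_nonneg
  have ht0 : 0 ≤ Real.tanh h := (tanh_pos hh).le
  -- From `tanh h ≤ 1` and `tanh h ≤ h`; this is the source of the constant `1 / 10`.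
  have ht : Real.tanh h * (6 + 4 / h) ≤ 10 := by
    have h3 : Real.tanh h * (4 / h) ≤ 4 := by
      rw [mul_div_assoc', div_le_iff₀ hh]
      linarith [tanh_le_self hh.le]
    linarith [Real.tanh_lt_one h]
  calc (2 * Real.pi) ^ d / 10 * Real.tanh h / (1 + gradSupNorm η) * hHalfNormSq ψ
      ≤ (2 * Real.pi) ^ d / 10 * Real.tanh h / (1 + gradSupNorm η) *
        (((2 * Real.pi) ^ d)⁻¹ * ((1 + gradSupNorm η) * (6 + 4 / h) * D)) := by gcongr
    _ = Real.tanh h * (6 + 4 / h) / 10 * D := by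
        have : (2 * Real.pi) ^ d ≠ 0 := by positivity
        have : 1 + gradSupNorm η ≠ 0 := by positivity
        field_simp
    _ ≤ D := mul_le_of_le_one_left hD (by linarith)

/-! ### Optimality of the exponent: oscillating surfaces as their own data. -/

lemma IsLipschitzSurface.memHHalf (hη : IsLipschitzSurface η) : MemHHalf η := by
  obtain ⟨hp, K, hK⟩ := hη
  refine ⟨hp, memLp_torusMeasure_of_continuous hK.continuous,
    summable_of_sum_le (fun ξ => by unfold hHalfTerm; positivity) fun F =>
      le_trans (Finset.sum_le_sum fun ξ _ => ?_) (sum_normSq_mul_fourierCoeff_le hK hp F)⟩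
  unfold hHalfTerm
  gcongr
  -- For integer vectors `|ξ| ≤ |ξ|²`, so the gradient bound dominates the seminorm.
  rcases eq_or_ne ξ 0 with rfl | h0
  · have : (latticeVec 0 : Horiz d) = 0 := by ext; simp [latticeVec]
    simp [this]
  · exact le_self_pow₀ (one_le_norm_latticeVec h0) two_ne_zero

/-- The vertical coordinate is an extension of the surface elevation. -/
lemma hasTrace_snd : HasTrace h η (classical fun p => p.2) η := by
  refine ⟨fun _ p => p.2, fun _ => ⟨contDiff_snd, fun _ _ _ => rfl⟩, ?_, ?_, ?_, ?_⟩ <;>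
  simp [classical]

lemma gradX_snd : (gradX fun p : Horiz d × ℝ => p.2) = fun _ => 0 := by
  funext p
  simp [gradX, gradient]

lemma derivY_snd : (derivY fun p : Horiz d × ℝ => p.2) = fun _ => 1 := by
  funext p
  simp [derivY]

lemma memH1_snd (hc : Continuous η) (hp : IsPeriodic η) :
    MemH1 h η (classical fun p => p.2) := by
  refine MemH1.of_hasTrace hp (fun _ _ _ => rfl) ?_ ?_
    (memLp_fluidMeasure_of_continuous hc continuous_snd) ?_ ?_ hasTrace_snd
  · simp only [classical, gradX_snd]
    exact fun _ _ _ => rfl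
  · simp only [classical, derivY_snd]
    exact fun _ _ _ => rfl
  · simp only [classical, gradX_snd]
    exact memLp_fluidMeasure_of_continuous hc continuous_const
  · simp only [classical, derivY_snd]
    exact memLp_fluidMeasure_of_continuous hc continuous_const

lemma dirichletForm_snd_le (hc : Continuous η) {m : ℝ} (hm : ∀ x, η x ≤ m) (hmh : 0 ≤ m + h) :
    dirichletForm h η (classical fun p => p.2) (classical fun p => p.2) ≤
      (m + h) * (torusMeasure d).real Set.univ := by
  simp only [dirichletForm, classical, gradX_snd, derivY_snd, inner_zero_left, zero_add, mul_one,
    integral_const, smul_eq_mul]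
  refine ENNReal.toReal_le_of_le_ofReal (by positivity) ?_
  rw [← setLIntegral_one, Measure.restrict_univ, lintegral_fluidMeasure hc (by fun_prop)]
  simp only [setLIntegral_one, Real.volume_Ioo]
  refine (lintegral_mono fun x => ENNReal.ofReal_le_ofReal
    (by linarith [hm x] : η x - -h ≤ m + h)).trans ?_
  rw [lintegral_const, ENNReal.ofReal_mul hmh, measureReal_def,
    ENNReal.ofReal_toReal (by finiteness)]

/-- Steepness costs no energy: the energy of `G(η)η` is at most the area of the fluid domain. -/
lemma dirichletToNeumann_self_le (hη : IsLipschitzSurface η) {m : ℝ} (hm : ∀ x, η x ≤ m)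
    (hmh : 0 ≤ m + h) :
    dirichletToNeumann h η η η ≤ (m + h) * (torusMeasure d).real Set.univ := by
  obtain ⟨φ, hφ, he⟩ := exists_dirichletToNeumann_eq hη hη.memHHalf h
  rw [he]
  exact (hφ.dirichletForm_le hη.continuous hη.1 hη.memHHalf.memLp
    (memH1_snd hη.continuous hη.1) hasTrace_snd).trans
      (dirichletForm_snd_le hη.continuous hm hmh)

/-- Translation by `v` changes the sign of the integrand and preserves its integral. -/
lemma integral_wave_eq_zero {ζ : Fin d → ℤ} {v : Horiz d} (hv : wave ζ v = -1) :
    ∫ x, wave ζ x ∂(torusMeasure d) = 0 := by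
  have h1 := integral_torusMeasure_add (isPeriodic_wave ζ) (continuous_wave ζ) v
  simp only [wave_add, hv, mul_neg, mul_one, integral_neg] at h1
  exact self_eq_neg.1 h1.symm

/-- The surface `a cos(n x_j)`. -/
noncomputable def cosSurface (a : ℝ) (n : ℕ) (j : Fin d) (x : Horiz d) : ℝ :=
  a * Real.cos (n * x j)

variable {a : ℝ} {n : ℕ} {j : Fin d}

lemma lipschitzWith_cosSurface (ha : 0 ≤ a) :
    LipschitzWith (a * n).toNNReal (cosSurface a n j) := by
  refine LipschitzWith.of_dist_le_mul fun x y => ?_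
  rw [Real.coe_toNNReal _ (by positivity)]
  simp only [cosSurface, Real.dist_eq]
  rw [← mul_sub, abs_mul, abs_of_nonneg ha, mul_assoc]
  gcongr
  refine (Real.abs_cos_sub_cos_le _ _).trans ?_
  rw [← mul_sub, abs_mul, Nat.abs_cast]
  gcongr
  rw [dist_eq_norm]
  exact PiLp.norm_apply_le (x - y) j

lemma isLipschitzSurface_cosSurface (ha : 0 ≤ a) : IsLipschitzSurface (cosSurface a n j) := by
  refine ⟨fun k x => ?_, _, lipschitzWith_cosSurface ha⟩
  simp only [cosSurface, latticeVec, PiLp.add_apply, PiLp.smul_apply, smul_eq_mul]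
  congr 1
  rw [mul_add, show (n : ℝ) * (2 * Real.pi * k j) = ((n * k j : ℤ) : ℝ) * (2 * Real.pi) by
    push_cast; ring, Real.cos_add_int_mul_two_pi]

lemma gradSupNorm_cosSurface_le (ha : 0 ≤ a) : gradSupNorm (cosSurface a n j) ≤ a * n :=
  gradSupNorm_le (by positivity) fun x =>
    (norm_gradient_le_of_lipschitz (lipschitzWith_cosSurface ha) x).trans_eq
      (Real.coe_toNNReal _ (by positivity))

lemma wave_single (k : ℤ) (x : Horiz d) :
    wave (Pi.single j k) x = Complex.exp (Complex.I * ((k * x j : ℝ) : ℂ)) := by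
  have : (latticeVec (Pi.single j k) : Horiz d) = EuclideanSpace.single j (k : ℝ) := by
    ext i
    by_cases hi : i = j
    · subst hi; simp [latticeVec]
    · simp [latticeVec, hi]
  rw [wave, this, EuclideanSpace.inner_single_right]
  simp

/-- Multiplying the cosine by the conjugate character leaves the constant `a / 2` and a character of
frequency `-2n`, which has mean zero. -/
lemma fourierCoeff_cosSurface (hn : n ≠ 0) :
    fourierCoeff (cosSurface a n j) (Pi.single j (n : ℤ)) = a / 2 := by
  have h1 : ∀ x : Horiz d, (starRingEnd ℂ) (wave (Pi.single j (n : ℤ)) x) *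
      (cosSurface a n j x : ℂ) = a / 2 * (1 + wave (Pi.single j (-2 * n : ℤ)) x) := by
    intro x
    rw [conj_wave, ← Pi.single_neg, wave_single, wave_single, cosSurface]
    push_cast
    rw [Complex.cos]
    have e1 : Complex.exp (Complex.I * (-n * x j)) * Complex.exp (n * x j * Complex.I) = 1 := by
      rw [← Complex.exp_add]; ring_nf; simp
    have e2 : Complex.exp (Complex.I * (-n * x j)) * Complex.exp (-(n * x j) * Complex.I) =
        Complex.exp (Complex.I * (-2 * n * x j)) := by
      rw [← Complex.exp_add]; ring_nf
    linear_combination (a / 2 : ℂ) * e1 + (a / 2 : ℂ) * e2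
  -- Translation by half a period of the frequency `-2n` gives the phase `-π`.
  have h2 : wave (Pi.single j (-2 * n : ℤ))
      (EuclideanSpace.single j (Real.pi / (2 * n)) : Horiz d) = -1 := by
    have hn' : (n : ℂ) ≠ 0 := by exact_mod_cast hn
    rw [wave_single]
    have : Complex.I * (((-2 * n : ℤ) * (EuclideanSpace.single j (Real.pi / (2 * n)) : Horiz d) j :
        ℝ) : ℂ) = -(Real.pi * Complex.I) := by
      simp
      field_simp
    rw [this, Complex.exp_neg, Complex.exp_pi_mul_I]
    norm_num
  have hp : ((2 * Real.pi) ^ d : ℝ) ≠ 0 := by positivity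
  have h3 : ∫ _ : Horiz d, (1 : ℂ) ∂(torusMeasure d) = ((2 * Real.pi) ^ d : ℝ) := by
    rw [integral_torusMeasure (by fun_prop)]
    simp
  have hi : Integrable (wave (Pi.single j (-2 * n : ℤ)) : Horiz d → ℂ) (torusMeasure d) :=
    memLp_one_iff_integrable.1 (memLp_torusMeasure_of_continuous (continuous_wave _))
  rw [fourierCoeff_eq]
  simp only [h1]
  rw [integral_const_mul, integral_add (integrable_const _) hi, integral_wave_eq_zero h2, h3,
    add_zero, mul_left_comm, ← Complex.ofReal_mul, inv_mul_cancel₀ hp, Complex.ofReal_one, mul_one]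

lemma le_hHalfNormSq_cosSurface (ha : 0 ≤ a) (hn : n ≠ 0) :
    n * (a / 2) ^ 2 ≤ hHalfNormSq (cosSurface a n j) := by
  have h1 := (isLipschitzSurface_cosSurface (n := n) (j := j) ha).memHHalf.summable.le_tsum
    (Pi.single j (n : ℤ)) fun ξ _ => by unfold hHalfTerm; positivity
  refine le_of_eq_of_le ?_ h1
  have h2 : ‖(latticeVec (Pi.single j (n : ℤ)) : Horiz d)‖ = n := by
    rw [← sq_eq_sq₀ (norm_nonneg _) (by positivity), norm_latticeVec_sq]
    rw [Finset.sum_eq_single j] <;> simp +contextual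
  rw [hHalfTerm, fourierCoeff_cosSurface hn, h2, norm_div, Complex.norm_real,
    Real.norm_of_nonneg ha]
  simp

/-- The power of the slope in the lower bound cannot be improved. -/
theorem not_lower_bound_of_lt_one (hd : 1 ≤ d) {α : ℝ} (hα : α < 1) (hh : 0 < h) {C : ℝ}
    (hC : 0 < C) : ∃ η : Horiz d → ℝ, IsLipschitzSurface η ∧ -(h / 2) < ⨅ x, η x ∧
      dirichletToNeumann h η η η <
        C * Real.tanh h / (1 + gradSupNorm η) ^ α * hHalfNormSq η := by
  -- The amplitude stays fixed as `n` grows, and keeps the surface above `-(h / 2)`.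
  set a := h / 4 with ha
  have ha0 : 0 < a := by positivity
  let j : Fin d := ⟨0, hd⟩
  -- The upper bound on the slope can be raised to a power only if the exponent is nonnegative; `β`
  -- still lies below `1`.
  set β := max α 0 with hβ
  have hβ0 : 0 ≤ β := le_max_right _ _
  have hβ1 : 0 < 1 - β := sub_pos.2 (max_lt hα one_pos)
  have ht := tanh_pos hh
  set M := (a + h) * (torusMeasure d).real Set.univ with hM
  set c := C * Real.tanh h * (a / 2) ^ 2 / (1 + a) ^ β with hc
  have hc0 : 0 < c := by positivity
  have hlim : Tendsto (fun n : ℕ => c * (n : ℝ) ^ (1 - β)) atTop atTop :=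
    ((tendsto_rpow_atTop hβ1).comp tendsto_natCast_atTop_atTop).const_mul_atTop hc0
  obtain ⟨n, hn1, hn2⟩ := ((hlim.eventually_gt_atTop M).and (eventually_ge_atTop 1)).exists
  have hn0 : n ≠ 0 := by omega
  have hnr : (1 : ℝ) ≤ n := by exact_mod_cast hn2
  have hη := isLipschitzSurface_cosSurface (n := n) (j := j) ha0.le
  refine ⟨cosSurface a n j, hη, ?_, ?_⟩
  · refine lt_of_lt_of_le (by linarith : -(h / 2) < -a) (le_ciInf fun x => ?_)
    unfold cosSurface
    nlinarith [Real.neg_one_le_cos (n * x j)]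
  · have h1 : dirichletToNeumann h _ _ _ ≤ M := dirichletToNeumann_self_le hη (fun x => by
      unfold cosSurface
      nlinarith [Real.cos_le_one (n * x j)]) (by positivity)
    refine (h1.trans_lt hn1).trans_le ?_
    have hL0 : 0 ≤ gradSupNorm (cosSurface a n j) := ENNReal.toReal_nonneg
    have hL : (1 + gradSupNorm (cosSurface a n j)) ^ α ≤ (1 + a) ^ β * (n : ℝ) ^ β := by
      rw [← Real.mul_rpow (by positivity) (by positivity)]
      refine (Real.rpow_le_rpow_of_exponent_le (by linarith) (le_max_left α 0)).trans
        (Real.rpow_le_rpow (by positivity) ?_ hβ0)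
      -- With `n ≥ 1`, `1 + a * n ≤ (1 + a) * n`.
      have := gradSupNorm_cosSurface_le (n := n) (j := j) ha0.le
      nlinarith
    have hS := le_hHalfNormSq_cosSurface (j := j) ha0.le hn0
    have hn' : (0 : ℝ) < n := by linarith
    calc c * (n : ℝ) ^ (1 - β)
        = C * Real.tanh h / ((1 + a) ^ β * (n : ℝ) ^ β) * (n * (a / 2) ^ 2) := by
          rw [Real.rpow_sub hn', Real.rpow_one, hc]
          field_simp
      _ ≤ _ := by gcongr

end

end WaterWaves

theorem propositionB3 (d : ℕ) (hd : 1 ≤ d) :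
    (∃ C : ℝ, 0 < C ∧ ∀ h : ℝ, 0 < h →
      ∀ η : WaterWaves.Horiz d → ℝ, WaterWaves.IsLipschitzSurface η → -(h / 2) < ⨅ x, η x →
      ∀ ψ : WaterWaves.Horiz d → ℝ, WaterWaves.MemHHalf ψ →
        C * Real.tanh h / (1 + WaterWaves.gradSupNorm η) * WaterWaves.hHalfNormSq ψ
          ≤ WaterWaves.dirichletToNeumann h η ψ ψ) ∧
    (∀ α : ℝ, α < 1 → ∀ h : ℝ, 0 < h → ¬ ∃ C : ℝ, 0 < C ∧
      ∀ η : WaterWaves.Horiz d → ℝ, WaterWaves.IsLipschitzSurface η → -(h / 2) < ⨅ x, η x →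
      ∀ ψ : WaterWaves.Horiz d → ℝ, WaterWaves.MemHHalf ψ →
        C * Real.tanh h / (1 + WaterWaves.gradSupNorm η) ^ α * WaterWaves.hHalfNormSq ψ
          ≤ WaterWaves.dirichletToNeumann h η ψ ψ) := by
  refine ⟨⟨(2 * Real.pi) ^ d / 10, by positivity, fun h hh η hη hb ψ hψ =>
    WaterWaves.lower_bound_dirichletToNeumann hη hh hb hψ⟩, ?_⟩
  rintro α hα h hh ⟨C, hC, H⟩
  obtain ⟨η, hη, hb, hlt⟩ := WaterWaves.not_lower_bound_of_lt_one hd hα hh hC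
  exact hlt.not_ge (H η hη hb η hη.memHHalf)
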